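/- Let $n\ge 2$, $m\ge n-1$ and $d_1,\dots,d_m\ge 1$ be integers, and put $d:=\max_j d_j$, $N_j:=\binom{n+d_j-1}{d_j}$, $N:=\sum_{j=1}^m N_j$. For a system $P=(p_1,\dots,p_m)$ of real forms in $x_1,\dots,x_n$ with $\deg p_j=d_j$, written $p_j(x)=\sum_{|\alpha|=d_j} c_{j,\alpha}\sqrt{\binom{d_j}{\alpha}}\,x^\alpha$, let $\|P\|_W:=\big(\sum_{j}\sum_{|\alpha|=d_j} c_{j,\alpha}^2\big)^{1/2}$ be its Weyl-Bombieri norm. Let $\Delta_m$ be the diagonal matrix with entries $\sqrt{d_1},\dots,\sqrt{d_m}$, let $T_xS^{n-1}=x^\perp$, let $\sigma_{\min}$ denote the smallest singular value (the singular values of $T$ being the square roots of the eigenvalues of $T^\top T$), and set $$L(P,x):=\sqrt{\sigma_{\min}\big(\Delta_m^{-1}DP(x)|_{T_xS^{n-1}}\big)^2+\|P(x)\|_2^2},\qquad \tilde\kappa(P):=\sup_{x\in S^{n-1}}\frac{\|P\|_W}{L(P,x)}\in[0,\infty].$$ There is a universal constant $C>0$ such that the following holds for all such $n,m,d_1,\dots,d_m$.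 Suppose the coefficient vectors $C_j=(c_{j,\alpha})_{|\alpha|=d_j}$, $j=1,\dots,m$, are independent random vectors in $\mathbb{R}^{N_j}$ for which there are constants $K,c_0>0$ with, for every $j$, * (Sub-Gaussian) $\mathrm{Prob}(|\langle C_j,\theta\rangle|\ge t)\le 2e^{-t^2/K^2}$ for all $\theta\in S^{N_j-1}$ and $t>0$; * (Small Ball) $\mathrm{Prob}(|\langle a,C_j\rangle|\le\varepsilon\|a\|_2)\le c_0\varepsilon$ for all $a\in\mathbb{R}^{N_j}\setminus\{0\}$ and $\varepsilon>0$. Let $P$ be the random system with these coefficients. Write $s:=m-n+\tfrac32$ and $$M:=\sqrt{\tfrac{N}{m}}\,(Kc_0C)^{\frac{m}{s}}\,(3d^2\log(ed))^{\frac{n-3/2}{s}}\,n^{\frac{1}{2m-2n+3}}\max\Big\{d^6,\frac{n}{d^2}\Big\},$$ and, for $0<q<s$, $$\delta_1:=\frac{q\sqrt{\pi n}}{s}\Big(\frac{n-\frac32}{2em\log(ed)}\Big)^{\frac{n-3/2}{2}}\frac{1}{(1-\frac qs)^{n/2}},\qquad \delta_2:=\Big(\frac mN\Big)^{\frac s2}\frac{q\sqrt{\pi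 m}\,e^{-m/2}}{(s-q)(1-\frac qs)^{m/2}(\log(ed))^{\frac n2-1}}.$$ 1. If $N\ge m\log(ed)$, then: * for $q\in(0,s)$, $\big(\mathbb{E}\,\tilde\kappa(P)^q\big)^{1/q}\le M\big(1+\frac{q}{m-n-q+2}+\delta_1+\delta_2\big)^{1/q}$; * for $q\in\big(0,s\big(1-\frac{1}{2\log(ed)}\big)\big]$, $\big(\mathbb{E}\,\tilde\kappa(P)^q\big)^{1/q}\le M\big(\frac{3m\log(ed)}{n}\big)^{1/q}$; * for $q\in(0,\frac s2]$, $\big(\mathbb{E}\,\tilde\kappa(P)^q\big)^{1/q}\le 4^{1/q}M$; * $\mathbb{E}(\log\tilde\kappa(P))\le 1+\log M$. 2. If $N\le m\log(ed)$, then: * for $q\in(0,s)$, $\big(\mathbb{E}\,\tilde\kappa(P)^q\big)^{1/q}\le M\big(1+\frac{q}{m-n-q+\frac32}+\delta_2\big)^{1/q}$; * for $q\in\big(0,s\big(1-\frac{m}{eN}\big)\big]$, $\big(\mathbb{E}\,\tilde\kappa(P)^q\big)^{1/q}\le M\big(\frac{3m\log(ed)}{n}\big)^{1/q}$; * for $q\in(0,\frac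 s2]$, $\big(\mathbb{E}\,\tilde\kappa(P)^q\big)^{1/q}\le 4^{1/q}M$; * $\mathbb{E}(\log\tilde\kappa(P))\le 1+\log M$. In both cases $0<\tilde\kappa(P)<\infty$ almost surely and $\log\tilde\kappa(P)$ is integrable. -/

import Mathlib

open MeasureTheory ProbabilityTheory

noncomputable section

/-- Exponent vectors `α = (α₁, …, αₙ)` of natural numbers with `α₁ + ⋯ + αₙ = k`. -/
abbrev MultiIndex (n k : ℕ) : Type :=
  {α : Fin n → ℕ // α ∈ Finset.piAntidiag (Finset.univ : Finset (Fin n)) k}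

/-- The exponent vector `α` as the exponent of a monomial. -/
def MultiIndex.toFinsupp {n k : ℕ} (α : MultiIndex n k) : Fin n →₀ ℕ :=
  Finsupp.equivFunOnFinite.symm α.1

/-- The multinomial coefficient `k! / (α₁! ⋯ αₙ!)`. -/
def MultiIndex.multinomial {n k : ℕ} (α : MultiIndex n k) : ℕ :=
  Nat.multinomial Finset.univ α.1

/-- The form `∑_{|α| = k} c_α √(k choose α) x^α` of degree `k` with coefficient vector `c`. -/
def formOfCoeff {n k : ℕ} (c : EuclideanSpace ℝ (MultiIndex n k)) : MvPolynomial (Fin n) ℝ :=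
  ∑ α : MultiIndex n k, MvPolynomial.monomial α.toFinsupp (c α * √(α.multinomial : ℝ))

/-- The Weyl-Bombieri norm of a system `P` of forms of degrees `deg 1, …, deg m`:
the square root of the sum over `j` and `|α| = deg j` of
`(coefficient of x^α in p_j)² / (deg j choose α)`. -/
def weylNorm {n m : ℕ} (deg : Fin m → ℕ) (P : Fin m → MvPolynomial (Fin n) ℝ) : ℝ :=
  √(∑ j, ∑ α : MultiIndex n (deg j),
    (MvPolynomial.coeff α.toFinsupp (P j)) ^ 2 / (α.multinomial : ℝ))

/-- The `m × n` Jacobian matrix of `P` at `x`. -/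
def jacobianMatrix {n m : ℕ} (P : Fin m → MvPolynomial (Fin n) ℝ)
    (x : EuclideanSpace ℝ (Fin n)) : Matrix (Fin m) (Fin n) ℝ :=
  Matrix.of fun j i => MvPolynomial.eval x.ofLp (MvPolynomial.pderiv i (P j))

/-- The linear map `Δ⁻¹ DP(x)` restricted to the tangent space `x^⊥` of the unit sphere at `x`,
where `Δ` is the diagonal matrix with entries `√(deg 1), …, √(deg m)`. -/
def tangentJacobian {n m : ℕ} (deg : Fin m → ℕ) (P : Fin m → MvPolynomial (Fin n) ℝ)
    (x : EuclideanSpace ℝ (Fin n)) : (ℝ ∙ x)ᗮ →ₗ[ℝ] EuclideanSpace ℝ (Fin m) :=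
  (Matrix.toEuclideanLin
    (Matrix.diagonal (fun j => (√(deg j : ℝ))⁻¹) * jacobianMatrix P x)).domRestrict (ℝ ∙ x)ᗮ

/-- The smallest singular value of `T : E → F`, that is, the square root of the smallest of the
`dim E` eigenvalues of `T* T` (Mathlib lists the singular values in decreasing order, from
index `0`). -/
def sigmaMin {E F : Type*} [NormedAddCommGroup E] [InnerProductSpace ℝ E] [FiniteDimensional ℝ E]
    [NormedAddCommGroup F] [InnerProductSpace ℝ F] [FiniteDimensional ℝ F] (T : E →ₗ[ℝ] F) : ℝ :=
  T.singularValues (Module.finrank ℝ E - 1)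

/-- `L(P, x) = √(σ_min(Δ⁻¹ DP(x)|_{T_x S^{n-1}})² + ‖P(x)‖₂²)`. -/
def condL {n m : ℕ} (deg : Fin m → ℕ) (P : Fin m → MvPolynomial (Fin n) ℝ)
    (x : EuclideanSpace ℝ (Fin n)) : ℝ :=
  √(sigmaMin (tangentJacobian deg P x) ^ 2 + ∑ j, (MvPolynomial.eval x.ofLp (P j)) ^ 2)

/-- The local condition number `‖P‖_W / L(P, x)`, which is infinite where `L(P, x) = 0`
and `P ≠ 0`. -/
def kappaLoc {n m : ℕ} (deg : Fin m → ℕ) (P : Fin m → MvPolynomial (Fin n) ℝ)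
    (x : EuclideanSpace ℝ (Fin n)) : ENNReal :=
  ENNReal.ofReal (weylNorm deg P) / ENNReal.ofReal (condL deg P x)

/-- The global condition number for real solving: the supremum of the local one over `S^{n-1}`. -/
def kappa {n m : ℕ} (deg : Fin m → ℕ) (P : Fin m → MvPolynomial (Fin n) ℝ) : ENNReal :=
  ⨆ x ∈ Metric.sphere (0 : EuclideanSpace ℝ (Fin n)) 1, kappaLoc deg P x

/-- The Sub-Gaussian assumption with constant `K`. -/
def IsSubGaussianVector {Ω ι : Type*} [MeasurableSpace Ω] [Fintype ι] (μ : Measure Ω)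
    (X : Ω → EuclideanSpace ℝ ι) (K : ℝ) : Prop :=
  ∀ θ : EuclideanSpace ℝ ι, ‖θ‖ = 1 → ∀ t : ℝ, 0 < t →
    μ.real {ω | t ≤ |inner ℝ (X ω) θ|} ≤ 2 * Real.exp (-t ^ 2 / K ^ 2)

/-- The Small Ball assumption with constant `c₀`. (The vector `a = 0`, for which the inequality
cannot hold, is excluded.) -/
def HasSmallBall {Ω ι : Type*} [MeasurableSpace Ω] [Fintype ι] (μ : Measure Ω)
    (X : Ω → EuclideanSpace ℝ ι) (c₀ : ℝ) : Prop :=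
  ∀ a : EuclideanSpace ℝ ι, a ≠ 0 → ∀ ε : ℝ, 0 < ε →
    μ.real {ω | |inner ℝ a (X ω)| ≤ ε * ‖a‖} ≤ c₀ * ε

/-- `d = max_j deg j`. -/
def maxDeg {m : ℕ} (deg : Fin m → ℕ) : ℕ := Finset.univ.sup deg

/-- `N = ∑_j N_j`, with `N_j = (n + deg j - 1 choose deg j)`. -/
def totalN (n : ℕ) {m : ℕ} (deg : Fin m → ℕ) : ℕ := ∑ j, (n + deg j - 1).choose (deg j)

/-- `log(e d)`. -/
def logE (d : ℕ) : ℝ := Real.log (Real.exp 1 * d)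

/-- The exponent `m - n + 3/2`. -/
def gap (n m : ℕ) : ℝ := (m : ℝ) - n + 3 / 2

/-- The quantity `M` that scales the condition number bounds. -/
def boundM (C K c₀ : ℝ) (n m N d : ℕ) : ℝ :=
  √((N : ℝ) / m) * (K * c₀ * C) ^ ((m : ℝ) / gap n m)
    * (3 * (d : ℝ) ^ 2 * logE d) ^ (((n : ℝ) - 3 / 2) / gap n m)
    * (n : ℝ) ^ (1 / (2 * (m : ℝ) - 2 * n + 3))
    * max ((d : ℝ) ^ 6) ((n : ℝ) / (d : ℝ) ^ 2)

/-- The error term `δ₁`. -/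
def delta₁ (n m d : ℕ) (q : ℝ) : ℝ :=
  q * √(Real.pi * n) / gap n m
    * (((n : ℝ) - 3 / 2) / (2 * Real.exp 1 * m * logE d)) ^ (((n : ℝ) - 3 / 2) / 2)
    * (1 / (1 - q / gap n m) ^ ((n : ℝ) / 2))

/-- The error term `δ₂`. -/
def delta₂ (n m N d : ℕ) (q : ℝ) : ℝ :=
  ((m : ℝ) / N) ^ (gap n m / 2)
    * (q * √(Real.pi * m) * Real.exp (-(m : ℝ) / 2)
      / ((gap n m - q) * (1 - q / gap n m) ^ ((m : ℝ) / 2) * logE d ^ ((n : ℝ) / 2 - 1)))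

/-- `E(X^q)^{1/q}` for a random variable with values in `[0, ∞]`. -/
def qMean {Ω : Type*} [MeasurableSpace Ω] (μ : Measure Ω) (X : Ω → ENNReal) (q : ℝ) : ENNReal :=
  (∫⁻ ω, X ω ^ q ∂μ) ^ (1 / q)

/-- `X` is almost surely positive and finite, `log X` is integrable, and `E(log X) ≤ b`. -/
def ExpectedLogLE {Ω : Type*} [MeasurableSpace Ω] (μ : Measure Ω) (X : Ω → ENNReal)
    (b : ℝ) : Prop :=
  (∀ᵐ ω ∂μ, 0 < X ω ∧ X ω < ⊤) ∧ Integrable (fun ω => Real.log (X ω).toReal) μ ∧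
    ∫ ω, Real.log (X ω).toReal ∂μ ≤ b

end

/-! The theorem is a tail bound for κ, integrated over an exponential scale. κ is a supremum of
‖P‖_W / `condPair` over orthonormal pairs (x, y). So if κ ≥ T and ‖P‖_W ≤ b, some x has both P(x)
and one tangential derivative of size about α = 2b/T (the derivative up to a factor √d). If moreover
‖P‖ ≤ R on the sphere, then ‖P‖ ≤ 4α on a whole neighbourhood of x in a shell just inside the
sphere. Along the ray, homogeneity allows a length of order 1/d. In direction y the second order
Taylor estimate allows √(α/R)/d. In the other n - 2 directions the first order estimate allows
(α/R)/d. The volume is therefore at least (α/R)^(n-3/2) (14d)^(-n) times that of the unit ball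
(`IsFormSystem.volume_small_ge`); the half-integer comes from the one elongated direction.

At a fixed point of the shell, independence and the small ball assumption make the probability of
‖P(z)‖ ≤ 4α at most (96 c₀ α/√m)^m. Tonelli and Markov, applied to the random volume, bound the bad
event by (14d)^n (R/α)^(n-3/2) (96 c₀ α/√m)^m, in which α has the positive exponent s = m - n + 3/2
(`measure_le_kappa_le`). The same averaging over volume, with exponential moments in place of small
balls, controls R and b, so no net is ever used. The Taylor estimates come from a Bernstein
inequality for trigonometric polynomials on great circles.

With R² of order K²(m log(ed) + w), b² of order K²(N + w) and T = M e^(w/s), the exponent s of α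
turns T into the decay e^(-w), times a polynomial growth factor and a constant containing 10^(-4m)
d^(3-n-6s) (`measure_boundM_mul_exp_le_kappa_le`). Then E κ^q ≤ M^q (1 + (q/s) ∫ tail(w) e^(qw/s)
dw), and the e^(-w) term leaves the weight e^(-xw) with x = 1 - q/s. The ranges w ≤ m log(ed), m
log(ed) ≤ w ≤ N and w ≥ N give the three error terms of the sharp bound. When x ≥ 1/(e log(ed)), one
cruder estimate yields E κ^q ≤ (5/4) M^q, which settles all remaining moment bounds and, through log
y ≤ (y^q - 1)/q, the logarithmic one. -/

/-! ### Bernstein and Taylor estimates for trigonometric polynomials. -/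

section TrigPolynomials

/-- Trigonometric polynomials of degree at most `d`, in the form `e^{-idθ} G(e^{iθ})` with
`G` a complex polynomial of degree at most `2d`. -/
def IsTrigPoly (d : ℕ) (f : ℝ → ℂ) : Prop :=
  ∃ G : Polynomial ℂ, G.natDegree ≤ 2 * d ∧
    ∀ θ : ℝ, f θ = Complex.exp (-(d * θ * Complex.I)) * G.eval (Complex.exp (θ * Complex.I))

namespace IsTrigPoly

theorem const (d : ℕ) (a : ℂ) : IsTrigPoly d (fun _ => a) := by
  refine ⟨Polynomial.C a * Polynomial.X ^ d, ?_, fun θ => ?_⟩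
  · exact (Polynomial.natDegree_C_mul_X_pow_le a d).trans (by omega)
  · simp only [Polynomial.eval_mul, Polynomial.eval_C, Polynomial.eval_pow, Polynomial.eval_X]
    rw [mul_left_comm, ← Complex.exp_nat_mul, ← Complex.exp_add]
    rw [show -(d * θ * Complex.I) + d * (θ * Complex.I) = 0 by ring]
    simp

theorem add {d : ℕ} {f g : ℝ → ℂ} (hf : IsTrigPoly d f) (hg : IsTrigPoly d g) :
    IsTrigPoly d (fun θ => f θ + g θ) := by
  obtain ⟨F, hF, hf⟩ := hf
  obtain ⟨G, hG, hg⟩ := hg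
  refine ⟨F + G, (Polynomial.natDegree_add_le _ _).trans (max_le hF hG), fun θ => ?_⟩
  simp only [hf, hg, Polynomial.eval_add, mul_add]

theorem mul {d e : ℕ} {f g : ℝ → ℂ} (hf : IsTrigPoly d f) (hg : IsTrigPoly e g) :
    IsTrigPoly (d + e) (fun θ => f θ * g θ) := by
  obtain ⟨F, hF, hf⟩ := hf
  obtain ⟨G, hG, hg⟩ := hg
  refine ⟨F * G, Polynomial.natDegree_mul_le.trans (by omega), fun θ => ?_⟩
  simp only [hf, hg, Polynomial.eval_mul, Nat.cast_add, add_mul, neg_add, Complex.exp_add]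
  ring

theorem mono {d e : ℕ} {f : ℝ → ℂ} (hf : IsTrigPoly d f) (h : d ≤ e) : IsTrigPoly e f := by
  obtain ⟨k, rfl⟩ := Nat.exists_eq_add_of_le h
  simpa using hf.mul (const k 1)

theorem const_mul {d : ℕ} {f : ℝ → ℂ} (hf : IsTrigPoly d f) (a : ℂ) :
    IsTrigPoly d (fun θ => a * f θ) := by
  simpa using (const 0 a).mul hf

theorem pow {d : ℕ} {f : ℝ → ℂ} (hf : IsTrigPoly d f) (k : ℕ) :
    IsTrigPoly (k * d) (fun θ => f θ ^ k) := by
  induction k with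
  | zero => simpa using const 0 1
  | succ k ih =>
    rw [add_mul, one_mul]
    simpa only [pow_succ] using ih.mul hf

theorem prod {ι : Type*} (s : Finset ι) (k : ι → ℕ) (f : ι → ℝ → ℂ)
    (h : ∀ i ∈ s, IsTrigPoly (k i) (f i)) :
    IsTrigPoly (∑ i ∈ s, k i) (fun θ => ∏ i ∈ s, f i θ) := by
  classical
  induction s using Finset.induction_on with
  | empty => simpa using const 0 1
  | insert i s hi ih =>
    simp only [Finset.sum_insert hi, Finset.prod_insert hi]
    exact (h i (Finset.mem_insert_self i s)).mul
      (ih fun j hj => h j (Finset.mem_insert_of_mem hj))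

theorem sum {ι : Type*} (s : Finset ι) {d : ℕ} (f : ι → ℝ → ℂ)
    (h : ∀ i ∈ s, IsTrigPoly d (f i)) : IsTrigPoly d (fun θ => ∑ i ∈ s, f i θ) := by
  classical
  induction s using Finset.induction_on with
  | empty => simpa using const d 0
  | insert i s hi ih =>
    simp only [Finset.sum_insert hi]
    exact (h i (Finset.mem_insert_self i s)).add
      (ih fun j hj => h j (Finset.mem_insert_of_mem hj))

theorem cos_sin (a b : ℝ) :
    IsTrigPoly 1 (fun θ => ((Real.cos θ * a + Real.sin θ * b : ℝ) : ℂ)) := by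
  refine ⟨Polynomial.C ((a - b * Complex.I) / 2) * Polynomial.X ^ 2 +
    Polynomial.C ((a + b * Complex.I) / 2), ?_, fun θ => ?_⟩
  · refine (Polynomial.natDegree_add_le _ _).trans (max_le ?_ ?_)
    · exact (Polynomial.natDegree_C_mul_X_pow_le _ _).trans (by omega)
    · simp
  · simp only [Polynomial.eval_add, Polynomial.eval_mul, Polynomial.eval_C, Polynomial.eval_pow,
      Polynomial.eval_X, Nat.cast_one, one_mul]
    have h1 : Complex.exp (-(θ * Complex.I)) * Complex.exp (θ * Complex.I) = 1 := by
      rw [← Complex.exp_add]; simp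
    push_cast
    rw [Complex.cos, Complex.sin, neg_mul]
    linear_combination (-(a - b * Complex.I) / 2 * Complex.exp (θ * Complex.I)) * h1

end IsTrigPoly

/-- A polynomial of degree at most `k` that is bounded by `H` on the unit circle is bounded by
`H |z|^k` outside the unit disk. -/
theorem norm_eval_le_of_circle {G : Polynomial ℂ} {k : ℕ} (hG : G.natDegree ≤ k) {H : ℝ}
    (h : ∀ z : ℂ, ‖z‖ = 1 → ‖G.eval z‖ ≤ H) {z : ℂ} (hz : 1 ≤ ‖z‖) :
    ‖G.eval z‖ ≤ H * ‖z‖ ^ k := by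
  -- The reversed polynomial z^k G(1/z) has the same bound on the unit circle, and the maximum
  -- principle carries it to the inside of the disk.
  have key : ∀ w : ℂ, w ≠ 0 → (G.reflect k).eval w⁻¹ * w ^ k = G.eval w := by
    intro w hw
    have : Invertible w := invertibleOfNonzero hw
    have := Polynomial.eval₂_reflect_mul_pow (RingHom.id ℂ) w k G hG
    simpa [Polynomial.eval₂_eq_eval_map] using this
  have hz0 : z ≠ 0 := by
    rintro rfl; simp at hz; linarith
  have hb : ‖(G.reflect k).eval z⁻¹‖ ≤ H := by
    have hd : DiffContOnCl ℂ (fun w => (G.reflect k).eval w) (Metric.ball (0 : ℂ) 1) :=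
      (G.reflect k).differentiable.diffContOnCl
    refine Complex.norm_le_of_forall_mem_frontier_norm_le Metric.isBounded_ball hd ?_ ?_
    · intro w hw
      rw [frontier_ball _ one_ne_zero, mem_sphere_zero_iff_norm] at hw
      have hw0 : w ≠ 0 := by
        rintro rfl; simp at hw
      have h2 := key w⁻¹ (inv_ne_zero hw0)
      have h3 := h w⁻¹ (by rw [norm_inv, hw, inv_one])
      rw [← h2, inv_inv, norm_mul, norm_pow, norm_inv, hw] at h3
      simpa using h3
    · rw [closure_ball _ one_ne_zero, mem_closedBall_zero_iff, norm_inv]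
      exact inv_le_one_of_one_le₀ hz
  rw [← key z hz0, norm_mul, norm_pow]
  gcongr

/-- Cauchy's estimate on a circle of radius 1/k: there the polynomial has grown by at most (1 +
1/k)^k ≤ e ≤ 3. -/
theorem norm_eval_derivative_le_of_circle {G : Polynomial ℂ} {k : ℕ} (hk : 0 < k)
    (hG : G.natDegree ≤ k) {H : ℝ} (h : ∀ z : ℂ, ‖z‖ = 1 → ‖G.eval z‖ ≤ H) {w : ℂ}
    (hw : ‖w‖ = 1) : ‖G.derivative.eval w‖ ≤ 3 * k * H := by
  have hH : 0 ≤ H := (norm_nonneg _).trans (h w hw)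
  have hk' : (0 : ℝ) < k := by exact_mod_cast hk
  have hb : ∀ z ∈ Metric.sphere w (1 / k : ℝ), ‖G.eval z‖ ≤ 3 * H := by
    intro z hz
    have hzn : ‖z‖ ≤ 1 + 1 / k := by
      have : ‖z‖ ≤ ‖w‖ + ‖z - w‖ := by
        simpa using norm_add_le w (z - w)
      rw [mem_sphere_iff_norm] at hz
      linarith
    have hmax : ‖G.eval z‖ ≤ H * (1 + 1 / k : ℝ) ^ k := by
      rcases le_total 1 ‖z‖ with h1 | h1
      · refine (norm_eval_le_of_circle hG h h1).trans ?_
        gcongr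
      · have : ‖G.eval z‖ ≤ H := by
          refine Complex.norm_le_of_forall_mem_frontier_norm_le (f := fun w => G.eval w)
            (Metric.isBounded_ball (x := (0 : ℂ)) (r := 1)) G.differentiable.diffContOnCl ?_ ?_
          · intro v hv
            rw [frontier_ball _ one_ne_zero, mem_sphere_zero_iff_norm] at hv
            exact h v hv
          · rwa [closure_ball _ one_ne_zero, mem_closedBall_zero_iff]
        refine this.trans (le_mul_of_one_le_right hH (one_le_pow₀ ?_))
        have : 0 < 1 / (k : ℝ) := by positivity
        linarith
    have he : (1 + 1 / k : ℝ) ^ k ≤ 3 := by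
      have h1 : (1 + 1 / k : ℝ) ≤ Real.exp (1 / k) := by
        rw [add_comm]; exact Real.add_one_le_exp _
      calc (1 + 1 / k : ℝ) ^ k ≤ Real.exp (1 / k) ^ k := by gcongr
        _ = Real.exp 1 := by
          rw [← Real.exp_nat_mul]; congr 1; field_simp
        _ ≤ 3 := by linarith [Real.exp_one_lt_d9]
    calc _ ≤ _ := hmax
      _ ≤ H * 3 := by gcongr
      _ = 3 * H := by ring
  have := Complex.norm_deriv_le_of_forall_mem_sphere_norm_le (f := fun w => G.eval w) (c := w)
    (by positivity : (0 : ℝ) < 1 / k) G.differentiable.diffContOnCl hb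
  rw [Polynomial.deriv] at this
  calc _ ≤ _ := this
    _ = 3 * k * H := by field_simp

/-- Bernstein's inequality, up to a constant: the derivative of a trigonometric polynomial `f` of
degree at most `d` is a trigonometric polynomial of degree at most `d`, and is bounded by `7 d`
times the supremum of `|f|`. -/
theorem IsTrigPoly.exists_hasDerivAt {d : ℕ} (hd : 0 < d) {f : ℝ → ℂ} (hf : IsTrigPoly d f)
    {H : ℝ} (hH : ∀ θ, ‖f θ‖ ≤ H) :
    ∃ g : ℝ → ℂ, IsTrigPoly d g ∧ (∀ θ, HasDerivAt f (g θ) θ) ∧ ∀ θ, ‖g θ‖ ≤ 7 * d * H := by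
  obtain ⟨G, hG, hf⟩ := hf
  -- Differentiating e^(-idθ) G(e^(iθ)) replaces G by i(zG' - dG). The constant 7d is 3·(2d) from
  -- G', of degree bound 2d, plus d from the second term.
  let g : ℝ → ℂ := fun θ => Complex.exp (-(d * θ * Complex.I)) *
    (Complex.I • (Polynomial.X * G.derivative - (d : ℂ) • G)).eval (Complex.exp (θ * Complex.I))
  refine ⟨g, ⟨_, ?_, fun θ => rfl⟩, ?_, ?_⟩
  · refine (Polynomial.natDegree_smul_le _ _).trans ?_
    refine (Polynomial.natDegree_sub_le _ _).trans (max_le ?_ ?_)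
    · refine Polynomial.natDegree_mul_le.trans ?_
      have := Polynomial.natDegree_derivative_le G
      rw [Polynomial.natDegree_X]
      omega
    · exact (Polynomial.natDegree_smul_le _ _).trans hG
  · intro θ
    have h1 : HasDerivAt (fun θ : ℝ => Complex.exp (θ * Complex.I))
        (Complex.exp (θ * Complex.I) * Complex.I) θ := by
      have : HasDerivAt (fun θ : ℝ => (θ : ℂ) * Complex.I) (1 * Complex.I) θ :=
        (Complex.ofRealCLM.hasDerivAt).mul_const _
      simpa using this.cexp
    have h2 : HasDerivAt (fun θ : ℝ => Complex.exp (-(d * θ * Complex.I)))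
        (Complex.exp (-(d * θ * Complex.I)) * (-(d * Complex.I))) θ := by
      have : HasDerivAt (fun θ : ℝ => -((d : ℂ) * θ * Complex.I)) (-((d : ℂ) * 1 * Complex.I)) θ :=
        (((Complex.ofRealCLM.hasDerivAt).const_mul _).mul_const _).neg
      simpa using this.cexp
    have h3 := HasDerivAt.comp θ (h₂ := fun w => G.eval w)
      (G.hasDerivAt (Complex.exp (θ * Complex.I))) h1
    have h4 := h2.mul h3
    have : f = (fun θ : ℝ => Complex.exp (-(d * θ * Complex.I))) *
        ((fun w => G.eval w) ∘ fun θ : ℝ => Complex.exp (θ * Complex.I)) := by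
      funext θ; exact hf θ
    rw [this]
    refine h4.congr_deriv ?_
    simp only [g, Polynomial.eval_smul, Polynomial.eval_sub, Polynomial.eval_mul,
      Polynomial.eval_X, smul_eq_mul, Function.comp_apply]
    ring
  · intro θ
    have hn : ∀ a : ℝ, ‖Complex.exp (-(d * a * Complex.I))‖ = 1 := by
      intro a
      have := Complex.norm_exp_ofReal_mul_I (-(d * a))
      rw [← this]; congr 2; push_cast; ring
    have hc : ∀ z : ℂ, ‖z‖ = 1 → ‖G.eval z‖ ≤ H := by
      intro z hz
      have h5 := hH (Complex.arg z)
      rw [hf, norm_mul, hn, one_mul] at h5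
      have : Complex.exp (Complex.arg z * Complex.I) = z := by
        have := Complex.norm_mul_exp_arg_mul_I z
        rwa [hz, Complex.ofReal_one, one_mul] at this
      rwa [this] at h5
    have hw : ‖Complex.exp (θ * Complex.I)‖ = 1 := Complex.norm_exp_ofReal_mul_I θ
    have hd' := norm_eval_derivative_le_of_circle (k := 2 * d) (by omega) hG hc hw
    have h0 := hc _ hw
    simp only [g, norm_mul, hn, one_mul, Polynomial.eval_smul, Polynomial.eval_sub,
      Polynomial.eval_mul, Polynomial.eval_X, smul_eq_mul, Complex.norm_I]
    refine (norm_sub_le _ _).trans ?_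
    rw [norm_mul, norm_mul, hw, one_mul, Complex.norm_natCast]
    push_cast at hd'
    have : (d : ℝ) * ‖G.eval (Complex.exp (θ * Complex.I))‖ ≤ d * H := by gcongr
    linarith

/-- First and second order Taylor estimates for trigonometric polynomials. -/
theorem IsTrigPoly.taylor {d : ℕ} (hd : 0 < d) {f : ℝ → ℂ} (hf : IsTrigPoly d f)
    {H : ℝ} (hH : ∀ θ, ‖f θ‖ ≤ H) (θ : ℝ) :
    ‖f θ - f 0‖ ≤ 7 * d * H * |θ| ∧
      ∀ a : ℂ, HasDerivAt f a 0 → ‖f θ - f 0 - θ * a‖ ≤ 49 * d ^ 2 * H * θ ^ 2 := by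
  obtain ⟨g, hg, hfg, hgH⟩ := hf.exists_hasDerivAt hd hH
  obtain ⟨k, hk, hgk, hkH⟩ := hg.exists_hasDerivAt hd hgH
  have hgl : ∀ t, ‖g t - g 0‖ ≤ 7 * d * (7 * d * H) * |t| := by
    intro t
    have := convex_univ.norm_image_sub_le_of_norm_hasDerivWithin_le (f := g) (f' := k)
      (C := 7 * d * (7 * d * H)) (x := 0) (y := t) (fun x _ => (hgk x).hasDerivWithinAt)
      (fun x _ => hkH x) (Set.mem_univ _) (Set.mem_univ _)
    simpa using this
  constructor
  · have := convex_univ.norm_image_sub_le_of_norm_hasDerivWithin_le (f := f) (f' := g)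
      (C := 7 * d * H) (x := 0) (y := θ) (fun x _ => (hfg x).hasDerivWithinAt)
      (fun x _ => hgH x) (Set.mem_univ _) (Set.mem_univ _)
    simpa using this
  · intro a ha
    have hH0 : 0 ≤ H := (norm_nonneg _).trans (hH 0)
    obtain rfl : a = g 0 := ha.unique (hfg 0)
    have := (convex_uIcc (0 : ℝ) θ).norm_image_sub_le_of_norm_hasDerivWithin_le
      (f := fun t => f t - t * g 0) (f' := fun t => g t - g 0)
      (C := 7 * d * (7 * d * H) * |θ|) (x := 0) (y := θ)
      (fun x _ => ?_) (fun x hx => ?_) Set.left_mem_uIcc Set.right_mem_uIcc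
    · simp only [Complex.ofReal_zero, zero_mul, sub_zero] at this
      calc ‖f θ - f 0 - θ * g 0‖ = ‖f θ - θ * g 0 - f 0‖ := by congr 1; ring
        _ ≤ _ := this
        _ = 49 * d ^ 2 * H * (|θ| * |θ|) := by rw [Real.norm_eq_abs]; ring
        _ = 49 * d ^ 2 * H * θ ^ 2 := by rw [abs_mul_abs_self, sq θ]
    · have h2 : HasDerivAt (fun t : ℝ => (t : ℂ) * g 0) (1 * g 0) x :=
        (Complex.ofRealCLM.hasDerivAt).mul_const _
      rw [one_mul] at h2
      exact ((hfg x).sub h2).hasDerivWithinAt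
    · refine (hgl x).trans ?_
      have : |x| ≤ |θ| := by
        rcases Set.mem_uIcc.1 hx with ⟨h1, h2⟩ | ⟨h1, h2⟩
        · rw [abs_of_nonneg h1]; exact h2.trans (le_abs_self _)
        · rw [abs_of_nonpos h2, abs_of_nonpos (h1.trans h2)]; linarith
      gcongr

end TrigPolynomials

/-! ### Forms as inner products with weighted monomials. -/

section Forms

variable {n k : ℕ}

theorem MultiIndex.sum_eq (α : MultiIndex n k) : ∑ i, α.1 i = k :=
  (Finset.mem_piAntidiag.1 α.2).1

theorem MultiIndex.multinomial_pos (α : MultiIndex n k) : 0 < α.multinomial :=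
  Nat.multinomial_pos _ _

theorem MultiIndex.toFinsupp_injective :
    Function.Injective (MultiIndex.toFinsupp : MultiIndex n k → Fin n →₀ ℕ) :=
  fun _ _ h => Subtype.ext (Finsupp.equivFunOnFinite.symm.injective h)

/-- The vector of weighted monomials `√(k choose α) x^α`. -/
noncomputable def veroneseVec (k : ℕ) (x : EuclideanSpace ℝ (Fin n)) :
    EuclideanSpace ℝ (MultiIndex n k) :=
  WithLp.toLp 2 fun α => √(α.multinomial : ℝ) * ∏ i, x i ^ α.1 i

theorem eval_monomial_toFinsupp (α : MultiIndex n k) (a : ℝ) (x : Fin n → ℝ) :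
    MvPolynomial.eval x (MvPolynomial.monomial α.toFinsupp a) = a * ∏ i, x i ^ α.1 i := by
  rw [MvPolynomial.eval_monomial, Finsupp.prod_fintype _ _ (fun i => pow_zero _)]
  rfl

theorem eval_formOfCoeff (c : EuclideanSpace ℝ (MultiIndex n k)) (x : EuclideanSpace ℝ (Fin n)) :
    MvPolynomial.eval x.ofLp (formOfCoeff c) = inner ℝ c (veroneseVec k x) := by
  simp only [formOfCoeff, map_sum, eval_monomial_toFinsupp, PiLp.inner_apply, veroneseVec,
    RCLike.inner_apply, conj_trivial]
  exact Finset.sum_congr rfl fun α _ => by ring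

/-- This is the multinomial theorem, and the reason for the Weyl weights: evaluation at a unit
vector is a functional of norm 1, so the probabilistic assumptions apply to it directly. -/
theorem norm_veroneseVec (x : EuclideanSpace ℝ (Fin n)) : ‖veroneseVec k x‖ = ‖x‖ ^ k := by
  have h : ‖veroneseVec k x‖ ^ 2 = (‖x‖ ^ k) ^ 2 := by
    rw [← pow_mul, mul_comm k 2, pow_mul, EuclideanSpace.norm_sq_eq, EuclideanSpace.norm_sq_eq,
      Finset.sum_pow_eq_sum_piAntidiag]
    rw [← Finset.sum_coe_sort (Finset.piAntidiag Finset.univ k)]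
    refine Finset.sum_congr rfl fun α _ => ?_
    simp only [veroneseVec, Real.norm_eq_abs, sq_abs, mul_pow]
    rw [Real.sq_sqrt (Nat.cast_nonneg _), ← Finset.prod_pow]
    congr 1
    refine Finset.prod_congr rfl fun i _ => ?_
    rw [← pow_mul, ← pow_mul, mul_comm]
  exact (pow_left_inj₀ (norm_nonneg _) (by positivity) two_ne_zero).1 h

theorem veroneseVec_smul (r : ℝ) (x : EuclideanSpace ℝ (Fin n)) :
    veroneseVec k (r • x) = r ^ k • veroneseVec k x := by
  ext α
  simp only [veroneseVec, PiLp.smul_apply, smul_eq_mul, mul_pow, Finset.prod_mul_distrib,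
    Finset.prod_pow_eq_pow_sum, α.sum_eq]
  ring

theorem continuous_veroneseVec : Continuous (veroneseVec (n := n) k) := by
  unfold veroneseVec
  fun_prop

theorem coeff_formOfCoeff (c : EuclideanSpace ℝ (MultiIndex n k)) (α : MultiIndex n k) :
    MvPolynomial.coeff α.toFinsupp (formOfCoeff c) = c α * √(α.multinomial : ℝ) := by
  classical
  rw [formOfCoeff, MvPolynomial.coeff_sum, Finset.sum_eq_single α]
  · simp
  · intro β _ hβ
    rw [MvPolynomial.coeff_monomial, if_neg fun h => hβ (MultiIndex.toFinsupp_injective h)]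
  · simp

theorem weylNorm_formOfCoeff {m : ℕ} {deg : Fin m → ℕ}
    (c : (j : Fin m) → EuclideanSpace ℝ (MultiIndex n (deg j))) :
    weylNorm deg (fun j => formOfCoeff (c j)) = √(∑ j, ‖c j‖ ^ 2) := by
  unfold weylNorm
  congr 1
  refine Finset.sum_congr rfl fun j _ => ?_
  rw [EuclideanSpace.norm_sq_eq]
  refine Finset.sum_congr rfl fun α _ => ?_
  have : (0 : ℝ) < α.multinomial := by exact_mod_cast α.multinomial_pos
  rw [coeff_formOfCoeff, mul_pow, Real.sq_sqrt this.le, Real.norm_eq_abs, sq_abs]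
  field_simp

theorem isTrigPoly_eval_formOfCoeff (c : EuclideanSpace ℝ (MultiIndex n k))
    (x y : EuclideanSpace ℝ (Fin n)) :
    IsTrigPoly k (fun θ : ℝ =>
      ((inner ℝ c (veroneseVec k (Real.cos θ • x + Real.sin θ • y)) : ℝ) : ℂ)) := by
  have h : ∀ α : MultiIndex n k, IsTrigPoly k (fun θ : ℝ =>
      ((c α * √(α.multinomial : ℝ) : ℝ) : ℂ) *
        ∏ i, (((Real.cos θ * x i + Real.sin θ * y i : ℝ) : ℂ)) ^ α.1 i) := by
    intro α
    refine IsTrigPoly.const_mul ?_ _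
    have := IsTrigPoly.prod Finset.univ (fun i => α.1 i * 1)
      (fun i (θ : ℝ) => (((Real.cos θ * x i + Real.sin θ * y i : ℝ) : ℂ)) ^ α.1 i)
      (fun i _ => (IsTrigPoly.cos_sin (x i) (y i)).pow _)
    simpa only [mul_one, α.sum_eq] using this
  convert IsTrigPoly.sum Finset.univ _ (fun α _ => h α) using 2 with θ
  simp only [PiLp.inner_apply, veroneseVec, RCLike.inner_apply, conj_trivial, PiLp.add_apply,
    PiLp.smul_apply, smul_eq_mul]
  push_cast
  exact Finset.sum_congr rfl fun α _ => by ring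

theorem card_multiIndex (n k : ℕ) :
    Fintype.card (MultiIndex n k) = (n + k - 1).choose k := by
  have h := Finset.card_finsuppAntidiag_nat_eq_choose (s := (Finset.univ : Finset (Fin n))) k
  rw [Finset.card_univ, Fintype.card_fin] at h
  rw [Fintype.card_coe, ← h]
  refine Finset.card_bij (fun f _ => Finsupp.equivFunOnFinite.symm f) ?_ ?_ ?_
  · intro f hf
    simp only [Finset.mem_finsuppAntidiag, Finset.subset_univ, and_true]
    exact (Finset.mem_piAntidiag.1 hf).1
  · intro f _ g _ hfg
    exact Finsupp.equivFunOnFinite.symm.injective hfg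
  · intro f hf
    refine ⟨f, ?_, ?_⟩
    · rw [Finset.mem_finsuppAntidiag] at hf
      exact Finset.mem_piAntidiag.2 ⟨hf.1, fun i _ => Finset.mem_univ i⟩
    · ext i
      rfl

/-- The chain rule for polynomials in several variables along a curve. -/
theorem MvPolynomial.hasDerivAt_eval_comp {σ : Type*} [Fintype σ] (p : MvPolynomial σ ℝ)
    {γ : ℝ → σ → ℝ} {γ' : σ → ℝ} {t : ℝ} (h : ∀ i, HasDerivAt (fun s => γ s i) (γ' i) t) :
    HasDerivAt (fun s => MvPolynomial.eval (γ s) p)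
      (∑ i, MvPolynomial.eval (γ t) (MvPolynomial.pderiv i p) * γ' i) t := by
  classical
  induction p using MvPolynomial.induction_on with
  | C a => simpa using hasDerivAt_const t a
  | add p q hp hq =>
    simp only [map_add, add_mul, Finset.sum_add_distrib]
    exact hp.add hq
  | mul_X p i hp =>
    simp only [map_mul, MvPolynomial.eval_X, Derivation.leibniz, MvPolynomial.pderiv_X, map_add,
      smul_eq_mul]
    refine (hp.mul (h i)).congr_deriv ?_
    simp only [add_mul, Finset.sum_add_distrib, Pi.single_apply, Finset.sum_mul]
    rw [add_comm]
    congr 1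
    · rw [Finset.sum_eq_single i]
      · simp
      · intro j _ hj
        simp [Ne.symm hj]
      · simp
    · exact Finset.sum_congr rfl fun j _ => by ring

end Forms

/-! ### Local size estimates for systems of forms. -/

section FormSystems

variable {E : Type*} [NormedAddCommGroup E] [InnerProductSpace ℝ E] {m : ℕ}

/-- A map to `ℝ^m` whose `j`-th coordinate behaves like a form of degree `deg j`: it is
homogeneous, and restricts to trigonometric polynomials of degree `deg j` on great circles. -/
structure IsFormSystem (deg : Fin m → ℕ) (F : E → EuclideanSpace ℝ (Fin m)) : Prop where
  hom : ∀ j (r : ℝ) x, F (r • x) j = r ^ deg j * F x j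
  trig : ∀ j x y, IsTrigPoly (deg j)
    (fun θ : ℝ => ((F (Real.cos θ • x + Real.sin θ • y) j : ℝ) : ℂ))

theorem norm_le_of_forall_inner_le {V : Type*} [NormedAddCommGroup V] [InnerProductSpace ℝ V]
    {v : V} {b : ℝ} (hb : 0 ≤ b) (h : ∀ u : V, ‖u‖ = 1 → |inner ℝ u v| ≤ b) : ‖v‖ ≤ b := by
  rcases eq_or_ne v 0 with rfl | hv
  · simpa using hb
  · have hv' : ‖v‖ ≠ 0 := norm_ne_zero_iff.2 hv
    have := h (‖v‖⁻¹ • v) (by rw [norm_smul, norm_inv, norm_norm, inv_mul_cancel₀ hv'])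
    rw [inner_smul_left, real_inner_self_eq_norm_sq] at this
    simp only [conj_trivial] at this
    rw [sq, ← mul_assoc, inv_mul_cancel₀ hv', one_mul, abs_norm] at this
    exact this

theorem norm_cos_smul_add_sin_smul {e v : E} (he : ‖e‖ = 1) (hv : ‖v‖ = 1) (hev : inner ℝ e v = 0)
    (θ : ℝ) : ‖Real.cos θ • e + Real.sin θ • v‖ = 1 := by
  have h : ‖Real.cos θ • e + Real.sin θ • v‖ ^ 2 = 1 := by
    rw [norm_add_sq_real, inner_smul_left, inner_smul_right, hev, norm_smul, norm_smul, he, hv]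
    simp
  exact (pow_eq_one_iff_of_nonneg (norm_nonneg _) two_ne_zero).1 h

variable {deg : Fin m → ℕ} {F : E → EuclideanSpace ℝ (Fin m)} {d : ℕ} {H : ℝ} {e v : E}

theorem IsFormSystem.isTrigPoly_inner (hF : IsFormSystem deg F) (hdeg : ∀ j, deg j ≤ d)
    (u : EuclideanSpace ℝ (Fin m)) (e v : E) :
    IsTrigPoly d (fun θ : ℝ =>
      ((inner ℝ u (F (Real.cos θ • e + Real.sin θ • v)) : ℝ) : ℂ)) := by
  have := IsTrigPoly.sum Finset.univ (d := d) _
    (fun j _ => ((hF.trig j e v).mono (hdeg j)).const_mul (u j : ℂ))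
  convert this using 2 with θ
  simp only [PiLp.inner_apply, RCLike.inner_apply, conj_trivial]
  push_cast
  exact Finset.sum_congr rfl fun j _ => by ring

/-- Pairing with a unit vector u gives a scalar trigonometric polynomial with the same bound H, so
passing to vector values costs no factor depending on m. -/
theorem IsFormSystem.taylor (hF : IsFormSystem deg F) (hd : 0 < d) (hdeg : ∀ j, deg j ≤ d)
    (hH : ∀ x : E, ‖x‖ = 1 → ‖F x‖ ≤ H) (he : ‖e‖ = 1) (hv : ‖v‖ = 1) (hev : inner ℝ e v = 0)
    (θ : ℝ) :
    ‖F (Real.cos θ • e + Real.sin θ • v) - F e‖ ≤ 7 * d * H * |θ| ∧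
    ∀ a : EuclideanSpace ℝ (Fin m),
      (∀ j, HasDerivAt (fun t : ℝ => F (Real.cos t • e + Real.sin t • v) j) (a j) 0) →
      ‖F (Real.cos θ • e + Real.sin θ • v) - F e - θ • a‖ ≤ 49 * d ^ 2 * H * θ ^ 2 := by
  have hH0 : 0 ≤ H := (norm_nonneg _).trans (hH e he)
  have hb : ∀ u : EuclideanSpace ℝ (Fin m), ‖u‖ = 1 → ∀ t : ℝ,
      ‖((inner ℝ u (F (Real.cos t • e + Real.sin t • v)) : ℝ) : ℂ)‖ ≤ H := by
    intro u hu t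
    rw [Complex.norm_real]
    refine (norm_inner_le_norm _ _).trans ?_
    rw [hu, one_mul]
    exact hH _ (norm_cos_smul_add_sin_smul he hv hev t)
  constructor
  · refine norm_le_of_forall_inner_le (by positivity) fun u hu => ?_
    have := ((hF.isTrigPoly_inner hdeg u e v).taylor hd (hb u hu) θ).1
    rw [← Complex.ofReal_sub, Complex.norm_real, ← inner_sub_right] at this
    simpa using this
  · intro a ha
    refine norm_le_of_forall_inner_le (by positivity) fun u hu => ?_
    have hder : HasDerivAt (fun t : ℝ =>
        ((inner ℝ u (F (Real.cos t • e + Real.sin t • v)) : ℝ) : ℂ))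
        ((inner ℝ u a : ℝ) : ℂ) 0 := by
      refine HasDerivAt.ofReal_comp ?_
      simp only [PiLp.inner_apply, RCLike.inner_apply, conj_trivial]
      exact HasDerivAt.fun_sum fun j _ => (ha j).mul_const _
    have := ((hF.isTrigPoly_inner hdeg u e v).taylor hd (hb u hu) θ).2 _ hder
    rw [← Complex.ofReal_mul, ← Complex.ofReal_sub, ← Complex.ofReal_sub, Complex.norm_real,
      ← inner_sub_right, ← real_inner_smul_right, ← inner_sub_right] at this
    simpa using this

/-- Radial projection of the tangent line to the great circle; with `abs_arctan_le`, it transfers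
the Taylor bounds from angles to tangent vectors. -/
theorem normalize_add_smul (e v : E) (b : ℝ) :
    (√(1 + b ^ 2))⁻¹ • (e + b • v)
      = Real.cos (Real.arctan b) • e + Real.sin (Real.arctan b) • v := by
  rw [Real.cos_arctan, Real.sin_arctan, smul_add, smul_smul, one_div, div_eq_inv_mul]

theorem abs_arctan_le (b : ℝ) : |Real.arctan b| ≤ |b| := by
  have := convex_univ.norm_image_sub_le_of_norm_hasDerivWithin_le (f := Real.arctan)
      (f' := fun x => 1 / (1 + x ^ 2)) (C := 1) (x := 0) (y := b)
      (fun x _ => (Real.hasDerivAt_arctan x).hasDerivWithinAt) (fun x _ => by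
        have : 0 < 1 + x ^ 2 := by positivity
        rw [Real.norm_of_nonneg (by positivity), div_le_one this]
        nlinarith [sq_nonneg x]) (Set.mem_univ _) (Set.mem_univ _)
  simpa using this

theorem IsFormSystem.norm_normalize_sub_le (hF : IsFormSystem deg F) (hd : 0 < d)
    (hdeg : ∀ j, deg j ≤ d) (hH : ∀ x : E, ‖x‖ = 1 → ‖F x‖ ≤ H) (he : ‖e‖ = 1) {w : E}
    (hw : inner ℝ e w = 0) :
    ‖F ((√(1 + ‖w‖ ^ 2))⁻¹ • (e + w)) - F e‖ ≤ 7 * d * H * ‖w‖ := by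
  rcases eq_or_ne w 0 with rfl | hw0
  · simp
  have hw' : ‖w‖ ≠ 0 := norm_ne_zero_iff.2 hw0
  have hH0 : 0 ≤ H := (norm_nonneg _).trans (hH e he)
  have h1 : w = ‖w‖ • (‖w‖⁻¹ • w) := by rw [smul_smul, mul_inv_cancel₀ hw', one_smul]
  have h2 : ‖‖w‖⁻¹ • w‖ = 1 := by rw [norm_smul, norm_inv, norm_norm, inv_mul_cancel₀ hw']
  have h3 : inner ℝ e (‖w‖⁻¹ • w) = 0 := by rw [inner_smul_right, hw, mul_zero]
  have h4 : (√(1 + ‖w‖ ^ 2))⁻¹ • (e + w) = Real.cos (Real.arctan ‖w‖) • e +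
      Real.sin (Real.arctan ‖w‖) • (‖w‖⁻¹ • w) := by
    rw [← normalize_add_smul, ← h1]
  rw [h4]
  refine (hF.taylor hd hdeg hH he h2 h3 _).1.trans ?_
  have := abs_arctan_le ‖w‖
  rw [abs_norm] at this
  gcongr

theorem IsFormSystem.norm_normalize_le (hF : IsFormSystem deg F) (hd : 0 < d)
    (hdeg : ∀ j, deg j ≤ d) (hH : ∀ x : E, ‖x‖ = 1 → ‖F x‖ ≤ H) (he : ‖e‖ = 1) (hv : ‖v‖ = 1)
    (hev : inner ℝ e v = 0) {a : EuclideanSpace ℝ (Fin m)}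
    (ha : ∀ j, HasDerivAt (fun t : ℝ => F (Real.cos t • e + Real.sin t • v) j) (a j) 0) (b : ℝ) :
    ‖F ((√(1 + b ^ 2))⁻¹ • (e + b • v))‖ ≤ ‖F e‖ + |b| * ‖a‖ + 49 * d ^ 2 * H * b ^ 2 := by
  have hH0 : 0 ≤ H := (norm_nonneg _).trans (hH e he)
  rw [normalize_add_smul]
  set θ := Real.arctan b
  have h1 := (hF.taylor hd hdeg hH he hv hev θ).2 a ha
  have h2 : |θ| ≤ |b| := abs_arctan_le b
  have h3 : θ ^ 2 ≤ b ^ 2 := sq_le_sq.2 h2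
  set y := F (Real.cos θ • e + Real.sin θ • v)
  calc ‖y‖ = ‖F e + θ • a + (y - F e - θ • a)‖ := by congr 1; abel
    _ ≤ ‖F e‖ + ‖θ • a‖ + ‖y - F e - θ • a‖ := norm_add₃_le
    _ ≤ ‖F e‖ + |b| * ‖a‖ + 49 * d ^ 2 * H * b ^ 2 := by
      rw [norm_smul, Real.norm_eq_abs]
      gcongr
      exact h1.trans (by gcongr)

theorem IsFormSystem.norm_smul_le (hF : IsFormSystem deg F) {r : ℝ} (hr0 : 0 ≤ r) (hr : r ≤ 1)
    (z : E) : ‖F (r • z)‖ ≤ ‖F z‖ := by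
  rw [EuclideanSpace.norm_eq, EuclideanSpace.norm_eq]
  refine Real.sqrt_le_sqrt (Finset.sum_le_sum fun j _ => ?_)
  rw [hF.hom, norm_mul, norm_pow, Real.norm_of_nonneg hr0]
  gcongr
  exact mul_le_of_le_one_left (norm_nonneg _) (pow_le_one₀ hr0 hr)

theorem IsFormSystem.le_norm_smul (hF : IsFormSystem deg F) (hdeg : ∀ j, deg j ≤ d) {r : ℝ}
    (hr0 : 0 ≤ r) (hr : r ≤ 1) (z : E) : r ^ d * ‖F z‖ ≤ ‖F (r • z)‖ := by
  have h1 : r ^ d * ‖F z‖ = ‖r ^ d • F z‖ := by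
    rw [norm_smul, norm_pow, Real.norm_of_nonneg hr0]
  rw [h1, EuclideanSpace.norm_eq, EuclideanSpace.norm_eq]
  refine Real.sqrt_le_sqrt (Finset.sum_le_sum fun j _ => ?_)
  rw [hF.hom, PiLp.smul_apply, smul_eq_mul, norm_mul, norm_mul, norm_pow, norm_pow,
    Real.norm_of_nonneg hr0]
  gcongr ?_ ^ 2
  exact mul_le_mul_of_nonneg_right (pow_le_pow_of_le_one hr0 hr (hdeg j)) (norm_nonneg _)

theorem one_le_sqrt_one_add_sq (b : ℝ) : 1 ≤ √(1 + b ^ 2) := by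
  rw [Real.one_le_sqrt]; nlinarith [sq_nonneg b]

/-- A system with small value at `e` and small derivative at `e` in the direction `v` is small on
a neighbourhood of `e` that is elongated in the direction `v`. -/
theorem IsFormSystem.norm_le_of_near (hF : IsFormSystem deg F) (hd : 0 < d)
    (hdeg : ∀ j, deg j ≤ d) (hH : ∀ x : E, ‖x‖ = 1 → ‖F x‖ ≤ H) (he : ‖e‖ = 1) (hv : ‖v‖ = 1)
    (hev : inner ℝ e v = 0) {D : EuclideanSpace ℝ (Fin m)}
    (hD : ∀ j, HasDerivAt (fun t : ℝ => F (Real.cos t • e + Real.sin t • v) j) (D j) 0)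
    {a b β ρ : ℝ} {w : E} (ha : 1 / 2 ≤ a) (hb : |b| ≤ β) (hw : ‖w‖ ≤ ρ)
    (hwe : inner ℝ e w = 0) (hwv : inner ℝ v w = 0) (hz : ‖a • e + b • v + w‖ ≤ 1) :
    ‖F (a • e + b • v + w)‖ ≤ ‖F e‖ + 2 * β * ‖D‖ + 49 * d ^ 2 * H * (2 * β) ^ 2 +
      7 * d * H * (2 * ρ) := by
  have hH0 : 0 ≤ H := (norm_nonneg _).trans (hH e he)
  have ha0 : 0 < a := by linarith
  have hba : |b / a| ≤ 2 * β := by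
    rw [abs_div, abs_of_pos ha0, div_le_iff₀ ha0]
    nlinarith [abs_nonneg b]
  set s := √(1 + (b / a) ^ 2) with hs
  have hs1 : 1 ≤ s := one_le_sqrt_one_add_sq _
  have hs0 : 0 < s := by linarith
  -- The point is reached by moving from e along the great circle to f, then from f in an orthogonal
  -- direction w', then by shrinking. The second order estimate is used on the first leg, the first
  -- order one on the second. Since a ≥ 1/2, normalizing at most doubles β and ρ.
  set f := s⁻¹ • (e + (b / a) • v) with hf
  have hfn : ‖f‖ = 1 := by
    rw [hf, hs, normalize_add_smul]
    exact norm_cos_smul_add_sin_smul he hv hev _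
  set w' := (a * s)⁻¹ • w with hw'
  have hw'n : ‖w'‖ ≤ 2 * ρ := by
    have has : 1 / 2 ≤ a * s := by nlinarith
    rw [hw', norm_smul, norm_inv, Real.norm_of_nonneg (by positivity), inv_mul_le_iff₀ (by positivity)]
    nlinarith [norm_nonneg w]
  have hfw : inner ℝ f w' = 0 := by
    rw [hf, hw', inner_smul_left, inner_smul_right, inner_add_left, inner_smul_left, hwe, hwv]
    simp
  set t := √(1 + ‖w'‖ ^ 2) with ht
  have ht1 : 1 ≤ t := one_le_sqrt_one_add_sq _
  have ht0 : 0 < t := by linarith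
  have has0 : a * s ≠ 0 := by positivity
  have hzeq : a • e + b • v + w = (a * s * t) • (t⁻¹ • (f + w')) := by
    have h1 : (a * s) • f = a • e + b • v := by
      rw [hf, smul_smul, mul_assoc a, mul_inv_cancel₀ hs0.ne', mul_one, smul_add, smul_smul,
        mul_div_cancel₀ _ ha0.ne']
    have h2 : (a * s) • w' = w := smul_inv_smul₀ has0 w
    rw [smul_smul, mul_assoc (a * s), mul_inv_cancel₀ ht0.ne', mul_one, smul_add, h1, h2]
  have hn : ‖t⁻¹ • (f + w')‖ = 1 := by
    have h2 : ‖f + w'‖ ^ 2 = 1 + ‖w'‖ ^ 2 := by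
      rw [norm_add_sq_real, hfw, hfn]; ring
    rw [norm_smul, norm_inv, Real.norm_of_nonneg ht0.le, ← Real.sqrt_sq (norm_nonneg (f + w')), h2,
      ← ht, inv_mul_cancel₀ ht0.ne']
  have hr : a * s * t ≤ 1 := by
    rw [hzeq, norm_smul, hn, mul_one, Real.norm_of_nonneg (by positivity)] at hz
    exact hz
  rw [hzeq]
  have h1 := hF.norm_smul_le (r := a * s * t) (by positivity) hr (t⁻¹ • (f + w'))
  have h2 := hF.norm_normalize_sub_le hd hdeg hH hfn hfw
  rw [← ht] at h2
  have h3 := hF.norm_normalize_le hd hdeg hH he hv hev hD (b / a)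
  rw [← hs, ← hf] at h3
  have h4 : ‖F (t⁻¹ • (f + w'))‖ ≤ ‖F f‖ + ‖F (t⁻¹ • (f + w')) - F f‖ := by
    simpa using norm_add_le (F f) (F (t⁻¹ • (f + w')) - F f)
  have h5 : (b / a) ^ 2 ≤ (2 * β) ^ 2 := sq_le_sq' (abs_le.1 hba).1 (abs_le.1 hba).2
  calc _ ≤ _ := h1
    _ ≤ _ := h4
    _ ≤ (‖F e‖ + |b / a| * ‖D‖ + 49 * d ^ 2 * H * (b / a) ^ 2) + 7 * d * H * ‖w'‖ := by gcongr
    _ ≤ _ := by gcongr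

/-- A system is comparable to its maximum on the sphere on a ball near a maximum point. -/
theorem IsFormSystem.le_norm_of_near (hF : IsFormSystem deg F) (hd : 0 < d)
    (hdeg : ∀ j, deg j ≤ d) (hH : ∀ x : E, ‖x‖ = 1 → ‖F x‖ ≤ H) (he : ‖e‖ = 1)
    (heH : ‖F e‖ = H) {z : E}
    (hz : ‖z - (1 - 1 / (4 * d : ℝ)) • e‖ ≤ 1 / (28 * d)) : H / 4 ≤ ‖F z‖ := by
  have hd1 : (1 : ℝ) ≤ d := by exact_mod_cast hd
  have hd0 : (0 : ℝ) < d := by linarith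
  have hH0 : 0 ≤ H := (norm_nonneg _).trans (hH e he)
  set a : ℝ := inner ℝ e z with ha
  set w : E := z - a • e with hw
  -- With z split into a part along e and an orthogonal part w, the tangential displacement has
  -- length at most 1/(14d), so ‖F‖ drops at most from H to H/2. The radial factor is at least 1 -
  -- 1/(2d), whose d-th power is at least 1/2 by Bernoulli.
  have hwe : inner ℝ e w = 0 := by
    rw [hw, inner_sub_right, inner_smul_right, real_inner_self_eq_norm_sq, he, ha]; ring
  obtain ⟨c, hc⟩ : ∃ c : ℝ, c = 1 - 1 / (4 * d : ℝ) := ⟨_, rfl⟩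
  rw [← hc] at hz
  have hzc : ‖z - c • e‖ ^ 2 = (a - c) ^ 2 + ‖w‖ ^ 2 := by
    have : z - c • e = (a - c) • e + w := by rw [hw, sub_smul]; abel
    rw [this, norm_add_sq_real, inner_smul_left, hwe, norm_smul, he, mul_one, Real.norm_eq_abs,
      sq_abs]
    simp
  have hsq : ‖z - c • e‖ ^ 2 ≤ (1 / (28 * d)) ^ 2 := by gcongr
  have hac : |a - c| ≤ 1 / (28 * d) := by
    refine abs_le_of_sq_le_sq ?_ (by positivity)
    nlinarith [sq_nonneg ‖w‖]
  have hwn : ‖w‖ ≤ 1 / (28 * d) := by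
    refine (sq_le_sq₀ (norm_nonneg _) (by positivity)).1 ?_
    nlinarith [sq_nonneg (a - c)]
  have h1d : (1 : ℝ) / d ≤ 1 := by rw [div_le_one hd0]; exact hd1
  have e4 : 1 / (4 * d : ℝ) = 1 / d / 4 := by field_simp
  have e28 : 1 / (28 * d : ℝ) = 1 / d / 28 := by field_simp
  have e2 : 1 / (2 * d : ℝ) = 1 / d / 2 := by field_simp
  have hd'pos : 0 < (1 : ℝ) / d := by positivity
  have ha1 : 1 - 1 / (2 * d : ℝ) ≤ a := by
    have := (abs_le.1 hac).1
    rw [e28] at this; rw [e2]; rw [hc, e4] at this; linarith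
  have ha0 : 1 / 2 ≤ a := by rw [e2] at ha1; linarith
  have hapos : 0 < a := by linarith
  set w' : E := a⁻¹ • w with hw'
  have hw'n : ‖w'‖ ≤ 1 / (14 * d) := by
    rw [hw', norm_smul, norm_inv, Real.norm_of_nonneg hapos.le, inv_mul_le_iff₀ hapos]
    have : 1 / (28 * d : ℝ) ≤ a * (1 / (14 * d)) := by
      rw [show 1 / (28 * d : ℝ) = 1 / 2 * (1 / (14 * d)) by field_simp; norm_num]
      gcongr
    exact hwn.trans this
  have hew : inner ℝ e w' = 0 := by rw [hw', inner_smul_right, hwe, mul_zero]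
  set t := √(1 + ‖w'‖ ^ 2) with ht
  have ht1 : 1 ≤ t := one_le_sqrt_one_add_sq _
  have ht0 : 0 < t := by linarith
  have hzeq : z = (a * t) • (t⁻¹ • (e + w')) := by
    rw [smul_smul, mul_assoc, mul_inv_cancel₀ ht0.ne', mul_one, smul_add, hw', smul_smul,
      mul_inv_cancel₀ hapos.ne', one_smul, hw]
    abel
  have hn : ‖t⁻¹ • (e + w')‖ = 1 := by
    have h2 : ‖e + w'‖ ^ 2 = 1 + ‖w'‖ ^ 2 := by
      rw [norm_add_sq_real, hew, he]; ring
    rw [norm_smul, norm_inv, Real.norm_of_nonneg ht0.le, ← Real.sqrt_sq (norm_nonneg (e + w')), h2,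
      ← ht, inv_mul_cancel₀ ht0.ne']
  have hr : a * t ≤ 1 := by
    have hzn : ‖z‖ ≤ 1 := by
      have h1 : ‖z‖ ≤ ‖c • e‖ + ‖z - c • e‖ := by simpa using norm_add_le (c • e) (z - c • e)
      have hc0 : 0 ≤ c := by rw [hc, e4]; linarith
      rw [norm_smul, he, mul_one, Real.norm_of_nonneg hc0] at h1
      rw [e28] at hz
      have hc4 := hc
      rw [e4] at hc4
      linarith
    rw [hzeq, norm_smul, hn, mul_one, Real.norm_of_nonneg (by positivity)] at hzn
    exact hzn
  have h2 := hF.norm_normalize_sub_le hd hdeg hH he hew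
  rw [← ht] at h2
  have h3 : 7 * d * H * ‖w'‖ ≤ H / 2 := by
    calc 7 * d * H * ‖w'‖ ≤ 7 * d * H * (1 / (14 * d)) := by gcongr
      _ = H / 2 := by field_simp; ring
  have h4 : ‖F e‖ ≤ ‖F (t⁻¹ • (e + w'))‖ + ‖F (t⁻¹ • (e + w')) - F e‖ := by
    have := norm_sub_norm_le (F e) (F (t⁻¹ • (e + w')))
    rw [norm_sub_rev] at this
    linarith
  have h5 := hF.le_norm_smul hdeg (r := a * t) (by positivity) hr (t⁻¹ • (e + w'))
  rw [← hzeq] at h5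
  have h6 : 1 / 2 ≤ (a * t) ^ d := by
    have hat : 1 - 1 / (2 * d : ℝ) ≤ a * t := by nlinarith
    have h0 : 0 ≤ 1 - 1 / (2 * d : ℝ) := by rw [e2]; linarith
    have hB := one_add_mul_le_pow (a := -(1 / (2 * d : ℝ))) (by rw [e2]; linarith) d
    calc (1 : ℝ) / 2 = 1 + d * -(1 / (2 * d : ℝ)) := by field_simp; norm_num
      _ ≤ (1 + -(1 / (2 * d : ℝ))) ^ d := hB
      _ = (1 - 1 / (2 * d : ℝ)) ^ d := by ring
      _ ≤ (a * t) ^ d := by gcongr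
  have h7 : H / 2 ≤ ‖F (t⁻¹ • (e + w'))‖ := by linarith
  calc H / 4 = 1 / 2 * (H / 2) := by ring
    _ ≤ (a * t) ^ d * ‖F (t⁻¹ • (e + w'))‖ := by gcongr
    _ ≤ _ := h5

end FormSystems

/-! ### Volume of the set where a badly conditioned system is small. -/

section Volume

variable {n : ℕ}

/-- The linear map that scales an orthonormal pair `e, v` by `r` and `β`, and its orthogonal
complement by `ρ`. -/
noncomputable def ellipsoidMap (e v : EuclideanSpace ℝ (Fin n)) (r β ρ : ℝ) :
    EuclideanSpace ℝ (Fin n) →ₗ[ℝ] EuclideanSpace ℝ (Fin n) :=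
  ρ • (LinearMap.transvection (innerₗ (EuclideanSpace ℝ (Fin n)) e) ((r / ρ - 1) • e) ∘ₗ
    LinearMap.transvection (innerₗ (EuclideanSpace ℝ (Fin n)) v) ((β / ρ - 1) • v))

theorem ellipsoidMap_apply {e v : EuclideanSpace ℝ (Fin n)} (hev : inner ℝ e v = 0)
    {r β ρ : ℝ} (hρ : ρ ≠ 0) (x : EuclideanSpace ℝ (Fin n)) :
    ellipsoidMap e v r β ρ x = (r * inner ℝ e x) • e + (β * inner ℝ v x) • v +
      ρ • (x - (inner ℝ e x : ℝ) • e - (inner ℝ v x : ℝ) • v) := by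
  simp only [ellipsoidMap, LinearMap.smul_apply, LinearMap.comp_apply,
    LinearMap.transvection.apply, innerₗ_apply_apply, inner_add_right, inner_smul_right, hev]
  simp only [smul_add, smul_sub, smul_smul, mul_zero, add_zero]
  have h1 : ρ * (inner ℝ v x * (β / ρ - 1)) = β * inner ℝ v x - ρ * inner ℝ v x := by
    field_simp
  have h2 : ρ * (inner ℝ e x * (r / ρ - 1)) = r * inner ℝ e x - ρ * inner ℝ e x := by
    field_simp
  rw [h1, h2, sub_smul, sub_smul]
  abel

/-- Each transvection x ↦ x + f(x)u has determinant 1 + f(u), so no orthonormal basis extending e, v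
is needed. -/
theorem det_ellipsoidMap {e v : EuclideanSpace ℝ (Fin n)} (he : ‖e‖ = 1) (hv : ‖v‖ = 1)
    (hn : 2 ≤ n) {r β ρ : ℝ} (hρ : ρ ≠ 0) :
    LinearMap.det (ellipsoidMap e v r β ρ) = r * β * ρ ^ (n - 2) := by
  rw [ellipsoidMap, LinearMap.det_smul, LinearMap.det_comp, LinearMap.transvection.det,
    LinearMap.transvection.det, finrank_euclideanSpace_fin]
  simp only [innerₗ_apply_apply, inner_smul_right, real_inner_self_eq_norm_sq, he, hv]
  obtain ⟨k, rfl⟩ := Nat.exists_eq_add_of_le hn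
  rw [show 2 + k - 2 = k by omega, pow_add]
  field_simp
  ring

variable {m : ℕ} {deg : Fin m → ℕ} {d : ℕ}
  {F : EuclideanSpace ℝ (Fin n) → EuclideanSpace ℝ (Fin m)}

set_option maxHeartbeats 800000 in
/-- If a system of forms has a small value and a small directional derivative somewhere on the
sphere, it is small on a set of large volume in the shell `1 - 1/(2d) ≤ ‖z‖ ≤ 1`. -/
theorem IsFormSystem.volume_small_ge (hF : IsFormSystem deg F) (hn : 2 ≤ n) (hd : 0 < d)
    (hdeg : ∀ j, deg j ≤ d) {R α : ℝ} (hR : ∀ x, ‖x‖ = 1 → ‖F x‖ ≤ R) (hα : 0 < α) (hαR : α ≤ R)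
    {e v : EuclideanSpace ℝ (Fin n)} (he : ‖e‖ = 1) (hv : ‖v‖ = 1) (hev : inner ℝ e v = 0)
    {D : EuclideanSpace ℝ (Fin m)}
    (hD : ∀ j, HasDerivAt (fun t : ℝ => F (Real.cos t • e + Real.sin t • v) j) (D j) 0)
    (hFe : ‖F e‖ ≤ α) (hDα : ‖D‖ ≤ √d * α) :
    ENNReal.ofReal (√(α / R) * (α / R) ^ (n - 2) / (14 * d) ^ n) *
      volume (Metric.ball (0 : EuclideanSpace ℝ (Fin n)) 1) ≤
    volume {z : EuclideanSpace ℝ (Fin n) | 1 - 1 / (2 * d : ℝ) ≤ ‖z‖ ∧ ‖z‖ ≤ 1 ∧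
      ‖F z‖ ≤ 4 * α} := by
  have hd1 : (1 : ℝ) ≤ d := by exact_mod_cast hd
  have hd0 : (0 : ℝ) < d := by linarith
  have hR0 : 0 < R := hα.trans_le hαR
  set A := α / R with hA
  have hA0 : 0 < A := by positivity
  have hA1 : A ≤ 1 := (div_le_one hR0).2 hαR
  have hAR : R * A = α := by rw [hA]; field_simp
  clear_value A
  have hsA0 : 0 < √A := Real.sqrt_pos.2 hA0
  have hsA1 : √A ≤ 1 := Real.sqrt_le_one.2 hA1
  -- The semi-axes are tuned so that 49 d² R (2β)² = α and 7 d R (2ρ) = α; the first order term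
  -- 2β‖D‖ is also at most α, and together with ‖F e‖ ≤ α this gives 4α. The ellipsoid is centred at
  -- (1 - r)e, so that with r = 1/(4d) it lies in the shell.
  set r : ℝ := 1 / (4 * d) with hr
  set β : ℝ := √A / (14 * d) with hβ
  set ρ : ℝ := A / (14 * d) with hρ
  have hr0 : 0 < r := by positivity
  have hβ0 : 0 < β := by positivity
  have hρ0 : 0 < ρ := by positivity
  have h14 : 1 / (14 * d : ℝ) ≤ r := by
    rw [hr]; exact one_div_le_one_div_of_le (by positivity) (by linarith)
  have hβr : β ≤ r := by
    refine le_trans ?_ h14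
    rw [hβ]; gcongr
  have hρr : ρ ≤ r := by
    refine le_trans ?_ h14
    rw [hρ]; gcongr
  have hr4 : r ≤ 1 / 4 := by
    rw [hr]; exact one_div_le_one_div_of_le (by positivity) (by linarith)
  have h2r : 1 / (2 * d : ℝ) = 2 * r := by rw [hr]; field_simp; norm_num
  have hsub : (fun x => (1 - r) • e + x) '' (ellipsoidMap e v r β ρ '' Metric.ball 0 1) ⊆
      {z : EuclideanSpace ℝ (Fin n) | 1 - 1 / (2 * d : ℝ) ≤ ‖z‖ ∧ ‖z‖ ≤ 1 ∧ ‖F z‖ ≤ 4 * α} := by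
    rintro z ⟨_, ⟨x, hx, rfl⟩, rfl⟩
    rw [mem_ball_zero_iff] at hx
    simp only [Set.mem_ofPred_eq]
    set p : ℝ := inner ℝ e x with hp
    set q : ℝ := inner ℝ v x with hq
    set u := x - p • e - q • v with hu
    have hve : inner ℝ v e = 0 := by rw [real_inner_comm, hev]
    have heu : inner ℝ e u = 0 := by
      rw [hu, inner_sub_right, inner_sub_right, inner_smul_right, inner_smul_right, hev,
        real_inner_self_eq_norm_sq, he, ← hp]
      ring
    have hvu : inner ℝ v u = 0 := by
      rw [hu, inner_sub_right, inner_sub_right, inner_smul_right, inner_smul_right, hve,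
        real_inner_self_eq_norm_sq, hv, ← hq]
      ring
    have hpyth : ∀ s t : ℝ, ∀ w : EuclideanSpace ℝ (Fin n), inner ℝ e w = 0 → inner ℝ v w = 0 →
        ‖s • e + t • v + w‖ ^ 2 = s ^ 2 + t ^ 2 + ‖w‖ ^ 2 := by
      intro s t w hw1 hw2
      rw [norm_add_sq_real, norm_add_sq_real, inner_add_left, inner_smul_left, inner_smul_left,
        inner_smul_left, inner_smul_right, hev, hw1, hw2, norm_smul, norm_smul, he, hv]
      simp
    have hxn : p ^ 2 + q ^ 2 + ‖u‖ ^ 2 < 1 := by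
      rw [← hpyth p q u heu hvu]
      have : p • e + q • v + u = x := by rw [hu]; abel
      rw [this]
      nlinarith [norm_nonneg x]
    have hp1 : |p| ≤ 1 := abs_le_of_sq_le_sq (by nlinarith [sq_nonneg q, sq_nonneg ‖u‖]) one_pos.le
    have hq1 : |q| ≤ 1 := abs_le_of_sq_le_sq (by nlinarith [sq_nonneg p, sq_nonneg ‖u‖]) one_pos.le
    have hu1 : ‖u‖ ≤ 1 := by
      have := abs_le_of_sq_le_sq (a := ‖u‖) (b := 1) (by nlinarith [sq_nonneg p, sq_nonneg q])
        one_pos.le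
      rwa [abs_norm] at this
    have heρ : inner ℝ e (ρ • u) = 0 := by rw [inner_smul_right, heu, mul_zero]
    have hvρ : inner ℝ v (ρ • u) = 0 := by rw [inner_smul_right, hvu, mul_zero]
    rw [ellipsoidMap_apply hev hρ0.ne', ← hp, ← hq, ← hu]
    have hTn : ‖(r * p) • e + (β * q) • v + ρ • u‖ ≤ r := by
      refine (sq_le_sq₀ (norm_nonneg _) hr0.le).1 ?_
      rw [hpyth _ _ _ heρ hvρ, norm_smul, mul_pow, mul_pow, mul_pow, Real.norm_eq_abs, sq_abs]
      have h1 : β ^ 2 ≤ r ^ 2 := by gcongr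
      have h2 : ρ ^ 2 ≤ r ^ 2 := by gcongr
      calc r ^ 2 * p ^ 2 + β ^ 2 * q ^ 2 + ρ ^ 2 * ‖u‖ ^ 2
          ≤ r ^ 2 * p ^ 2 + r ^ 2 * q ^ 2 + r ^ 2 * ‖u‖ ^ 2 := by gcongr
        _ = r ^ 2 * (p ^ 2 + q ^ 2 + ‖u‖ ^ 2) := by ring
        _ ≤ r ^ 2 * 1 := by gcongr
        _ = r ^ 2 := mul_one _
    have hz1 : ‖(1 - r) • e + ((r * p) • e + (β * q) • v + ρ • u)‖ ≤ 1 := by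
      refine (norm_add_le _ _).trans ?_
      rw [norm_smul, he, mul_one, Real.norm_of_nonneg (by linarith)]
      linarith
    have hzeq : (1 - r) • e + ((r * p) • e + (β * q) • v + ρ • u) =
        (1 - r + r * p) • e + (β * q) • v + ρ • u := by
      rw [add_smul]; abel
    rw [hzeq] at hz1 ⊢
    have hrp : -r ≤ r * p := by nlinarith [(abs_le.1 hp1).1]
    refine ⟨?_, hz1, ?_⟩
    -- The norm is at least the component along e, which is at least 1 - 2r.
    · have h3 : (1 - r + r * p) ^ 2 ≤ ‖(1 - r + r * p) • e + (β * q) • v + ρ • u‖ ^ 2 := by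
        rw [hpyth _ _ _ heρ hvρ]
        nlinarith [sq_nonneg (β * q), sq_nonneg ‖ρ • u‖]
      have h4 := (sq_le_sq₀ (by linarith) (norm_nonneg _)).1 h3
      rw [h2r]
      linarith
    · have h5 := hF.norm_le_of_near hd hdeg hR he hv hev hD (a := 1 - r + r * p) (b := β * q)
        (β := β) (ρ := ρ) (w := ρ • u) (by linarith)
        (by rw [abs_mul, abs_of_pos hβ0]; exact mul_le_of_le_one_right hβ0.le hq1)
        (by rw [norm_smul, Real.norm_of_nonneg hρ0.le]; exact mul_le_of_le_one_right hρ0.le hu1)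
        heρ hvρ hz1
      refine h5.trans ?_
      have h6 : 2 * β * ‖D‖ ≤ α := by
        have hsd : √(d : ℝ) ≤ d := by
          rw [Real.sqrt_le_left hd0.le]; nlinarith
        have hβ1 : β ≤ 1 / (14 * d) := by rw [hβ]; gcongr
        calc 2 * β * ‖D‖ ≤ 2 * (1 / (14 * d)) * (d * α) := by
              gcongr
              exact hDα.trans (by gcongr)
          _ = α / 7 := by field_simp; norm_num
          _ ≤ α := by linarith
      have h7 : 49 * d ^ 2 * R * (2 * β) ^ 2 = α := by
        rw [hβ, mul_pow, div_pow, Real.sq_sqrt hA0.le, ← hAR]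
        field_simp
        ring
      have h8 : 7 * d * R * (2 * ρ) = α := by
        rw [hρ, ← hAR]
        field_simp
        ring
      linarith
  refine le_trans ?_ (measure_mono hsub)
  rw [Set.image_add_left, measure_preimage_add, Measure.addHaar_image_linearMap,
    det_ellipsoidMap he hv hn hρ0.ne', abs_of_nonneg (by positivity)]
  gcongr
  obtain ⟨k, rfl⟩ := Nat.exists_eq_add_of_le hn
  rw [show 2 + k - 2 = k by omega]
  calc √A * A ^ k / (14 * d) ^ (2 + k)
      = 1 / (14 * d) * (√A / (14 * d)) * (A / (14 * d)) ^ k := by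
        rw [div_pow A, pow_add]; field_simp
    _ ≤ r * β * ρ ^ k := by rw [hβ, hρ]; gcongr

end Volume

/-! ### Exponential moments of real random variables. -/

section Moments

variable {Ω : Type*} [MeasurableSpace Ω] {μ : Measure Ω}

theorem lintegral_prod_comp_eq {m : ℕ} {β : Fin m → Type*} [∀ j, MeasurableSpace (β j)]
    {c : (j : Fin m) → Ω → β j} (hc : ∀ j, Measurable (c j)) (hi : iIndepFun c μ)
    {g : (j : Fin m) → β j → ENNReal} (hg : ∀ j, Measurable (g j)) :
    ∫⁻ ω, ∏ j, g j (c j ω) ∂μ = ∏ j, ∫⁻ ω, g j (c j ω) ∂μ :=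
  lintegral_prod_eq_prod_lintegral_of_indepFun Finset.univ (fun j ω => g j (c j ω))
    (hi.comp g hg) (fun j => (hg j).comp (hc j))

theorem lintegral_exp_neg_mul_Ioi {a : ℝ} (ha : 0 < a) :
    ∫⁻ w in Set.Ioi (0 : ℝ), ENNReal.ofReal (Real.exp (-a * w)) = ENNReal.ofReal (1 / a) := by
  rw [← ofReal_integral_eq_lintegral_ofReal (integrableOn_exp_mul_Ioi (by linarith) 0)
    (Filter.Eventually.of_forall fun _ => (Real.exp_pos _).le),
    integral_exp_mul_Ioi (by linarith)]
  congr 1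
  field_simp
  simp

variable [IsProbabilityMeasure μ]

/-- Layer cake formula for exponential moments. -/
theorem lintegral_exp_eq {Y : Ω → ℝ} (hY : Measurable Y) (hY0 : ∀ ω, 0 ≤ Y ω) {a : ℝ}
    (ha : 0 < a) :
    ∫⁻ ω, ENNReal.ofReal (Real.exp (a * Y ω)) ∂μ =
      1 + ∫⁻ w in Set.Ioi 0, μ {ω | w ≤ Y ω} * ENNReal.ofReal (a * Real.exp (a * w)) := by
  rw [← lintegral_comp_eq_lintegral_meas_le_mul μ (Filter.Eventually.of_forall hY0)
    hY.aemeasurable (fun t _ => (by fun_prop : Continuous fun w => a * Real.exp (a * w))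
      |>.intervalIntegrable 0 t) (Filter.Eventually.of_forall fun w => by positivity)]
  have h1 : ∀ y : ℝ, ∫ t in (0 : ℝ)..y, a * Real.exp (a * t) = Real.exp (a * y) - 1 := by
    intro y
    rw [intervalIntegral.integral_eq_sub_of_hasDerivAt (f := fun t => Real.exp (a * t))]
    · simp
    · intro t _
      have := ((hasDerivAt_id t).const_mul a).exp
      simpa [mul_comm] using this
    · exact (by fun_prop : Continuous fun w => a * Real.exp (a * w)).intervalIntegrable 0 y
  simp only [h1]
  have h2 : ∀ ω, ENNReal.ofReal (Real.exp (a * Y ω)) =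
      1 + ENNReal.ofReal (Real.exp (a * Y ω) - 1) := by
    intro ω
    rw [← ENNReal.ofReal_one, ← ENNReal.ofReal_add zero_le_one]
    · congr 1; ring
    · have := Real.one_le_exp (mul_nonneg ha.le (hY0 ω))
      linarith
  simp only [h2]
  rw [lintegral_add_left measurable_const]
  simp

/-- Halving the sub-Gaussian exponent gives the tail 2e^(-2w) against the weight e^w, so the layer
cake integral is at most 2. -/
theorem lintegral_exp_sq_le {X : Ω → ℝ} (hX : Measurable X) {K : ℝ} (hK : 0 < K)
    (h : ∀ t, 0 < t → μ.real {ω | t ≤ |X ω|} ≤ 2 * Real.exp (-t ^ 2 / K ^ 2)) :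
    ∫⁻ ω, ENNReal.ofReal (Real.exp (X ω ^ 2 / (2 * K ^ 2))) ∂μ ≤ 3 := by
  have h1 := lintegral_exp_eq (μ := μ) (Y := fun ω => X ω ^ 2 / (2 * K ^ 2))
    (by fun_prop) (fun ω => by positivity) one_pos
  simp only [one_mul] at h1
  rw [h1]
  have h2 : ∀ w ∈ Set.Ioi (0 : ℝ), μ {ω | w ≤ X ω ^ 2 / (2 * K ^ 2)} * ENNReal.ofReal (Real.exp w)
      ≤ 2 * ENNReal.ofReal (Real.exp (-1 * w)) := by
    intro w hw
    have hw : 0 < w := hw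
    have hset : {ω | w ≤ X ω ^ 2 / (2 * K ^ 2)} = {ω | √(2 * w) * K ≤ |X ω|} := by
      ext ω
      simp only [Set.mem_ofPred_eq]
      rw [le_div_iff₀ (by positivity), ← sq_le_sq₀ (a := √(2 * w) * K) (by positivity) (abs_nonneg _), sq_abs, mul_pow,
        Real.sq_sqrt (by positivity)]
      constructor <;> intro h <;> linarith
    have h3 := h (√(2 * w) * K) (by positivity)
    rw [hset, ← ofReal_measureReal]
    refine (mul_le_mul_left (ENNReal.ofReal_le_ofReal h3) _).trans ?_
    rw [← ENNReal.ofReal_mul (by positivity), mul_pow, Real.sq_sqrt (by positivity), mul_assoc,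
      ← Real.exp_add, ENNReal.ofReal_mul zero_le_two, ENNReal.ofReal_ofNat]
    refine le_of_eq ?_
    congr 3
    field_simp
    ring
  calc _ ≤ 1 + ∫⁻ w in Set.Ioi (0 : ℝ), 2 * ENNReal.ofReal (Real.exp (-1 * w)) := by
        gcongr 1 + ?_
        exact setLIntegral_mono' measurableSet_Ioi h2
    _ = 1 + 2 := by
        rw [lintegral_const_mul _ (by fun_prop), lintegral_exp_neg_mul_Ioi one_pos]
        simp
    _ = 3 := by norm_num

/-- A small ball bound in a form that multiplies over independent coordinates. With k the integer
part of |X|/ε, the integrand is at most 2^(-k), and ∑ (k + 1) 2^(-k) = 4. -/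
theorem lintegral_exp_neg_sq_le {X : Ω → ℝ} (hX : Measurable X) {b : ℝ} (hb : 0 ≤ b)
    (h : ∀ ε, 0 < ε → μ.real {ω | |X ω| ≤ ε} ≤ b * ε) {ε : ℝ} (hε : 0 < ε) :
    ∫⁻ ω, ENNReal.ofReal (Real.exp (-(X ω / ε) ^ 2)) ∂μ ≤ ENNReal.ofReal (4 * b * ε) := by
  have hm : ∀ k : ℕ, MeasurableSet {ω | |X ω| ≤ ε * (k + 1)} := fun k =>
    measurableSet_le (by fun_prop) measurable_const
  have hpt : ∀ ω, ENNReal.ofReal (Real.exp (-(X ω / ε) ^ 2)) ≤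
      ∑' k : ℕ, Set.indicator {ω | |X ω| ≤ ε * (k + 1)}
        (fun _ => ENNReal.ofReal ((1 / 2) ^ k)) ω := by
    intro ω
    set k := ⌊|X ω| / ε⌋₊ with hk
    have hk0 : (k : ℝ) ≤ |X ω| / ε := Nat.floor_le (by positivity)
    have hk1 : |X ω| / ε < k + 1 := Nat.lt_floor_add_one _
    refine le_trans ?_ (ENNReal.le_tsum k)
    rw [Set.indicator_of_mem (by
      rw [Set.mem_ofPred_eq]
      rw [div_lt_iff₀ hε] at hk1
      linarith)]
    refine ENNReal.ofReal_le_ofReal ?_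
    have h1 : (k : ℝ) ≤ (X ω / ε) ^ 2 := by
      have h2 : (k : ℝ) ≤ (k : ℝ) ^ 2 := by exact_mod_cast Nat.le_self_pow two_ne_zero k
      have h3 : (k : ℝ) ^ 2 ≤ (|X ω| / ε) ^ 2 := by gcongr
      rw [div_pow, sq_abs, ← div_pow] at h3
      linarith
    have h4 : Real.exp (-1) ≤ 1 / 2 := by
      rw [Real.exp_neg, ← one_div]
      exact one_div_le_one_div_of_le two_pos (by linarith [Real.exp_one_gt_d9])
    calc Real.exp (-(X ω / ε) ^ 2) ≤ Real.exp (k * -1) := by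
          apply Real.exp_le_exp.2; linarith
      _ = Real.exp (-1) ^ k := Real.exp_nat_mul _ _
      _ ≤ (1 / 2) ^ k := by gcongr
  have hsum : HasSum (fun k : ℕ => (1 / 2 : ℝ) ^ k * (b * (ε * (k + 1)))) (4 * b * ε) := by
    have h1 : HasSum (fun k : ℕ => (k : ℝ) * (1 / 2 : ℝ) ^ k) ((1 / 2) / (1 - 1 / 2) ^ 2) :=
      hasSum_coe_mul_geometric_of_norm_lt_one (by norm_num)
    have h2 := (h1.add hasSum_geometric_two).mul_left (b * ε)
    have h3 : (fun k : ℕ => (1 / 2 : ℝ) ^ k * (b * (ε * (k + 1)))) =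
        fun k : ℕ => b * ε * (k * (1 / 2 : ℝ) ^ k + (1 / 2) ^ k) := by
      funext k; ring
    have h4 : b * ε * (1 / 2 / (1 - 1 / 2) ^ 2 + 2) = 4 * b * ε := by norm_num; ring
    rw [h3, ← h4]
    exact h2
  calc _ ≤ ∫⁻ ω, ∑' k : ℕ, Set.indicator {ω | |X ω| ≤ ε * (k + 1)}
        (fun _ => ENNReal.ofReal ((1 / 2) ^ k)) ω ∂μ := lintegral_mono hpt
    _ = ∑' k : ℕ, ENNReal.ofReal ((1 / 2) ^ k) * μ {ω | |X ω| ≤ ε * (k + 1)} := by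
        rw [lintegral_tsum fun k => (measurable_const.indicator (hm k)).aemeasurable]
        simp only [lintegral_indicator_const (hm _)]
    _ ≤ ∑' k : ℕ, ENNReal.ofReal ((1 / 2 : ℝ) ^ k * (b * (ε * (k + 1)))) := by
        refine ENNReal.tsum_le_tsum fun k => ?_
        rw [ENNReal.ofReal_mul (by positivity), ← ofReal_measureReal]
        gcongr
        exact h _ (by positivity)
    _ = ENNReal.ofReal (4 * b * ε) := by
        rw [← ENNReal.ofReal_tsum_of_nonneg (fun k => by positivity) hsum.summable, hsum.tsum_eq]

end Moments

/-! ### The norm of a sub-Gaussian vector. -/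

section Vectors

variable {Ω : Type*} [MeasurableSpace Ω] {μ : Measure Ω} [IsProbabilityMeasure μ]
  {ι : Type*} [Fintype ι] {X : Ω → EuclideanSpace ℝ ι} {K c₀ : ℝ}

theorem IsSubGaussianVector.lintegral_exp_inner_sq_le (hX : Measurable X) (hK : 0 < K)
    (h : IsSubGaussianVector μ X K) {θ : EuclideanSpace ℝ ι} (hθ : ‖θ‖ ≤ 1) :
    ∫⁻ ω, ENNReal.ofReal (Real.exp ((inner ℝ (X ω) θ) ^ 2 / (2 * K ^ 2))) ∂μ ≤ 3 := by
  rcases eq_or_ne θ 0 with rfl | h0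
  · simp
  have hn : ‖θ‖ ≠ 0 := norm_ne_zero_iff.2 h0
  have h1 := lintegral_exp_sq_le (μ := μ) (X := fun ω => inner ℝ (X ω) (‖θ‖⁻¹ • θ))
    (hX.inner_const) hK
    (h (‖θ‖⁻¹ • θ) (by rw [norm_smul, norm_inv, norm_norm, inv_mul_cancel₀ hn]))
  refine le_trans (lintegral_mono fun ω => ?_) h1
  refine ENNReal.ofReal_le_ofReal (Real.exp_le_exp.2 ?_)
  have h2 : inner ℝ (X ω) θ = ‖θ‖ * inner ℝ (X ω) (‖θ‖⁻¹ • θ) := by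
    rw [inner_smul_right, ← mul_assoc, mul_inv_cancel₀ hn, one_mul]
  rw [h2, mul_pow]
  gcongr
  exact mul_le_of_le_one_left (sq_nonneg _) (pow_le_one₀ (norm_nonneg _) hθ)

/-- The norm of a sub-Gaussian vector has a sub-Gaussian moment bound. -/
theorem IsSubGaussianVector.lintegral_exp_norm_sq_le (hX : Measurable X) (hK : 0 < K)
    (h : IsSubGaussianVector μ X K) :
    ∫⁻ ω, ENNReal.ofReal (Real.exp (‖X ω‖ ^ 2 / (8 * K ^ 2))) ∂μ ≤ 3 * 4 ^ Fintype.card ι := by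
  set B : Set (EuclideanSpace ℝ ι) := Metric.ball 0 1 with hB
  have hV0 : volume B ≠ 0 := (Metric.measure_ball_pos volume _ one_pos).ne'
  have hVt : volume B ≠ ⊤ := measure_ball_lt_top.ne
  -- Averaging over directions replaces a net. On the ball of radius 1/4 about 3/4 of the direction
  -- of X, which lies in the unit ball, the inner product with X is at least ‖X‖/2. This ball is a
  -- fraction 4^(-dim) of the unit ball.
  have hlow : ∀ ω, ENNReal.ofReal (Real.exp (‖X ω‖ ^ 2 / (8 * K ^ 2))) *
      (ENNReal.ofReal ((1 / 4) ^ Fintype.card ι) * volume B) ≤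
      ∫⁻ θ in B, ENNReal.ofReal (Real.exp ((inner ℝ (X ω) θ) ^ 2 / (2 * K ^ 2))) := by
    intro ω
    set z := (3 / 4 : ℝ) • (‖X ω‖⁻¹ • X ω) with hz
    have hzn : ‖z‖ ≤ 3 / 4 := by
      rw [hz, norm_smul, norm_smul, norm_inv, norm_norm, Real.norm_of_nonneg (by norm_num)]
      have := inv_mul_le_one (a := ‖X ω‖)
      linarith
    have hXz : inner ℝ (X ω) z = 3 / 4 * ‖X ω‖ := by
      rw [hz, inner_smul_right, inner_smul_right, real_inner_self_eq_norm_sq]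
      rcases eq_or_ne ‖X ω‖ 0 with h0 | h0
      · rw [h0]; simp
      · field_simp
    have hsub : Metric.ball z (1 / 4) ⊆ B := by
      refine Metric.ball_subset_ball' ?_
      rw [dist_zero_right]; linarith
    rw [← finrank_euclideanSpace (𝕜 := ℝ) (ι := ι),
      ← Measure.addHaar_ball_of_pos volume z (by norm_num : (0 : ℝ) < 1 / 4),
      ← setLIntegral_const]
    refine le_trans (setLIntegral_mono' measurableSet_ball fun θ hθ => ?_)
      (lintegral_mono_set hsub)
    refine ENNReal.ofReal_le_ofReal (Real.exp_le_exp.2 ?_)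
    have h1 : ‖X ω‖ / 2 ≤ inner ℝ (X ω) θ := by
      have h2 : inner ℝ (X ω) θ = 3 / 4 * ‖X ω‖ + inner ℝ (X ω) (θ - z) := by
        rw [inner_sub_right, hXz]; ring
      have h3 := abs_real_inner_le_norm (X ω) (θ - z)
      rw [mem_ball_iff_norm] at hθ
      have h4 : ‖X ω‖ * ‖θ - z‖ ≤ ‖X ω‖ * (1 / 4) := by gcongr
      have := (abs_le.1 h3).1
      linarith
    have h5 : (‖X ω‖ / 2) ^ 2 ≤ (inner ℝ (X ω) θ) ^ 2 := by gcongr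
    rw [div_le_div_iff₀ (by positivity) (by positivity)]
    nlinarith [sq_nonneg K]
  have hmeas : Measurable (Function.uncurry fun (ω : Ω) (θ : EuclideanSpace ℝ ι) =>
      ENNReal.ofReal (Real.exp ((inner ℝ (X ω) θ) ^ 2 / (2 * K ^ 2)))) := by
    have : Measurable fun p : Ω × EuclideanSpace ℝ ι => (inner ℝ (X p.1) p.2 : ℝ) :=
      (hX.comp measurable_fst).inner measurable_snd
    unfold Function.uncurry
    fun_prop
  have hup : ∫⁻ ω, (∫⁻ θ in B,
      ENNReal.ofReal (Real.exp ((inner ℝ (X ω) θ) ^ 2 / (2 * K ^ 2)))) ∂μ ≤ 3 * volume B := by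
    rw [lintegral_lintegral_swap hmeas.aemeasurable, ← setLIntegral_const]
    refine setLIntegral_mono' measurableSet_ball fun θ hθ => ?_
    rw [mem_ball_zero_iff] at hθ
    exact h.lintegral_exp_inner_sq_le hX hK hθ.le
  have h1 := (lintegral_mono hlow).trans hup
  rw [lintegral_mul_const _ (by fun_prop), ← mul_assoc] at h1
  have h2 := (ENNReal.mul_le_mul_iff_left hV0 hVt).1 h1
  have h4 : ENNReal.ofReal ((1 / 4) ^ Fintype.card ι) = (4 ^ Fintype.card ι)⁻¹ := by
    rw [ENNReal.ofReal_pow (by norm_num), one_div, ENNReal.ofReal_inv_of_pos (by norm_num),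
      ENNReal.ofReal_ofNat, ENNReal.inv_pow]
  rw [h4, ← div_eq_mul_inv] at h2
  exact (ENNReal.div_le_iff (by simp) (by simp)).1 h2

end Vectors

/-! ### Random systems: small values, sup norm and Weyl norm. -/

section Systems

variable {n m : ℕ} {deg : Fin m → ℕ}

/-- The values at `z` of the forms with coefficient vectors `c j`. -/
noncomputable def systemEval (c : (j : Fin m) → EuclideanSpace ℝ (MultiIndex n (deg j)))
    (z : EuclideanSpace ℝ (Fin n)) : EuclideanSpace ℝ (Fin m) :=
  WithLp.toLp 2 fun j => inner ℝ (c j) (veroneseVec (deg j) z)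

theorem systemEval_apply (c : (j : Fin m) → EuclideanSpace ℝ (MultiIndex n (deg j)))
    (z : EuclideanSpace ℝ (Fin n)) (j : Fin m) :
    systemEval c z j = inner ℝ (c j) (veroneseVec (deg j) z) := rfl

theorem isFormSystem_systemEval (c : (j : Fin m) → EuclideanSpace ℝ (MultiIndex n (deg j))) :
    IsFormSystem deg (systemEval c) where
  hom j r x := by
    rw [systemEval_apply, systemEval_apply, veroneseVec_smul, inner_smul_right]
  trig j x y := isTrigPoly_eval_formOfCoeff (c j) x y

theorem continuous_systemEval (c : (j : Fin m) → EuclideanSpace ℝ (MultiIndex n (deg j))) :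
    Continuous (systemEval c) := by
  have : ∀ j, Continuous fun z : EuclideanSpace ℝ (Fin n) => veroneseVec (deg j) z :=
    fun j => continuous_veroneseVec
  unfold systemEval
  fun_prop

theorem norm_systemEval_sq (c : (j : Fin m) → EuclideanSpace ℝ (MultiIndex n (deg j)))
    (z : EuclideanSpace ℝ (Fin n)) :
    ‖systemEval c z‖ ^ 2 = ∑ j, (inner ℝ (c j) (veroneseVec (deg j) z)) ^ 2 := by
  rw [EuclideanSpace.norm_sq_eq]
  simp only [systemEval_apply, Real.norm_eq_abs, sq_abs]

variable {Ω : Type*} [MeasurableSpace Ω] {μ : Measure Ω}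
  {c : (j : Fin m) → Ω → EuclideanSpace ℝ (MultiIndex n (deg j))} {K c₀ : ℝ}

theorem measurable_systemEval (hc : ∀ j, Measurable (c j)) :
    Measurable fun p : Ω × EuclideanSpace ℝ (Fin n) => systemEval (fun j => c j p.1) p.2 := by
  have h : ∀ j, Measurable fun p : Ω × EuclideanSpace ℝ (Fin n) =>
      (inner ℝ (c j p.1) (veroneseVec (deg j) p.2) : ℝ) := fun j =>
    ((hc j).comp measurable_fst).inner (continuous_veroneseVec.measurable.comp measurable_snd)
  exact (WithLp.measurable_toLp 2 (Fin m → ℝ)).comp (measurable_pi_lambda _ h)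

variable [IsProbabilityMeasure μ]

/-- Tensorization: Markov's inequality for ∏ exp(-(X_j/ε)²), whose expectation factors by
independence. In 24 = 4·2·3, the 4 comes from `lintegral_exp_neg_sq_le`, the 2 from ‖`veroneseVec`‖
≥ 1/2 on the shell, and the 3 bounds e in the loss e^m. -/
theorem measure_norm_systemEval_le (hc : ∀ j, Measurable (c j)) (hi : iIndepFun c μ)
    (hc₀ : 0 < c₀) (hsb : ∀ j, HasSmallBall μ (c j) c₀) (hm : 0 < m) {d : ℕ} (hd : 0 < d)
    (hdeg : ∀ j, deg j ≤ d) {z : EuclideanSpace ℝ (Fin n)} (hz : 1 - 1 / (2 * d : ℝ) ≤ ‖z‖)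
    (hz1 : ‖z‖ ≤ 1) {τ : ℝ} (hτ : 0 < τ) :
    μ {ω | ‖systemEval (fun j => c j ω) z‖ ≤ τ} ≤ ENNReal.ofReal ((24 * c₀ * (τ / √m)) ^ m) := by
  have hm0 : (0 : ℝ) < m := by exact_mod_cast hm
  have hd1 : (1 : ℝ) ≤ d := by exact_mod_cast hd
  -- With this scale, ‖F(z)‖ ≤ τ becomes ∑ (X_j/ε)² ≤ m.
  set ε := τ / √m with hε
  have hε0 : 0 < ε := by positivity
  have h1d : 1 / (2 * d : ℝ) ≤ 1 / 2 := one_div_le_one_div_of_le two_pos (by linarith)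
  have hθ : ∀ j, 1 / 2 ≤ ‖veroneseVec (deg j) z‖ := by
    intro j
    rw [norm_veroneseVec]
    have hB := one_add_mul_le_pow (a := -(1 / (2 * d : ℝ))) (by linarith) d
    calc (1 : ℝ) / 2 = 1 + d * -(1 / (2 * d : ℝ)) := by field_simp; norm_num
      _ ≤ (1 + -(1 / (2 * d : ℝ))) ^ d := hB
      _ = (1 - 1 / (2 * d : ℝ)) ^ d := by ring
      _ ≤ ‖z‖ ^ d := by gcongr; linarith
      _ ≤ ‖z‖ ^ deg j := pow_le_pow_of_le_one (norm_nonneg _) hz1 (hdeg j)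
  let X : Fin m → Ω → ℝ := fun j ω => inner ℝ (c j ω) (veroneseVec (deg j) z)
  have hX : ∀ j, ∫⁻ ω, ENNReal.ofReal (Real.exp (-(X j ω / ε) ^ 2)) ∂μ ≤
      ENNReal.ofReal (4 * (2 * c₀) * ε) := by
    intro j
    refine lintegral_exp_neg_sq_le ((hc j).inner_const) (by positivity) (fun t ht => ?_) hε0
    have hθ0 : 0 < ‖veroneseVec (deg j) z‖ := by linarith [hθ j]
    have h1 := hsb j (veroneseVec (deg j) z) (norm_pos_iff.1 hθ0) (t / ‖veroneseVec (deg j) z‖)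
      (by positivity)
    rw [div_mul_cancel₀ _ hθ0.ne'] at h1
    have hcomm : ∀ ω, X j ω = inner ℝ (veroneseVec (deg j) z) (c j ω) := fun ω =>
      real_inner_comm _ _
    change μ.real {ω | |X j ω| ≤ t} ≤ _
    simp only [hcomm]
    refine h1.trans ?_
    have : t / ‖veroneseVec (deg j) z‖ ≤ 2 * t := by
      rw [div_le_iff₀ hθ0]; nlinarith [hθ j]
    nlinarith
  have hprod : ∫⁻ ω, ∏ j, ENNReal.ofReal (Real.exp (-(X j ω / ε) ^ 2)) ∂μ ≤
      ENNReal.ofReal (8 * c₀ * ε) ^ m := by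
    have := lintegral_prod_comp_eq hc hi
      (g := fun j x => ENNReal.ofReal (Real.exp (-(inner ℝ x (veroneseVec (deg j) z) / ε) ^ 2)))
      (fun j => by fun_prop)
    rw [this]
    refine (Finset.prod_le_prod' fun j _ => hX j).trans ?_
    rw [Finset.prod_const, Finset.card_univ, Fintype.card_fin]
    refine pow_le_pow_left' (ENNReal.ofReal_le_ofReal (le_of_eq ?_)) m
    ring
  have hsub : {ω | ‖systemEval (fun j => c j ω) z‖ ≤ τ} ⊆
      {ω | ENNReal.ofReal (Real.exp (-m)) ≤ ∏ j, ENNReal.ofReal (Real.exp (-(X j ω / ε) ^ 2))} := by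
    intro ω hω
    rw [Set.mem_ofPred_eq] at hω ⊢
    rw [← ENNReal.ofReal_prod_of_nonneg (fun _ _ => (Real.exp_pos _).le), ← Real.exp_sum]
    refine ENNReal.ofReal_le_ofReal (Real.exp_le_exp.2 ?_)
    rw [Finset.sum_neg_distrib, neg_le_neg_iff]
    simp only [div_pow]
    rw [← Finset.sum_div]
    simp only [X]
    rw [← norm_systemEval_sq (fun j => c j ω), div_le_iff₀ (by positivity), hε, div_pow,
      Real.sq_sqrt hm0.le, mul_div_cancel₀ _ hm0.ne']
    gcongr
  have hmeas : AEMeasurable (fun ω => ∏ j, ENNReal.ofReal (Real.exp (-(X j ω / ε) ^ 2))) μ := by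
    have : ∀ j, Measurable (X j) := fun j => (hc j).inner_const
    fun_prop
  have hmk := mul_meas_ge_le_lintegral₀ hmeas (ENNReal.ofReal (Real.exp (-m)))
  have h2 := (mul_le_mul_right (measure_mono hsub) (ENNReal.ofReal (Real.exp (-m)))).trans
    (hmk.trans hprod)
  have h3 : μ {ω | ‖systemEval (fun j => c j ω) z‖ ≤ τ} =
      ENNReal.ofReal (Real.exp m) * (ENNReal.ofReal (Real.exp (-m)) *
        μ {ω | ‖systemEval (fun j => c j ω) z‖ ≤ τ}) := by
    rw [← mul_assoc, ← ENNReal.ofReal_mul (Real.exp_pos _).le, ← Real.exp_add]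
    simp
  rw [h3]
  refine (mul_le_mul_right h2 _).trans ?_
  rw [← ENNReal.ofReal_pow (by positivity), ← ENNReal.ofReal_mul (Real.exp_pos _).le]
  refine ENNReal.ofReal_le_ofReal ?_
  have h4 : Real.exp m ≤ 3 ^ m := by
    rw [← mul_one (m : ℝ), Real.exp_nat_mul]
    gcongr
    linarith [Real.exp_one_lt_d9]
  calc Real.exp m * (8 * c₀ * ε) ^ m ≤ 3 ^ m * (8 * c₀ * ε) ^ m := by gcongr
    _ = (24 * c₀ * ε) ^ m := by rw [← mul_pow]; ring

/-- Markov's inequality for the volume of the set where the system is small. -/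
theorem measure_volume_small_le (hc : ∀ j, Measurable (c j)) (hi : iIndepFun c μ)
    (hc₀ : 0 < c₀) (hsb : ∀ j, HasSmallBall μ (c j) c₀) (hm : 0 < m) {d : ℕ} (hd : 0 < d)
    (hdeg : ∀ j, deg j ≤ d) {τ : ℝ} (hτ : 0 < τ) {v : ℝ} (hv : 0 < v) :
    μ {ω | ENNReal.ofReal v * volume (Metric.ball (0 : EuclideanSpace ℝ (Fin n)) 1) ≤
      volume {z : EuclideanSpace ℝ (Fin n) | 1 - 1 / (2 * d : ℝ) ≤ ‖z‖ ∧ ‖z‖ ≤ 1 ∧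
        ‖systemEval (fun j => c j ω) z‖ ≤ τ}} ≤
      ENNReal.ofReal (v⁻¹ * (24 * c₀ * (τ / √m)) ^ m) := by
  set B : Set (EuclideanSpace ℝ (Fin n)) := Metric.ball 0 1 with hB
  set S : Set (EuclideanSpace ℝ (Fin n)) := {z | 1 - 1 / (2 * d : ℝ) ≤ ‖z‖ ∧ ‖z‖ ≤ 1} with hS
  have hV0 : volume B ≠ 0 := (Metric.measure_ball_pos volume _ one_pos).ne'
  have hVt : volume B ≠ ⊤ := measure_ball_lt_top.ne
  have hSm : MeasurableSet S :=
    (measurableSet_le measurable_const measurable_norm).inter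
      (measurableSet_le measurable_norm measurable_const)
  have hSB : volume S ≤ volume B := by
    rw [hB, ← Measure.addHaar_unitClosedBall_eq_addHaar_unitBall]
    refine measure_mono fun z hz => ?_
    rw [mem_closedBall_zero_iff]
    exact hz.2
  set T : Set (Ω × EuclideanSpace ℝ (Fin n)) :=
    {p | p.2 ∈ S ∧ ‖systemEval (fun j => c j p.1) p.2‖ ≤ τ} with hT
  have hTm : MeasurableSet T :=
    (measurable_snd hSm).inter (measurableSet_le (measurable_systemEval hc).norm measurable_const)
  have hslice : ∀ ω, {z : EuclideanSpace ℝ (Fin n) | 1 - 1 / (2 * d : ℝ) ≤ ‖z‖ ∧ ‖z‖ ≤ 1 ∧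
      ‖systemEval (fun j => c j ω) z‖ ≤ τ} = Prod.mk ω ⁻¹' T := by
    intro ω
    ext z
    simp only [hT, hS, Set.mem_ofPred_eq, Set.mem_preimage, and_assoc]
  simp only [hslice]
  -- By Tonelli the expected volume is the integral over the shell of the pointwise small ball
  -- probabilities.
  have h1 : ∫⁻ ω, volume (Prod.mk ω ⁻¹' T) ∂μ ≤
      ENNReal.ofReal ((24 * c₀ * (τ / √m)) ^ m) * volume B := by
    rw [← Measure.prod_apply hTm, Measure.prod_apply_symm hTm]
    calc _ ≤ ∫⁻ z in S, ENNReal.ofReal ((24 * c₀ * (τ / √m)) ^ m) := by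
          rw [← lintegral_indicator hSm]
          refine lintegral_mono fun z => ?_
          by_cases hz : z ∈ S
          · rw [Set.indicator_of_mem hz]
            refine le_trans (measure_mono fun ω hω => ?_)
              (measure_norm_systemEval_le hc hi hc₀ hsb hm hd hdeg hz.1 hz.2 hτ)
            exact hω.2
          · rw [Set.indicator_of_notMem hz, nonpos_iff_eq_zero]
            convert measure_empty (μ := μ)
            ext ω
            simp [hT, hz]
      _ = ENNReal.ofReal ((24 * c₀ * (τ / √m)) ^ m) * volume S := setLIntegral_const _ _
      _ ≤ _ := by gcongr
  have h2 := (mul_meas_ge_le_lintegral₀ (measurable_measure_prodMk_left hTm).aemeasurable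
    (ENNReal.ofReal v * volume B)).trans h1
  rw [mul_right_comm] at h2
  have h3 := (ENNReal.mul_le_mul_iff_left hV0 hVt).1 h2
  rw [ENNReal.ofReal_mul (by positivity), ENNReal.ofReal_inv_of_pos hv,
    mul_comm (ENNReal.ofReal v)⁻¹, ← div_eq_mul_inv, ENNReal.le_div_iff_mul_le (Or.inl (by simpa using hv)) (Or.inl (by simp)),
    mul_comm (μ _)]
  exact h3

/-- If the maximum on the sphere exceeds R, then ‖F‖ ≥ R/4 on a ball of radius 1/(28d) near the
maximum point, which makes the integral of exp(‖F‖²/(2K²)) over the unit ball large. Its expectation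
is at most 3^m times the volume of that ball. -/
theorem measure_exists_lt_norm_systemEval_le (hc : ∀ j, Measurable (c j)) (hi : iIndepFun c μ)
    (hK : 0 < K) (hsg : ∀ j, IsSubGaussianVector μ (c j) K) {d : ℕ} (hd : 0 < d)
    (hdeg : ∀ j, deg j ≤ d) {R : ℝ} (hR : 0 ≤ R) :
    μ {ω | ∃ x : EuclideanSpace ℝ (Fin n), ‖x‖ = 1 ∧ R < ‖systemEval (fun j => c j ω) x‖} ≤
      ENNReal.ofReal (3 ^ m * (28 * d) ^ n * Real.exp (-(R ^ 2 / (32 * K ^ 2)))) := by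
  set B : Set (EuclideanSpace ℝ (Fin n)) := Metric.ball 0 1 with hB
  have hV0 : volume B ≠ 0 := (Metric.measure_ball_pos volume _ one_pos).ne'
  have hVt : volume B ≠ ⊤ := measure_ball_lt_top.ne
  have hd1 : (1 : ℝ) ≤ d := by exact_mod_cast hd
  have hd0 : (0 : ℝ) < d := by linarith
  set f : Ω → EuclideanSpace ℝ (Fin n) → ENNReal := fun ω z =>
    ENNReal.ofReal (Real.exp (‖systemEval (fun j => c j ω) z‖ ^ 2 / (2 * K ^ 2))) with hf
  have hfm : Measurable (Function.uncurry f) := by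
    have := measurable_systemEval hc
    simp only [hf, Function.uncurry_def]
    fun_prop
  have hup : ∫⁻ ω, (∫⁻ z in B, f ω z) ∂μ ≤ 3 ^ m * volume B := by
    rw [lintegral_lintegral_swap hfm.aemeasurable, ← setLIntegral_const]
    refine setLIntegral_mono' measurableSet_ball fun z hz => ?_
    rw [mem_ball_zero_iff] at hz
    have h1 : ∀ ω, f ω z = ∏ j, ENNReal.ofReal
        (Real.exp ((inner ℝ (c j ω) (veroneseVec (deg j) z)) ^ 2 / (2 * K ^ 2))) := by
      intro ω
      rw [← ENNReal.ofReal_prod_of_nonneg (fun _ _ => (Real.exp_pos _).le), ← Real.exp_sum,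
        ← Finset.sum_div, ← norm_systemEval_sq (fun j => c j ω)]
    simp only [h1]
    rw [lintegral_prod_comp_eq hc hi (g := fun j x => ENNReal.ofReal
      (Real.exp ((inner ℝ x (veroneseVec (deg j) z)) ^ 2 / (2 * K ^ 2)))) (fun j => by fun_prop)]
    calc _ ≤ ∏ _j : Fin m, (3 : ENNReal) := by
          refine Finset.prod_le_prod' fun j _ => ?_
          refine (hsg j).lintegral_exp_inner_sq_le (hc j) hK ?_
          rw [norm_veroneseVec]
          exact pow_le_one₀ (norm_nonneg _) hz.le
      _ = 3 ^ m := by simp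
  set v : ℝ := Real.exp (R ^ 2 / (32 * K ^ 2)) * (1 / (28 * d)) ^ n with hv
  have hv0 : 0 < v := by positivity
  have hsub : {ω | ∃ x : EuclideanSpace ℝ (Fin n), ‖x‖ = 1 ∧
      R < ‖systemEval (fun j => c j ω) x‖} ⊆
      {ω | ENNReal.ofReal v * volume B ≤ ∫⁻ z in B, f ω z} := by
    rintro ω ⟨x, hx, hRx⟩
    rw [Set.mem_ofPred_eq]
    set F := systemEval (fun j => c j ω) with hF
    have hcomp : IsCompact (Metric.sphere (0 : EuclideanSpace ℝ (Fin n)) 1) := isCompact_sphere _ _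
    obtain ⟨e, he, hmax⟩ := hcomp.exists_isMaxOn ⟨x, by simpa using hx⟩
      (continuous_systemEval fun j => c j ω).norm.continuousOn
    have he1 : ‖e‖ = 1 := by simpa using he
    have hmax' : ∀ y : EuclideanSpace ℝ (Fin n), ‖y‖ = 1 → ‖F y‖ ≤ ‖F e‖ := fun y hy =>
      hmax (by simpa using hy)
    have hRe : R < ‖F e‖ := hRx.trans_le (hmax' x hx)
    set z₀ : EuclideanSpace ℝ (Fin n) := (1 - 1 / (4 * d : ℝ)) • e with hz₀
    have h4d : 1 / (4 * d : ℝ) ≤ 1 := by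
      rw [div_le_one (by positivity)]; linarith
    have hsubB : Metric.ball z₀ (1 / (28 * d)) ⊆ B := by
      refine Metric.ball_subset_ball' ?_
      rw [dist_zero_right, hz₀, norm_smul, he1, mul_one, Real.norm_of_nonneg (by linarith)]
      have : 1 / (28 * d : ℝ) ≤ 1 / (4 * d) :=
        one_div_le_one_div_of_le (by positivity) (by linarith)
      linarith
    have hvol := Measure.addHaar_ball_of_pos volume z₀ (by positivity : (0 : ℝ) < 1 / (28 * d))
    -- The factor (1/(28d))^n in `v` is exactly the relative volume of the ball near the maximum
    -- point.
    rw [finrank_euclideanSpace_fin] at hvol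
    rw [hv, ENNReal.ofReal_mul (Real.exp_pos _).le, mul_assoc, ← hvol, ← setLIntegral_const]
    refine le_trans (setLIntegral_mono' measurableSet_ball fun z hz => ?_)
      (lintegral_mono_set hsubB)
    rw [mem_ball_iff_norm] at hz
    have h5 := (isFormSystem_systemEval fun j => c j ω).le_norm_of_near hd hdeg hmax' he1 rfl hz.le
    simp only [hf]
    refine ENNReal.ofReal_le_ofReal (Real.exp_le_exp.2 ?_)
    have h6 : R / 4 ≤ ‖F z‖ := le_trans (by linarith) h5
    have h7 : (R / 4) ^ 2 ≤ ‖F z‖ ^ 2 := by gcongr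
    calc R ^ 2 / (32 * K ^ 2) = (R / 4) ^ 2 / (2 * K ^ 2) := by field_simp; ring
      _ ≤ _ := by gcongr
  have h1 := (mul_le_mul_right (measure_mono hsub) (ENNReal.ofReal v * volume B)).trans
    ((mul_meas_ge_le_lintegral₀ hfm.lintegral_prod_right'.aemeasurable _).trans hup)
  rw [mul_right_comm] at h1
  have h3 := (ENNReal.mul_le_mul_iff_left hV0 hVt).1 h1
  have h4 : (3 : ENNReal) ^ m = ENNReal.ofReal (3 ^ m) := by
    rw [ENNReal.ofReal_pow (by norm_num), ENNReal.ofReal_ofNat]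
  rw [h4, mul_comm, ← ENNReal.le_div_iff_mul_le (Or.inl (by simpa using hv0)) (Or.inl (by simp)),
    ← ENNReal.ofReal_div_of_pos hv0] at h3
  refine h3.trans (ENNReal.ofReal_le_ofReal (le_of_eq ?_))
  rw [hv, Real.exp_neg, div_pow, one_pow]
  field_simp

theorem measure_le_weylNorm_le (hn : 1 ≤ n) (hc : ∀ j, Measurable (c j))
    (hi : iIndepFun c μ)
    (hK : 0 < K) (hsg : ∀ j, IsSubGaussianVector μ (c j) K) {b : ℝ} (hb : 0 ≤ b) :
    μ {ω | b ≤ √(∑ j, ‖c j ω‖ ^ 2)} ≤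
      ENNReal.ofReal (12 ^ totalN n deg * Real.exp (-(b ^ 2 / (8 * K ^ 2)))) := by
  have hE : ∫⁻ ω, ∏ j, ENNReal.ofReal (Real.exp (‖c j ω‖ ^ 2 / (8 * K ^ 2))) ∂μ ≤
      12 ^ totalN n deg := by
    rw [lintegral_prod_comp_eq hc hi (g := fun j x => ENNReal.ofReal
      (Real.exp (‖x‖ ^ 2 / (8 * K ^ 2)))) (fun j => by fun_prop), totalN,
      ← Finset.prod_pow_eq_pow_sum]
    refine Finset.prod_le_prod' fun j _ => ?_
    refine ((hsg j).lintegral_exp_norm_sq_le (hc j) hK).trans ?_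
    rw [card_multiIndex]
    set k := (n + deg j - 1).choose (deg j)
    have hk : k ≠ 0 := (Nat.choose_pos (by omega)).ne'
    calc (3 : ENNReal) * 4 ^ k ≤ 3 ^ k * 4 ^ k := by
          gcongr
          exact le_self_pow₀ (by norm_num) hk
      _ = 12 ^ k := by rw [← mul_pow]; norm_num
  have hsub : {ω | b ≤ √(∑ j, ‖c j ω‖ ^ 2)} ⊆ {ω | ENNReal.ofReal (Real.exp (b ^ 2 / (8 * K ^ 2))) ≤
      ∏ j, ENNReal.ofReal (Real.exp (‖c j ω‖ ^ 2 / (8 * K ^ 2)))} := by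
    intro ω hω
    rw [Set.mem_ofPred_eq] at hω ⊢
    rw [← ENNReal.ofReal_prod_of_nonneg (fun _ _ => (Real.exp_pos _).le), ← Real.exp_sum,
      ← Finset.sum_div]
    refine ENNReal.ofReal_le_ofReal (Real.exp_le_exp.2 ?_)
    gcongr
    rw [← Real.sq_sqrt (Finset.sum_nonneg fun j _ => sq_nonneg ‖c j ω‖)]
    gcongr
  have hmeas : AEMeasurable (fun ω => ∏ j, ENNReal.ofReal (Real.exp (‖c j ω‖ ^ 2 / (8 * K ^ 2))))
      μ := by fun_prop
  have h1 := (mul_le_mul_right (measure_mono hsub) _).trans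
    ((mul_meas_ge_le_lintegral₀ hmeas _).trans hE)
  have h4 : (12 : ENNReal) ^ totalN n deg = ENNReal.ofReal (12 ^ totalN n deg) := by
    rw [ENNReal.ofReal_pow (by norm_num), ENNReal.ofReal_ofNat]
  rw [h4, mul_comm, ← ENNReal.le_div_iff_mul_le (Or.inl (by simpa using Real.exp_pos _))
    (Or.inl (by simp)), ← ENNReal.ofReal_div_of_pos (Real.exp_pos _)] at h1
  refine h1.trans (ENNReal.ofReal_le_ofReal (le_of_eq ?_))
  rw [Real.exp_neg, div_eq_mul_inv]

end Systems

/-! ### Variational description of the smallest singular value. -/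

section SingularValue

variable {E F : Type*} [NormedAddCommGroup E] [InnerProductSpace ℝ E] [FiniteDimensional ℝ E]
  [NormedAddCommGroup F] [InnerProductSpace ℝ F] [FiniteDimensional ℝ F]

/-- The last vector of an eigenbasis of T*T does it. Positive dimension makes the truncated index
dim E - 1 a genuine one. -/
theorem exists_norm_eq_sigmaMin (hE : 0 < Module.finrank ℝ E) (T : E →ₗ[ℝ] F) :
    ∃ y : E, ‖y‖ = 1 ∧ ‖T y‖ = sigmaMin T := by
  have hlt : Module.finrank ℝ E - 1 < Module.finrank ℝ E := by omega
  set b := T.isSymmetric_adjoint_comp_self.eigenvectorBasis rfl with hb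
  set i : Fin (Module.finrank ℝ E) := ⟨_, hlt⟩ with hi
  refine ⟨b i, b.orthonormal.1 i, ?_⟩
  have h1 : ‖T (b i)‖ ^ 2 = sigmaMin T ^ 2 := by
    rw [sigmaMin, T.sq_singularValues_of_lt rfl hlt, ← real_inner_self_eq_norm_sq,
      ← LinearMap.adjoint_inner_right]
    have h2 := T.isSymmetric_adjoint_comp_self.apply_eigenvectorBasis rfl i
    rw [LinearMap.comp_apply] at h2
    rw [hb, h2, inner_smul_right, real_inner_self_eq_norm_sq, ← hb, b.orthonormal.1 i]
    simp [hi]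
  exact (pow_left_inj₀ (norm_nonneg _) (T.singularValues_nonneg _) two_ne_zero).1 h1

/-- Expand y in an eigenbasis of T*T; the eigenvalues are listed in decreasing order, so the last is
a lower bound for all. -/
theorem sigmaMin_mul_norm_le (hE : 0 < Module.finrank ℝ E) (T : E →ₗ[ℝ] F) (y : E) :
    sigmaMin T * ‖y‖ ≤ ‖T y‖ := by
  have hlt : Module.finrank ℝ E - 1 < Module.finrank ℝ E := by omega
  have hS := T.isSymmetric_adjoint_comp_self
  set b := hS.eigenvectorBasis rfl with hb
  set i₀ : Fin (Module.finrank ℝ E) := ⟨_, hlt⟩ with hi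
  have h0 : 0 ≤ sigmaMin T := T.singularValues_nonneg _
  refine (sq_le_sq₀ (mul_nonneg h0 (norm_nonneg _)) (norm_nonneg _)).1 ?_
  have h1 : ‖T y‖ ^ 2 = ∑ i, hS.eigenvalues rfl i * (b.repr y i) ^ 2 := by
    rw [← real_inner_self_eq_norm_sq, ← LinearMap.adjoint_inner_right, ← LinearMap.comp_apply,
      ← b.repr.inner_map_map, PiLp.inner_apply]
    refine Finset.sum_congr rfl fun i _ => ?_
    rw [hb, hS.eigenvectorBasis_apply_self_apply rfl]
    simp
    ring
  have h2 : ‖y‖ ^ 2 = ∑ i, (b.repr y i) ^ 2 := by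
    rw [← b.repr.norm_map, EuclideanSpace.norm_sq_eq]
    simp
  have h3 : sigmaMin T ^ 2 = hS.eigenvalues rfl i₀ := T.sq_singularValues_of_lt rfl hlt
  rw [h1, mul_pow, h2, Finset.mul_sum, h3]
  refine Finset.sum_le_sum fun i _ => ?_
  refine mul_le_mul_of_nonneg_right (hS.eigenvalues_antitone rfl ?_) (sq_nonneg _)
  exact Fin.le_def.2 (Nat.le_sub_one_of_lt i.2)

end SingularValue

/-! ### The condition number over orthonormal pairs, its measurability and lower bound. -/

section Kappa

variable {n m : ℕ} {deg : Fin m → ℕ}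

/-- The coefficient vector of the derivative at `x` in direction `y`, as a function of a form. -/
noncomputable def derivVec (k : ℕ) (x y : EuclideanSpace ℝ (Fin n)) :
    EuclideanSpace ℝ (MultiIndex n k) :=
  WithLp.toLp 2 fun α => √(α.multinomial : ℝ) *
    ∑ i, MvPolynomial.eval x.ofLp (MvPolynomial.pderiv i (MvPolynomial.monomial α.toFinsupp 1)) *
      y i

/-- For fixed x and y the derivative is linear in the coefficients, which is what makes `condPair`
continuous in them. -/
theorem sum_eval_pderiv_formOfCoeff {k : ℕ} (c : EuclideanSpace ℝ (MultiIndex n k))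
    (x y : EuclideanSpace ℝ (Fin n)) :
    ∑ i, MvPolynomial.eval x.ofLp (MvPolynomial.pderiv i (formOfCoeff c)) * y i =
      inner ℝ c (derivVec k x y) := by
  have h : formOfCoeff c = ∑ α : MultiIndex n k,
      (c α * √(α.multinomial : ℝ)) • MvPolynomial.monomial α.toFinsupp (1 : ℝ) := by
    simp [formOfCoeff, MvPolynomial.smul_monomial]
  simp only [h, map_sum, Derivation.map_smul, MvPolynomial.smul_eval, Finset.sum_mul, derivVec,
    PiLp.inner_apply, RCLike.inner_apply, conj_trivial]
  rw [Finset.sum_comm]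
  refine Finset.sum_congr rfl fun α _ => ?_
  rw [Finset.mul_sum, Finset.sum_mul]
  exact Finset.sum_congr rfl fun i _ => by ring

/-- The derivative at `x` in direction `y` of the system with coefficient vectors `c j`. -/
noncomputable def systemDeriv (c : (j : Fin m) → EuclideanSpace ℝ (MultiIndex n (deg j)))
    (x y : EuclideanSpace ℝ (Fin n)) : EuclideanSpace ℝ (Fin m) :=
  WithLp.toLp 2 fun j => inner ℝ (c j) (derivVec (deg j) x y)

theorem systemDeriv_apply (c : (j : Fin m) → EuclideanSpace ℝ (MultiIndex n (deg j)))
    (x y : EuclideanSpace ℝ (Fin n)) (j : Fin m) :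
    systemDeriv c x y j = inner ℝ (c j) (derivVec (deg j) x y) := rfl

theorem hasDerivAt_systemEval (c : (j : Fin m) → EuclideanSpace ℝ (MultiIndex n (deg j)))
    (x y : EuclideanSpace ℝ (Fin n)) (j : Fin m) :
    HasDerivAt (fun t : ℝ => systemEval c (Real.cos t • x + Real.sin t • y) j)
      (systemDeriv c x y j) 0 := by
  simp only [systemEval_apply, ← eval_formOfCoeff, systemDeriv_apply,
    ← sum_eval_pderiv_formOfCoeff]
  have h := MvPolynomial.hasDerivAt_eval_comp (formOfCoeff (c j))
    (γ := fun t : ℝ => (Real.cos t • x + Real.sin t • y).ofLp) (γ' := y.ofLp) (t := 0) (by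
      intro i
      have h1 := ((Real.hasDerivAt_cos 0).mul_const (x i)).fun_add
        ((Real.hasDerivAt_sin 0).mul_const (y i))
      simpa using h1)
  simpa using h

/-- The quantity whose minimum over unit vectors `y ⊥ x` is `condL`. -/
noncomputable def condPair (c : (j : Fin m) → EuclideanSpace ℝ (MultiIndex n (deg j)))
    (x y : EuclideanSpace ℝ (Fin n)) : ℝ :=
  √(∑ j, ((√(deg j : ℝ))⁻¹ * systemDeriv c x y j) ^ 2 + ‖systemEval c x‖ ^ 2)

theorem norm_tangentJacobian_sq (c : (j : Fin m) → EuclideanSpace ℝ (MultiIndex n (deg j)))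
    (x : EuclideanSpace ℝ (Fin n)) (y : (ℝ ∙ x)ᗮ) :
    ‖tangentJacobian deg (fun j => formOfCoeff (c j)) x y‖ ^ 2 =
      ∑ j, ((√(deg j : ℝ))⁻¹ * systemDeriv c x y j) ^ 2 := by
  rw [EuclideanSpace.norm_sq_eq]
  refine Finset.sum_congr rfl fun j _ => ?_
  rw [Real.norm_eq_abs, sq_abs, systemDeriv_apply, ← sum_eval_pderiv_formOfCoeff]
  congr 1
  rw [tangentJacobian, LinearMap.domRestrict_apply, Matrix.toLpLin_apply, ← Matrix.mulVec_mulVec]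
  change (Matrix.diagonal _).mulVec _ j = _
  rw [Matrix.mulVec_diagonal]
  rfl

theorem finrank_orthogonal_pos (hn : 2 ≤ n) {x : EuclideanSpace ℝ (Fin n)} (hx : ‖x‖ = 1) :
    0 < Module.finrank ℝ (ℝ ∙ x)ᗮ := by
  obtain ⟨k, rfl⟩ := Nat.exists_eq_add_of_le hn
  have : Fact (Module.finrank ℝ (EuclideanSpace ℝ (Fin (2 + k))) = (1 + k) + 1) :=
    ⟨by rw [finrank_euclideanSpace_fin]; omega⟩
  rw [Submodule.finrank_orthogonal_span_singleton (n := 1 + k) (by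
    rintro rfl; simp at hx)]
  omega

theorem condL_eq (c : (j : Fin m) → EuclideanSpace ℝ (MultiIndex n (deg j)))
    (x : EuclideanSpace ℝ (Fin n)) :
    condL deg (fun j => formOfCoeff (c j)) x =
      √(sigmaMin (tangentJacobian deg (fun j => formOfCoeff (c j)) x) ^ 2 +
        ‖systemEval c x‖ ^ 2) := by
  rw [condL, norm_systemEval_sq]
  simp only [eval_formOfCoeff]

theorem condL_le_condPair (hn : 2 ≤ n)
    (c : (j : Fin m) → EuclideanSpace ℝ (MultiIndex n (deg j)))
    {x y : EuclideanSpace ℝ (Fin n)} (hx : ‖x‖ = 1) (hy : ‖y‖ = 1) (hxy : inner ℝ x y = 0) :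
    condL deg (fun j => formOfCoeff (c j)) x ≤ condPair c x y := by
  have hy' : y ∈ (ℝ ∙ x)ᗮ := Submodule.mem_orthogonal_singleton_iff_inner_right.2 hxy
  have h1 := sigmaMin_mul_norm_le (finrank_orthogonal_pos hn hx)
    (tangentJacobian deg (fun j => formOfCoeff (c j)) x) ⟨y, hy'⟩
  rw [show ‖(⟨y, hy'⟩ : (ℝ ∙ x)ᗮ)‖ = 1 from hy, mul_one] at h1
  rw [condL_eq, condPair, ← norm_tangentJacobian_sq c x ⟨y, hy'⟩]
  have : 0 ≤ sigmaMin (tangentJacobian deg (fun j => formOfCoeff (c j)) x) :=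
    LinearMap.singularValues_nonneg _ _
  gcongr

theorem exists_condL_eq_condPair (hn : 2 ≤ n)
    (c : (j : Fin m) → EuclideanSpace ℝ (MultiIndex n (deg j)))
    {x : EuclideanSpace ℝ (Fin n)} (hx : ‖x‖ = 1) :
    ∃ y : EuclideanSpace ℝ (Fin n), ‖y‖ = 1 ∧ inner ℝ x y = 0 ∧
      condL deg (fun j => formOfCoeff (c j)) x = condPair c x y := by
  obtain ⟨y, hy, h⟩ := exists_norm_eq_sigmaMin (finrank_orthogonal_pos hn hx)
    (tangentJacobian deg (fun j => formOfCoeff (c j)) x)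
  refine ⟨y, hy, Submodule.mem_orthogonal_singleton_iff_inner_right.1 y.2, ?_⟩
  rw [condL_eq, condPair, ← norm_tangentJacobian_sq c x y, h]

/-- The condition number as a supremum over orthonormal pairs. -/
theorem kappa_eq_iSup (hn : 2 ≤ n) (c : (j : Fin m) → EuclideanSpace ℝ (MultiIndex n (deg j))) :
    kappa deg (fun j => formOfCoeff (c j)) =
      ⨆ (p : EuclideanSpace ℝ (Fin n) × EuclideanSpace ℝ (Fin n))
        (_ : ‖p.1‖ = 1 ∧ ‖p.2‖ = 1 ∧ inner ℝ p.1 p.2 = 0),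
        ENNReal.ofReal (√(∑ j, ‖c j‖ ^ 2)) / ENNReal.ofReal (condPair c p.1 p.2) := by
  refine le_antisymm (iSup₂_le fun x hx => ?_) (iSup₂_le fun p hp => ?_)
  · obtain ⟨y, hy, hxy, h⟩ := exists_condL_eq_condPair hn c (x := x) (by simpa using hx)
    rw [kappaLoc, h, weylNorm_formOfCoeff]
    exact le_iSup₂_of_le (x, y) ⟨by simpa using hx, hy, hxy⟩ le_rfl
  · refine le_iSup₂_of_le p.1 (by simpa using hp.1) ?_
    rw [kappaLoc, weylNorm_formOfCoeff]
    exact ENNReal.div_le_div_left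
      (ENNReal.ofReal_le_ofReal (condL_le_condPair hn c hp.1 hp.2.1 hp.2.2)) _

theorem continuous_condPair (x y : EuclideanSpace ℝ (Fin n)) :
    Continuous fun c : (j : Fin m) → EuclideanSpace ℝ (MultiIndex n (deg j)) =>
      condPair c x y := by
  simp only [condPair, norm_systemEval_sq, systemDeriv_apply]
  fun_prop

/-- The supremum is uncountable, so measurability is obtained from lower semicontinuity, which
arbitrary suprema preserve. -/
theorem measurable_kappa (hn : 2 ≤ n) :
    Measurable fun c : (j : Fin m) → EuclideanSpace ℝ (MultiIndex n (deg j)) =>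
      kappa deg (fun j => formOfCoeff (c j)) := by
  simp only [kappa_eq_iSup hn]
  refine LowerSemicontinuous.measurable ?_
  refine lowerSemicontinuous_biSup fun p _ => ?_
  intro c
  have hW : Continuous fun c : (j : Fin m) → EuclideanSpace ℝ (MultiIndex n (deg j)) =>
      ENNReal.ofReal (√(∑ j, ‖c j‖ ^ 2)) := ENNReal.continuous_ofReal.comp (by fun_prop)
  have hL : Continuous fun c : (j : Fin m) → EuclideanSpace ℝ (MultiIndex n (deg j)) =>
      ENNReal.ofReal (condPair c p.1 p.2) :=
    ENNReal.continuous_ofReal.comp (continuous_condPair _ _)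
  -- At the zero system the quotient is 0, even as 0/0, and lower semicontinuity is trivial.
  -- Elsewhere the quotient is continuous into [0, ∞], including where the denominator vanishes.
  rcases eq_or_ne (ENNReal.ofReal (√(∑ j, ‖c j‖ ^ 2))) 0 with h0 | h0
  · intro a ha
    simp only [h0, ENNReal.zero_div] at ha
    exact absurd ha not_lt_zero
  · refine ContinuousAt.lowerSemicontinuousAt ?_
    exact ENNReal.Tendsto.div hW.continuousAt (Or.inl h0) hL.continuousAt
      (Or.inl ENNReal.ofReal_ne_top)

theorem exists_condPair_mul_le (hn : 2 ≤ n)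
    (c : (j : Fin m) → EuclideanSpace ℝ (MultiIndex n (deg j))) {T : ℝ} (hT : 0 < T)
    (h : ENNReal.ofReal T ≤ kappa deg (fun j => formOfCoeff (c j))) :
    ∃ x y : EuclideanSpace ℝ (Fin n), ‖x‖ = 1 ∧ ‖y‖ = 1 ∧ inner ℝ x y = 0 ∧
      condPair c x y ≤ 2 * √(∑ j, ‖c j‖ ^ 2) / T := by
  -- Passing to T/2 makes the inequality strict, so a pair is found without showing that the
  -- supremum is attained; this is the factor 2 in the conclusion.
  have h1 : ENNReal.ofReal (T / 2) < kappa deg (fun j => formOfCoeff (c j)) :=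
    ((ENNReal.ofReal_lt_ofReal_iff hT).2 (by linarith)).trans_le h
  rw [kappa_eq_iSup hn] at h1
  simp only [lt_iSup_iff] at h1
  obtain ⟨p, hp, hlt⟩ := h1
  refine ⟨p.1, p.2, hp.1, hp.2.1, hp.2.2, ?_⟩
  have h2 := ENNReal.mul_le_of_le_div hlt.le
  rw [← ENNReal.ofReal_mul (by positivity),
    ENNReal.ofReal_le_ofReal_iff (Real.sqrt_nonneg _)] at h2
  rw [le_div_iff₀ hT]
  linarith

theorem norm_systemEval_le_condPair (c : (j : Fin m) → EuclideanSpace ℝ (MultiIndex n (deg j)))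
    (x y : EuclideanSpace ℝ (Fin n)) : ‖systemEval c x‖ ≤ condPair c x y := by
  refine Real.le_sqrt_of_sq_le ?_
  have : 0 ≤ ∑ j, ((√(deg j : ℝ))⁻¹ * systemDeriv c x y j) ^ 2 :=
    Finset.sum_nonneg fun j _ => sq_nonneg _
  linarith

theorem norm_systemDeriv_le_condPair (hdeg1 : ∀ j, 1 ≤ deg j) {d : ℕ} (hdeg : ∀ j, deg j ≤ d)
    (c : (j : Fin m) → EuclideanSpace ℝ (MultiIndex n (deg j)))
    (x y : EuclideanSpace ℝ (Fin n)) : ‖systemDeriv c x y‖ ≤ √d * condPair c x y := by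
  have hc0 : 0 ≤ condPair c x y := Real.sqrt_nonneg _
  refine (sq_le_sq₀ (norm_nonneg _) (mul_nonneg (Real.sqrt_nonneg _) hc0)).1 ?_
  have h0 : 0 ≤ ∑ j, ((√(deg j : ℝ))⁻¹ * systemDeriv c x y j) ^ 2 :=
    Finset.sum_nonneg fun j _ => sq_nonneg _
  have hcp : condPair c x y ^ 2 = ∑ j, ((√(deg j : ℝ))⁻¹ * systemDeriv c x y j) ^ 2 +
      ‖systemEval c x‖ ^ 2 := Real.sq_sqrt (add_nonneg h0 (sq_nonneg _))
  rw [mul_pow, Real.sq_sqrt (Nat.cast_nonneg _), hcp, EuclideanSpace.norm_sq_eq (systemDeriv c x y)]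
  have h1 : ∑ j, ‖systemDeriv c x y j‖ ^ 2 ≤
      d * ∑ j, ((√(deg j : ℝ))⁻¹ * systemDeriv c x y j) ^ 2 := by
    rw [Finset.mul_sum]
    refine Finset.sum_le_sum fun j _ => ?_
    have h2 : (0 : ℝ) < deg j := by exact_mod_cast hdeg1 j
    have h3 : (deg j : ℝ) ≤ d := by exact_mod_cast hdeg j
    rw [Real.norm_eq_abs, sq_abs, mul_pow, inv_pow, Real.sq_sqrt h2.le, ← mul_assoc]
    refine le_mul_of_one_le_left (sq_nonneg _) ?_
    rw [← div_eq_mul_inv, one_le_div h2]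
    exact h3
  have h4 : 0 ≤ (d : ℝ) * ‖systemEval c x‖ ^ 2 := by positivity
  linarith

/-- The condition number of a nonzero system is bounded below. -/
theorem exists_le_kappa (hn : 2 ≤ n) (deg : Fin m → ℕ) :
    ∃ δ : ℝ, 0 < δ ∧ ∀ c : (j : Fin m) → EuclideanSpace ℝ (MultiIndex n (deg j)),
      0 < ∑ j, ‖c j‖ ^ 2 → ENNReal.ofReal δ ≤ kappa deg (fun j => formOfCoeff (c j)) := by
  obtain ⟨k, rfl⟩ := Nat.exists_eq_add_of_le hn
  let x : EuclideanSpace ℝ (Fin (2 + k)) := EuclideanSpace.single ⟨0, by omega⟩ 1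
  let y : EuclideanSpace ℝ (Fin (2 + k)) := EuclideanSpace.single ⟨1, by omega⟩ 1
  have hx : ‖x‖ = 1 := by simp [x]
  have hy : ‖y‖ = 1 := by simp [y]
  have hxy : inner ℝ x y = 0 := by simp [x, y, EuclideanSpace.inner_single_left]
  -- One fixed orthonormal pair suffices: Cauchy–Schwarz bounds `condPair` by √A times the Weyl
  -- norm. The added 1 only keeps A positive.
  set A : ℝ := ∑ j, (((√(deg j : ℝ))⁻¹ * ‖derivVec (deg j) x y‖) ^ 2 +
    ‖veroneseVec (deg j) x‖ ^ 2) + 1 with hA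
  have hA1 : 1 ≤ A := by
    have : 0 ≤ ∑ j, (((√(deg j : ℝ))⁻¹ * ‖derivVec (deg j) x y‖) ^ 2 +
        ‖veroneseVec (deg j) x‖ ^ 2) := Finset.sum_nonneg fun j _ => by positivity
    linarith
  refine ⟨(√A)⁻¹, by positivity, fun c hc => ?_⟩
  rw [kappa_eq_iSup hn]
  refine le_iSup₂_of_le (x, y) ⟨hx, hy, hxy⟩ ?_
  set W := ∑ j, ‖c j‖ ^ 2 with hW
  have hle : condPair c x y ≤ √(A * W) := by
    refine Real.sqrt_le_sqrt ?_
    rw [norm_systemEval_sq, ← Finset.sum_add_distrib]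
    calc _ ≤ ∑ j, (((√(deg j : ℝ))⁻¹ * ‖derivVec (deg j) x y‖) ^ 2 +
          ‖veroneseVec (deg j) x‖ ^ 2) * W := by
          refine Finset.sum_le_sum fun j _ => ?_
          have hj : ‖c j‖ ^ 2 ≤ W :=
            Finset.single_le_sum (f := fun j => ‖c j‖ ^ 2) (fun _ _ => sq_nonneg _)
              (Finset.mem_univ j)
          have h1 : ∀ v, (inner ℝ (c j) v) ^ 2 ≤ ‖v‖ ^ 2 * W := by
            intro v
            calc (inner ℝ (c j) v) ^ 2 = |inner ℝ (c j) v| ^ 2 := (sq_abs _).symm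
              _ ≤ (‖c j‖ * ‖v‖) ^ 2 := by gcongr; exact abs_real_inner_le_norm _ _
              _ = ‖v‖ ^ 2 * ‖c j‖ ^ 2 := by ring
              _ ≤ _ := by gcongr
          rw [systemDeriv_apply, mul_pow, mul_pow, add_mul, mul_assoc]
          gcongr
          · exact h1 _
          · exact h1 _
      _ = (A - 1) * W := by rw [hA, add_sub_cancel_right, Finset.sum_mul]
      _ ≤ A * W := by nlinarith
  refine le_trans ?_ (ENNReal.div_le_div_left (ENNReal.ofReal_le_ofReal hle) _)
  rw [← ENNReal.ofReal_div_of_pos (by positivity)]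
  refine ENNReal.ofReal_le_ofReal (le_of_eq ?_)
  rw [Real.sqrt_mul (by linarith)]
  field_simp

end Kappa

/-! ### The tail bound with free thresholds. -/

section Tail

variable {n m : ℕ} {deg : Fin m → ℕ} {Ω : Type*} [MeasurableSpace Ω] {μ : Measure Ω}
  [IsProbabilityMeasure μ] {c : (j : Fin m) → Ω → EuclideanSpace ℝ (MultiIndex n (deg j))}
  {K c₀ : ℝ}

/-- A tail bound for the condition number in terms of thresholds `R` for the supremum norm and
`b` for the Weyl-Bombieri norm. -/
theorem measure_le_kappa_le (hn : 2 ≤ n) (hm : 0 < m) (hdeg1 : ∀ j, 1 ≤ deg j) {d : ℕ}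
    (hd : 0 < d) (hdeg : ∀ j, deg j ≤ d)
    (hc : ∀ j, Measurable (c j)) (hi : iIndepFun c μ)
    (hK : 0 < K) (hsg : ∀ j, IsSubGaussianVector μ (c j) K)
    (hc₀ : 0 < c₀) (hsb : ∀ j, HasSmallBall μ (c j) c₀)
    {R b T : ℝ} (hb : 0 < b) (hT : 0 < T) (hR : 2 * b / T ≤ R) :
    μ {ω | ENNReal.ofReal T ≤ kappa deg (fun j => formOfCoeff (c j ω))} ≤
      ENNReal.ofReal (3 ^ m * (28 * d) ^ n * Real.exp (-(R ^ 2 / (32 * K ^ 2)))) +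
      ENNReal.ofReal (12 ^ totalN n deg * Real.exp (-(b ^ 2 / (8 * K ^ 2)))) +
      ENNReal.ofReal ((√(2 * b / T / R) * (2 * b / T / R) ^ (n - 2) / (14 * d) ^ n)⁻¹ *
        (24 * c₀ * (4 * (2 * b / T) / √m)) ^ m) := by
  have hd0 : (0 : ℝ) < d := by exact_mod_cast hd
  set α := 2 * b / T with hα
  have hα0 : 0 < α := by positivity
  have hR0 : 0 < R := hα0.trans_le hR
  have hv : 0 < √(α / R) * (α / R) ^ (n - 2) / (14 * d) ^ n := by positivity
  refine le_trans (measure_mono (t := ({ω | ∃ x : EuclideanSpace ℝ (Fin n), ‖x‖ = 1 ∧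
      R < ‖systemEval (fun j => c j ω) x‖} ∪ {ω | b ≤ √(∑ j, ‖c j ω‖ ^ 2)}) ∪
      {ω | ENNReal.ofReal (√(α / R) * (α / R) ^ (n - 2) / (14 * d) ^ n) *
        volume (Metric.ball (0 : EuclideanSpace ℝ (Fin n)) 1) ≤
      volume {z : EuclideanSpace ℝ (Fin n) | 1 - 1 / (2 * d : ℝ) ≤ ‖z‖ ∧ ‖z‖ ≤ 1 ∧
        ‖systemEval (fun j => c j ω) z‖ ≤ 4 * α}}) ?_) ?_
  -- Outside the first two events the sup norm and the Weyl norm are under control, so a large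
  -- condition number forces the small set of `IsFormSystem.volume_small_ge`.
  · intro ω hω
    by_cases h1 : ω ∈ {ω | ∃ x : EuclideanSpace ℝ (Fin n), ‖x‖ = 1 ∧
      R < ‖systemEval (fun j => c j ω) x‖}
    · exact Or.inl (Or.inl h1)
    by_cases h2 : ω ∈ {ω | b ≤ √(∑ j, ‖c j ω‖ ^ 2)}
    · exact Or.inl (Or.inr h2)
    refine Or.inr ?_
    simp only [Set.mem_ofPred_eq, not_exists, not_and, not_lt, not_le] at h1 h2 hω ⊢
    obtain ⟨x, y, hx, hy, hxy, hL⟩ := exists_condPair_mul_le hn (fun j => c j ω) hT hω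
    have hLα : condPair (fun j => c j ω) x y ≤ α := by
      refine hL.trans ?_
      rw [hα]
      gcongr
    exact (isFormSystem_systemEval fun j => c j ω).volume_small_ge hn hd hdeg h1 hα0 hR hx hy hxy
      (hasDerivAt_systemEval _ x y) ((norm_systemEval_le_condPair _ x y).trans hLα)
      ((norm_systemDeriv_le_condPair hdeg1 hdeg _ x y).trans (by gcongr))
  · refine (measure_union_le _ _).trans (add_le_add ((measure_union_le _ _).trans
      (add_le_add ?_ ?_)) ?_)
    · exact measure_exists_lt_norm_systemEval_le hc hi hK hsg hd hdeg hR0.le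
    · exact measure_le_weylNorm_le (by omega) hc hi hK hsg hb.le
    · exact measure_volume_small_le hc hi hc₀ hsb hm hd hdeg (by positivity) hv

/-- The sub-Gaussian and small ball constants of a real random variable are linked. -/
theorem one_le_mul_of_subGaussian_of_smallBall {X : Ω → ℝ} (hK : 0 < K)
    (hsg : ∀ t, 0 < t → μ.real {ω | t ≤ |X ω|} ≤ 2 * Real.exp (-t ^ 2 / K ^ 2))
    (hsb : ∀ ε, 0 < ε → μ.real {ω | |X ω| ≤ ε} ≤ c₀ * ε) : 1 ≤ 4 * (K * c₀) := by
  -- At the common threshold 2K the two bounds cover the whole space: 1 ≤ 2e^(-4) + 2Kc₀.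
  have h1 := hsg (2 * K) (by positivity)
  have h2 := hsb (2 * K) (by positivity)
  have h3 : -(2 * K) ^ 2 / K ^ 2 = -4 := by field_simp; norm_num
  rw [h3] at h1
  have h4 : Real.exp (-4) ≤ 1 / 5 := by
    rw [Real.exp_neg, ← one_div]
    refine one_div_le_one_div_of_le (by norm_num) ?_
    linarith [Real.add_one_le_exp (4 : ℝ)]
  have h5 : (1 : ℝ) ≤ μ.real {ω | 2 * K ≤ |X ω|} + μ.real {ω | |X ω| ≤ 2 * K} := by
    refine le_trans (le_of_eq ?_) (measureReal_union_le _ _)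
    rw [← probReal_univ (μ := μ)]
    congr 1
    ext ω
    simp [le_total]
  linarith

theorem one_le_of_isSubGaussianVector_of_hasSmallBall {ι : Type*} [Fintype ι] [Nonempty ι]
    {X : Ω → EuclideanSpace ℝ ι} (hK : 0 < K)
    (hsg : IsSubGaussianVector μ X K) (hsb : HasSmallBall μ X c₀) : 1 ≤ 4 * (K * c₀) := by
  classical
  obtain ⟨i⟩ := ‹Nonempty ι›
  set θ : EuclideanSpace ℝ ι := EuclideanSpace.single i 1
  have hθ : ‖θ‖ = 1 := by simp [θ]
  refine one_le_mul_of_subGaussian_of_smallBall (X := fun ω => inner ℝ (X ω) θ) (μ := μ)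
    hK (hsg θ hθ) fun ε hε => ?_
  have h1 := hsb θ (by rintro h; simp [h] at hθ) ε hε
  rw [hθ, mul_one] at h1
  have hcomm : ∀ ω, inner ℝ (X ω) θ = inner ℝ θ (X ω) := fun ω => real_inner_comm _ _
  simpa only [hcomm] using h1

end Tail

/-! ### Choice of the thresholds and the scale M. -/

section Numerics

theorem logE_eq {d : ℕ} (hd : 0 < d) : logE d = 1 + Real.log d := by
  have : (d : ℝ) ≠ 0 := by positivity
  rw [logE, Real.log_mul (Real.exp_pos 1).ne' this, Real.log_exp]

theorem two_mul_sqrt_mul (y : ℝ) : 2 * √(128 * y) = √(512 * y) := by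
  rw [show 512 * y = 2 ^ 2 * (128 * y) by ring, Real.sqrt_mul (by positivity : (0 : ℝ) ≤ 2 ^ 2),
    Real.sqrt_sq zero_le_two]

theorem one_le_logE {d : ℕ} (hd : 0 < d) : 1 ≤ logE d := by
  rw [logE_eq hd]; linarith [Real.log_natCast_nonneg d]

theorem logE_le {d : ℕ} (hd : 0 < d) : logE d ≤ d := by
  rw [logE_eq hd]
  have := Real.log_le_sub_one_of_pos (x := (d : ℝ)) (by positivity)
  linarith

theorem half_le_gap {n m : ℕ} (hnm : n ≤ m + 1) : 1 / 2 ≤ gap n m := by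
  have : (n : ℝ) ≤ m + 1 := by exact_mod_cast hnm
  rw [gap]; linarith

theorem gap_le {n m : ℕ} (hn : 2 ≤ n) : gap n m ≤ m := by
  have : (2 : ℝ) ≤ n := by exact_mod_cast hn
  rw [gap]; linarith

variable {n m N d : ℕ} {C K c₀ w : ℝ}

theorem boundM_pos (hn : 2 ≤ n) (hm : 0 < m) (hmN : m ≤ N) (hd : 0 < d)
    (hK : 0 < K * c₀ * C) : 0 < boundM C K c₀ n m N d := by
  have h1 : 0 < logE d := by linarith [one_le_logE hd]
  have h2 : 0 < N := by omega
  have h3 : 0 < n := by omega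
  rw [boundM]
  positivity

/-- All that is needed about M, in logarithmic form so that products are compared by linear
arithmetic. The factor 3 in M, its power of n and the second entry of the maximum are not needed and
are dropped. -/
theorem gap_mul_log_boundM_ge (hn : 2 ≤ n) (hnm : n ≤ m + 1) (hm : 0 < m) (hmN : m ≤ N)
    (hd : 0 < d) (hK : 0 < K * c₀ * C) :
    gap n m / 2 * (Real.log N - Real.log m) + m * Real.log (K * c₀ * C) +
      (n - 3 / 2) * (2 * Real.log d + Real.log (logE d)) + 6 * gap n m * Real.log d ≤
      gap n m * Real.log (boundM C K c₀ n m N d) := by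
  have hs := half_le_gap hnm
  have hs0 : 0 < gap n m := by linarith
  have hl : 0 < logE d := by linarith [one_le_logE hd]
  have hN : (0 : ℝ) < N := by exact_mod_cast (by omega : 0 < N)
  have hm0 : (0 : ℝ) < m := by exact_mod_cast hm
  have hd0 : (0 : ℝ) < d := by exact_mod_cast hd
  have hn0 : (0 : ℝ) < n := by exact_mod_cast (by omega : 0 < n)
  have hn2 : (2 : ℝ) ≤ n := by exact_mod_cast hn
  have hmax : 0 < max ((d : ℝ) ^ 6) ((n : ℝ) / (d : ℝ) ^ 2) := by positivity
  have h1 : Real.log (boundM C K c₀ n m N d) = (Real.log N - Real.log m) / 2 +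
      m / gap n m * Real.log (K * c₀ * C) +
      (n - 3 / 2) / gap n m * (Real.log 3 + 2 * Real.log d + Real.log (logE d)) +
      1 / (2 * m - 2 * n + 3) * Real.log n +
      Real.log (max ((d : ℝ) ^ 6) ((n : ℝ) / (d : ℝ) ^ 2)) := by
    rw [boundM]
    generalize K * c₀ * C = Q at hK ⊢
    rw [Real.log_mul (by positivity) (by positivity),
      Real.log_mul (by positivity) (by positivity), Real.log_mul (by positivity) (by positivity),
      Real.log_mul (by positivity) (by positivity), Real.log_sqrt (by positivity),
      Real.log_div hN.ne' hm0.ne', Real.log_rpow hK, Real.log_rpow (by positivity),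
      Real.log_rpow hn0, Real.log_mul (by positivity) hl.ne',
      Real.log_mul (by positivity) (by positivity), Real.log_pow]
    norm_num
  have h2 : 6 * Real.log d ≤ Real.log (max ((d : ℝ) ^ 6) ((n : ℝ) / (d : ℝ) ^ 2)) := by
    have : Real.log ((d : ℝ) ^ 6) ≤ _ := Real.log_le_log (by positivity)
      (le_max_left ((d : ℝ) ^ 6) ((n : ℝ) / (d : ℝ) ^ 2))
    rw [Real.log_pow] at this
    exact_mod_cast this
  have h3 : 0 ≤ Real.log (3 : ℝ) := Real.log_nonneg (by norm_num)
  have h4 : 0 ≤ Real.log (n : ℝ) := Real.log_natCast_nonneg n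
  have h5 : 0 ≤ 1 / (2 * (m : ℝ) - 2 * n + 3) * Real.log n := by
    have : (0 : ℝ) < 2 * m - 2 * n + 3 := by
      rw [gap] at hs; linarith
    positivity
  have h6 : gap n m * (m / gap n m * Real.log (K * c₀ * C)) = m * Real.log (K * c₀ * C) := by
    field_simp
  have h7 : gap n m * ((n - 3 / 2) / gap n m *
      (Real.log 3 + 2 * Real.log d + Real.log (logE d))) =
      (n - 3 / 2) * (Real.log 3 + 2 * Real.log d + Real.log (logE d)) := by
    field_simp
  rw [h1]
  have h8 : 0 ≤ ((n : ℝ) - 3 / 2) * Real.log 3 := mul_nonneg (by linarith) h3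
  have h9 : 0 ≤ gap n m * (1 / (2 * (m : ℝ) - 2 * n + 3) * Real.log n) :=
    mul_nonneg hs0.le h5
  have h10 : gap n m * (6 * Real.log d) ≤
      gap n m * Real.log (max ((d : ℝ) ^ 6) ((n : ℝ) / (d : ℝ) ^ 2)) :=
    mul_le_mul_of_nonneg_left h2 hs0.le
  linear_combination h8 + h9 + h10 - h6 - h7

/-- The volume estimate needs α ≤ R. This follows from M ≥ √(N/m), where K c₀ C ≥ 1 enters, and from
1 + w/N ≤ e^(2w/s), since s ≤ m ≤ N. -/
theorem threshold_le (hn : 2 ≤ n) (hnm : n ≤ m + 1) (hm : 0 < m) (hmN : m ≤ N)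
    (hd : 0 < d) (hK : 0 < K) (hK1 : 1 ≤ K * c₀ * C) (hw : 0 ≤ w) :
    2 * (K * √(128 * (N + w))) / (boundM C K c₀ n m N d * Real.exp (w / gap n m)) ≤
      K * √(512 * (m * logE d + w)) := by
  have hs := half_le_gap hnm
  have hs0 : 0 < gap n m := by linarith
  have hsm := gap_le (m := m) hn
  have hl := one_le_logE hd
  have hN : (0 : ℝ) < N := by exact_mod_cast (by omega : 0 < N)
  have hm0 : (0 : ℝ) < m := by exact_mod_cast hm
  have hmN' : (m : ℝ) ≤ N := by exact_mod_cast hmN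
  have hn2 : (2 : ℝ) ≤ n := by exact_mod_cast hn
  have hld := Real.log_natCast_nonneg d
  have hM0 := boundM_pos (C := C) (K := K) (c₀ := c₀) hn hm hmN hd (by linarith)
  have hMlog := gap_mul_log_boundM_ge hn hnm hm hmN hd (by linarith : 0 < K * c₀ * C)
  set M := boundM C K c₀ n m N d
  have hM : √(N / m) ≤ M := by
    rw [← Real.log_le_log_iff (by positivity) hM0, Real.log_sqrt (by positivity),
      Real.log_div hN.ne' hm0.ne']
    have h1 : 0 ≤ (m : ℝ) * Real.log (K * c₀ * C) := mul_nonneg hm0.le (Real.log_nonneg hK1)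
    have h2 : 0 ≤ ((n : ℝ) - 3 / 2) * (2 * Real.log d + Real.log (logE d)) :=
      mul_nonneg (by linarith) (by have := Real.log_nonneg hl; positivity)
    have h3 : 0 ≤ 6 * gap n m * Real.log d := by positivity
    refine le_of_mul_le_mul_left ?_ hs0
    linear_combination hMlog + h1 + h2 + h3
  have h5 := two_mul_sqrt_mul (N + w)
  rw [div_le_iff₀ (by positivity)]
  calc 2 * (K * √(128 * (N + w))) = K * √(512 * (N + w)) := by rw [← h5]; ring
    _ ≤ K * (√(512 * (m * logE d + w)) * (√(N / m) * Real.exp (w / gap n m))) := by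
        gcongr
        refine Real.sqrt_le_iff.2 ⟨by positivity, ?_⟩
        rw [mul_pow, mul_pow, Real.sq_sqrt (by positivity), Real.sq_sqrt (by positivity),
          ← Real.exp_nat_mul]
        have h6 : 1 + w / N ≤ Real.exp ((2 : ℕ) * (w / gap n m)) := by
          have h7 : w / N ≤ w / gap n m := by gcongr; linarith
          have h8 := Real.add_one_le_exp ((2 : ℕ) * (w / gap n m))
          have h9 : 0 ≤ w / gap n m := by positivity
          push_cast at h8 ⊢
          linarith
        have h10 : (m : ℝ) ≤ m * logE d + w := by nlinarith
        calc 512 * (N + w) = 512 * m * (N / m * (1 + w / N)) := by field_simp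
          _ ≤ 512 * (m * logE d + w) * (N / m * Real.exp ((2 : ℕ) * (w / gap n m))) := by gcongr
    _ ≤ K * (√(512 * (m * logE d + w)) * (M * Real.exp (w / gap n m))) := by gcongr
    _ = _ := by ring

/-- The exponent is 16(m log(ed) + w). As n ≤ 2m and 3·28² ≤ e^8, half of its first part already
absorbs the prefactor. -/
theorem supNorm_term_le (hnm : n ≤ m + 1) (hm : 0 < m) (hd : 0 < d) (hK : 0 < K) (hw : 0 ≤ w) :
    3 ^ m * (28 * d) ^ n *
      Real.exp (-((K * √(512 * (m * logE d + w))) ^ 2 / (32 * K ^ 2))) ≤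
      Real.exp (-(8 * m) - 2 * w) := by
  have hl := one_le_logE hd
  have hm0 : (0 : ℝ) < m := by exact_mod_cast hm
  have hd0 : (0 : ℝ) < d := by exact_mod_cast hd
  have hld := Real.log_natCast_nonneg d
  have hn2m : (n : ℝ) ≤ 2 * m := by exact_mod_cast (by omega : n ≤ 2 * m)
  have h1 : (K * √(512 * (m * logE d + w))) ^ 2 / (32 * K ^ 2) = 16 * (m * logE d + w) := by
    rw [mul_pow, Real.sq_sqrt (by positivity)]
    field_simp
    norm_num
  rw [h1, ← Real.log_le_log_iff (by positivity) (by positivity), Real.log_exp,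
    Real.log_mul (by positivity) (by positivity), Real.log_exp,
    Real.log_mul (by positivity) (by positivity), Real.log_pow, Real.log_pow,
    Real.log_mul (by norm_num) hd0.ne', logE_eq hd]
  have h2 : Real.log 3 + 2 * Real.log 28 ≤ 8 := by
    have h3 : Real.log 3 + 2 * Real.log 28 = Real.log (3 * 28 ^ 2) := by
      rw [Real.log_mul (by norm_num) (by norm_num), Real.log_pow]; norm_num
    rw [h3, Real.log_le_iff_le_exp (by norm_num)]
    have h4 : Real.exp 8 = Real.exp 1 ^ 8 := by rw [← Real.exp_nat_mul]; norm_num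
    rw [h4]
    calc (3 : ℝ) * 28 ^ 2 ≤ 2.7 ^ 8 := by norm_num
      _ ≤ Real.exp 1 ^ 8 := by gcongr; linarith [Real.exp_one_gt_d9]
  have h28 : 0 ≤ Real.log (28 : ℝ) := Real.log_nonneg (by norm_num)
  have h5 : (n : ℝ) * (Real.log 28 + Real.log d) ≤ 2 * m * (Real.log 28 + Real.log d) := by gcongr
  have h6 : (m : ℝ) * (Real.log 3 + 2 * Real.log 28) ≤ m * 8 := by gcongr
  have h7 : 0 ≤ (m : ℝ) * Real.log d := by positivity
  linarith

theorem weylNorm_term_le (hmN : m ≤ N) (hK : 0 < K) (hw : 0 ≤ w) :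
    12 ^ N * Real.exp (-((K * √(128 * (N + w))) ^ 2 / (8 * K ^ 2))) ≤
      Real.exp (-(8 * m) - 2 * w) := by
  have hmN' : (m : ℝ) ≤ N := by exact_mod_cast hmN
  have h1 : (K * √(128 * (N + w))) ^ 2 / (8 * K ^ 2) = 16 * (N + w) := by
    rw [mul_pow, Real.sq_sqrt (by positivity)]
    field_simp
    ring
  rw [h1, ← Real.log_le_log_iff (by positivity) (by positivity), Real.log_exp,
    Real.log_mul (by positivity) (by positivity), Real.log_exp, Real.log_pow]
  have h2 : Real.log 12 ≤ 8 := by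
    rw [Real.log_le_iff_le_exp (by norm_num)]
    have h4 : Real.exp 8 = Real.exp 1 ^ 8 := by rw [← Real.exp_nat_mul]; norm_num
    rw [h4]
    calc (12 : ℝ) ≤ 2.7 ^ 8 := by norm_num
      _ ≤ Real.exp 1 ^ 8 := by gcongr; linarith [Real.exp_one_gt_d9]
  have h3 : (N : ℝ) * Real.log 12 ≤ N * 8 := by gcongr
  linarith

/-- The main term in the tail bound for the condition number. -/
noncomputable def mainTail (n m N d : ℕ) (w : ℝ) : ℝ :=
  (1 / 10 ^ 4) ^ m * (d : ℝ) ^ (3 - n - 6 * gap n m) * logE d ^ (-(((n : ℝ) - 3 / 2) / 2)) *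
    (Real.exp (-w) * ((1 + w / N) ^ (gap n m / 2) *
      (1 + w / (m * logE d)) ^ (((n : ℝ) - 3 / 2) / 2)))

/-- α occurs with exponent m - (n - 3/2) = s, so M e^(w/s) in its denominator contributes M^(-s)
e^(-w). The power of d is n from the volume, minus 2n - 3 and 6s from M. -/
theorem volume_term_le (hn : 2 ≤ n) (hnm : n ≤ m + 1) (hm : 0 < m) (hmN : m ≤ N)
    (hd : 0 < d) (hK : 0 < K) (hc₀ : 0 < c₀) (hw : 0 ≤ w) {α R : ℝ}
    (hα : α = 2 * (K * √(128 * (N + w))) /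
      (boundM (10 ^ 10) K c₀ n m N d * Real.exp (w / gap n m)))
    (hR : R = K * √(512 * (m * logE d + w))) :
    (√(α / R) * (α / R) ^ (n - 2) / (14 * d) ^ n)⁻¹ * (24 * c₀ * (4 * α / √m)) ^ m ≤
      mainTail n m N d w := by
  have hs := half_le_gap hnm
  have hs0 : 0 < gap n m := by linarith
  have hl := one_le_logE hd
  have hl0 : 0 < logE d := by linarith
  have hN : (0 : ℝ) < N := by exact_mod_cast (by omega : 0 < N)
  have hm0 : (0 : ℝ) < m := by exact_mod_cast hm
  have hd0 : (0 : ℝ) < d := by exact_mod_cast hd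
  have hn2m : (n : ℝ) ≤ 2 * m := by exact_mod_cast (by omega : n ≤ 2 * m)
  have hKc : 0 < K * c₀ * 10 ^ 10 := by positivity
  have hM0 := boundM_pos (n := n) hn hm hmN hd hKc
  have hMlog := gap_mul_log_boundM_ge hn hnm hm hmN hd hKc
  set M := boundM (10 ^ 10) K c₀ n m N d
  have hα0 : 0 < α := by rw [hα]; positivity
  have hR0 : 0 < R := by rw [hR]; positivity
  have hlα : Real.log α = Real.log K + Real.log 512 / 2 + Real.log (N + w) / 2 - Real.log M -
      w / gap n m := by
    have h5 := two_mul_sqrt_mul (N + w)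
    rw [hα, show 2 * (K * √(128 * (N + w))) = K * √(512 * (N + w)) by rw [← h5]; ring,
      Real.log_div (by positivity) (by positivity), Real.log_mul (by positivity) (by positivity),
      Real.log_mul (by positivity) (by positivity), Real.log_sqrt (by positivity),
      Real.log_mul (by positivity) (by positivity), Real.log_exp]
    ring
  have hlR : Real.log R = Real.log K + Real.log 512 / 2 + Real.log (m * logE d + w) / 2 := by
    rw [hR, Real.log_mul (by positivity) (by positivity), Real.log_sqrt (by positivity),
      Real.log_mul (by positivity) (by positivity)]
    ring
  have hn2 : ((n - 2 : ℕ) : ℝ) = n - 2 := by push_cast [Nat.cast_sub hn]; ring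
  have hmt : 0 < mainTail n m N d w := by
    rw [mainTail]
    positivity
  rw [← Real.log_le_log_iff (by positivity) hmt]
  have hL : Real.log ((√(α / R) * (α / R) ^ (n - 2) / (14 * d) ^ n)⁻¹ *
      (24 * c₀ * (4 * α / √m)) ^ m) =
      n * (Real.log 14 + Real.log d) - (n - 3 / 2) * (Real.log α - Real.log R) +
        m * (Real.log 96 + Real.log c₀ + Real.log α - Real.log m / 2) := by
    have h96 : 24 * c₀ * (4 * α / √m) = 96 * c₀ * α / √m := by ring
    rw [h96, Real.log_mul (by positivity) (by positivity), Real.log_inv,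
      Real.log_div (by positivity) (by positivity), Real.log_mul (by positivity) (by positivity),
      Real.log_sqrt (by positivity), Real.log_pow, Real.log_pow, Real.log_pow,
      Real.log_div hα0.ne' hR0.ne', Real.log_mul (by norm_num) hd0.ne',
      Real.log_div (by positivity) (by positivity), Real.log_mul (by positivity) hα0.ne',
      Real.log_mul (by norm_num) hc₀.ne', Real.log_sqrt hm0.le, hn2]
    ring
  have hRt : Real.log (mainTail n m N d w) = -(4 * m * Real.log 10) +
      (3 - n - 6 * gap n m) * Real.log d - (n - 3 / 2) / 2 * Real.log (logE d) - w +
      gap n m / 2 * (Real.log (N + w) - Real.log N) +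
      (n - 3 / 2) / 2 * (Real.log (m * logE d + w) - (Real.log m + Real.log (logE d))) := by
    have e1 : 1 + w / N = (N + w) / N := by field_simp
    have e2 : 1 + w / (m * logE d) = (m * logE d + w) / (m * logE d) := by field_simp
    rw [mainTail, e1, e2, Real.log_mul (by positivity) (by positivity),
      Real.log_mul (by positivity) (by positivity), Real.log_mul (by positivity) (by positivity),
      Real.log_mul (by positivity) (by positivity), Real.log_mul (by positivity) (by positivity),
      Real.log_exp, Real.log_pow, Real.log_rpow hd0, Real.log_rpow hl0,
      Real.log_rpow (by positivity), Real.log_rpow (by positivity),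
      Real.log_div (by positivity) hN.ne',
      Real.log_div (y := (m : ℝ) * logE d) (by positivity) (by positivity),
      Real.log_mul hm0.ne' hl0.ne', one_div, Real.log_inv, Real.log_pow]
    push_cast
    ring
  rw [hL, hRt, hlR]
  have hsα : gap n m * Real.log α = gap n m * (Real.log K + Real.log 512 / 2 +
      Real.log (N + w) / 2 - Real.log M) - w := by
    rw [hlα, mul_sub, mul_div_cancel₀ _ hs0.ne']
  have hlKc : Real.log (K * c₀ * 10 ^ 10) = Real.log K + Real.log c₀ + 10 * Real.log 10 := by
    rw [Real.log_mul (by positivity) (by positivity), Real.log_mul hK.ne' hc₀.ne', Real.log_pow]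
    norm_num
  rw [hlKc] at hMlog
  -- Of the 10^10 per equation, 10^6 pays for the geometric constants 14²·√512·96; the other 10^4
  -- survives as the factor 10^(-4m) in `mainTail`.
  have hconst : 2 * Real.log 14 + Real.log 512 / 2 + Real.log 96 ≤ 6 * Real.log 10 := by
    have h1 : 2 * (2 * Real.log 14 + Real.log 512 / 2 + Real.log 96) =
        Real.log (14 ^ 4 * 512 * 96 ^ 2) := by
      rw [Real.log_mul (by norm_num) (by norm_num), Real.log_mul (by norm_num) (by norm_num),
        Real.log_pow, Real.log_pow]
      push_cast
      ring
    have h2 : 2 * (6 * Real.log 10) = Real.log (10 ^ 12) := by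
      rw [Real.log_pow]; push_cast; ring
    have h3 : Real.log (14 ^ 4 * 512 * 96 ^ 2) ≤ Real.log (10 ^ 12) :=
      Real.log_le_log (by norm_num) (by norm_num)
    rw [← h1, ← h2] at h3
    linarith only [h3]
  have h14 : 0 ≤ Real.log (14 : ℝ) := Real.log_nonneg (by norm_num)
  have hc1 : (n : ℝ) * Real.log 14 ≤ 2 * m * Real.log 14 := by gcongr
  have hc2 : (m : ℝ) * (2 * Real.log 14 + Real.log 512 / 2 + Real.log 96) ≤
      m * (6 * Real.log 10) := by gcongr
  rw [gap] at hMlog hsα ⊢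
  linear_combination hMlog + hsα + hc1 + hc2

end Numerics

/-! ### The tail of the condition number, and moments from tails. -/

section TailMoment

variable {n m : ℕ} {deg : Fin m → ℕ} {Ω : Type*} [MeasurableSpace Ω] {μ : Measure Ω}

theorem le_totalN (hn : 0 < n) : m ≤ totalN n deg := by
  have h : ∑ _j : Fin m, 1 ≤ totalN n deg :=
    Finset.sum_le_sum fun j _ => Nat.choose_pos (by omega)
  simpa using h

/-- A crude count, each exponent being below 2d. It serves only to absorb the factor N^(1/4) of the
middle range. -/
theorem totalN_le {d : ℕ} (hd : 0 < d) (hdeg : ∀ j, deg j ≤ d) :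
    totalN n deg ≤ m * (2 * d) ^ n := by
  have h : ∀ j, (n + deg j - 1).choose (deg j) ≤ (2 * d) ^ n := by
    intro j
    rw [← card_multiIndex]
    have hlt : ∀ (α : MultiIndex n (deg j)) (i : Fin n), α.1 i < 2 * d := by
      intro α i
      have h1 := α.2
      have h2 : α.1 i ≤ deg j := by
        rw [Finset.mem_piAntidiag] at h1
        refine le_trans ?_ h1.1.le
        exact Finset.single_le_sum (f := fun i => α.1 i) (fun _ _ => Nat.zero_le _)
          (Finset.mem_univ i)
      have := hdeg j
      omega
    calc Fintype.card (MultiIndex n (deg j)) ≤ Fintype.card (Fin n → Fin (2 * d)) :=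
          Fintype.card_le_of_injective (fun α i => ⟨α.1 i, hlt α i⟩) fun α β hαβ => by
            apply Subtype.ext
            ext i
            simpa using congrFun hαβ i
      _ = (2 * d) ^ n := by simp
  calc totalN n deg ≤ ∑ _j : Fin m, (2 * d) ^ n := Finset.sum_le_sum fun j _ => h j
    _ = m * (2 * d) ^ n := by simp

/-- The tail of the condition number beyond the scale `boundM`. -/
theorem measure_boundM_mul_exp_le_kappa_le [IsProbabilityMeasure μ]
    {c : (j : Fin m) → Ω → EuclideanSpace ℝ (MultiIndex n (deg j))} {K c₀ : ℝ}
    (hn : 2 ≤ n) (hnm : n ≤ m + 1) (hdeg1 : ∀ j, 1 ≤ deg j) {d : ℕ}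
    (hd : 0 < d) (hdeg : ∀ j, deg j ≤ d) (hc : ∀ j, Measurable (c j)) (hi : iIndepFun c μ)
    (hK : 0 < K) (hsg : ∀ j, IsSubGaussianVector μ (c j) K)
    (hc₀ : 0 < c₀) (hsb : ∀ j, HasSmallBall μ (c j) c₀) {w : ℝ} (hw : 0 ≤ w) :
    μ {ω | ENNReal.ofReal (boundM (10 ^ 10) K c₀ n m (totalN n deg) d * Real.exp (w / gap n m)) ≤
        kappa deg (fun j => formOfCoeff (c j ω))} ≤
      ENNReal.ofReal (2 * Real.exp (-(8 * m) - 2 * w) + mainTail n m (totalN n deg) d w) := by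
  have hm : 0 < m := by omega
  have hmN : m ≤ totalN n deg := le_totalN (by omega)
  have hN : (0 : ℝ) < totalN n deg := by exact_mod_cast (by omega : 0 < totalN n deg)
  have hl := one_le_logE hd
  have hm0 : (0 : ℝ) < m := by exact_mod_cast hm
  have hM0 := boundM_pos (C := 10 ^ 10) (K := K) (c₀ := c₀) (n := n) hn hm hmN hd (by positivity)
  have hne : Nonempty (MultiIndex n (deg ⟨0, hm⟩)) := by
    rw [← Fintype.card_pos_iff, card_multiIndex]
    exact Nat.choose_pos (by omega)
  have hKc := one_le_of_isSubGaussianVector_of_hasSmallBall hK (hsg ⟨0, hm⟩) (hsb ⟨0, hm⟩)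
  have hK1 : 1 ≤ K * c₀ * 10 ^ 10 := by linarith
  refine (measure_le_kappa_le hn hm hdeg1 hd hdeg hc hi hK hsg hc₀ hsb
    (b := K * √(128 * (totalN n deg + w))) (R := K * √(512 * (m * logE d + w)))
    (by positivity) (by positivity) (threshold_le hn hnm hm hmN hd hK hK1 hw)).trans ?_
  rw [← ENNReal.ofReal_add (by positivity) (by positivity),
    ← ENNReal.ofReal_add (by positivity) (by positivity)]
  refine ENNReal.ofReal_le_ofReal ?_
  rw [two_mul (Real.exp _)]
  exact add_le_add (add_le_add (supNorm_term_le hnm hm hd hK hw) (weylNorm_term_le hmN hK hw))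
    (volume_term_le hn hnm hm hmN hd hK hc₀ hw rfl rfl)

/-- A random variable with a vanishing tail is almost surely finite. -/
theorem ae_lt_top_of_tail {X : Ω → ENNReal} {M s : ℝ} {t : ℝ → ℝ}
    (ht : ∀ w, 0 ≤ w → μ {ω | ENNReal.ofReal (M * Real.exp (w / s)) ≤ X ω} ≤ ENNReal.ofReal (t w))
    (ht0 : Filter.Tendsto t Filter.atTop (nhds 0)) : ∀ᵐ ω ∂μ, X ω < ⊤ := by
  rw [ae_iff]
  have h1 : Filter.Tendsto (fun w => ENNReal.ofReal (t w)) Filter.atTop (nhds 0) := by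
    simpa using ENNReal.tendsto_ofReal ht0
  refine le_antisymm (ge_of_tendsto h1 ?_) zero_le
  filter_upwards [Filter.eventually_ge_atTop 0] with w hw
  refine (measure_mono ?_).trans (ht w hw)
  intro ω hω
  simp only [Set.mem_ofPred_eq, not_lt, top_le_iff] at hω ⊢
  rw [hω]
  exact le_top

/-- Moments in terms of the tail, on an exponential scale. -/
theorem lintegral_rpow_le_of_tail [IsProbabilityMeasure μ] {X : Ω → ENNReal} (hX : Measurable X)
    {M s q : ℝ} (hM : 0 < M) (hs : 0 < s) (hq : 0 < q) {t : ℝ → ℝ}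
    (ht : ∀ w, 0 ≤ w → μ {ω | ENNReal.ofReal (M * Real.exp (w / s)) ≤ X ω} ≤ ENNReal.ofReal (t w))
    (hfin : ∀ᵐ ω ∂μ, X ω < ⊤) :
    ∫⁻ ω, X ω ^ q ∂μ ≤ ENNReal.ofReal (M ^ q) *
      (1 + ENNReal.ofReal (q / s) * ∫⁻ w in Set.Ioi 0,
        ENNReal.ofReal (t w) * ENNReal.ofReal (Real.exp (q / s * w))) := by
  -- Truncating below at the scale M gives a nonnegative Y = s log Z with X^q ≤ M^q e^((q/s)Y), and
  -- for w > 0 the event Y ≥ w is X ≥ M e^(w/s). Finiteness of X is needed because `toReal` sends ∞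
  -- to 0.
  set Z : Ω → ℝ := fun ω => max ((X ω).toReal / M) 1 with hZ
  have hZ1 : ∀ ω, 1 ≤ Z ω := fun ω => le_max_right _ _
  set Y : Ω → ℝ := fun ω => s * Real.log (Z ω) with hY
  have hYm : Measurable Y := by
    have : Measurable Z := (hX.ennreal_toReal.div_const M).max measurable_const
    exact (Real.measurable_log.comp this).const_mul s
  have hY0 : ∀ ω, 0 ≤ Y ω := fun ω => mul_nonneg hs.le (Real.log_nonneg (hZ1 ω))
  have hYq : ∀ ω, Real.exp (q / s * Y ω) = Z ω ^ q := by
    intro ω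
    rw [Real.rpow_def_of_pos (by linarith [hZ1 ω]), hY]
    congr 1
    field_simp
  calc ∫⁻ ω, X ω ^ q ∂μ
      ≤ ∫⁻ ω, ENNReal.ofReal (M ^ q) * ENNReal.ofReal (Real.exp (q / s * Y ω)) ∂μ := by
        refine lintegral_mono_ae ?_
        filter_upwards [hfin] with ω hω
        rw [hYq, ← ENNReal.ofReal_mul (by positivity), ← Real.mul_rpow hM.le
          (by linarith [hZ1 ω]), ← ENNReal.ofReal_rpow_of_nonneg
          (by have := hZ1 ω; positivity) hq.le]
        refine ENNReal.rpow_le_rpow ?_ hq.le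
        rw [← ENNReal.ofReal_toReal hω.ne]
        refine ENNReal.ofReal_le_ofReal ?_
        have : (X ω).toReal / M ≤ Z ω := le_max_left _ _
        rw [div_le_iff₀ hM] at this
        linarith
    _ = ENNReal.ofReal (M ^ q) * (1 + ∫⁻ w in Set.Ioi 0, μ {ω | w ≤ Y ω} *
          ENNReal.ofReal (q / s * Real.exp (q / s * w))) := by
        rw [lintegral_const_mul' _ _ ENNReal.ofReal_ne_top,
          lintegral_exp_eq hYm hY0 (by positivity)]
    _ ≤ _ := by
        gcongr
        rw [← lintegral_const_mul' _ _ ENNReal.ofReal_ne_top]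
        refine setLIntegral_mono' measurableSet_Ioi fun w hw => ?_
        rw [ENNReal.ofReal_mul (by positivity), mul_left_comm]
        gcongr
        refine (measure_mono ?_).trans (ht w (le_of_lt hw))
        intro ω hω
        simp only [Set.mem_ofPred_eq] at hω ⊢
        have h1 : Real.exp (w / s) ≤ Z ω := by
          rw [← Real.le_log_iff_exp_le (by linarith [hZ1 ω]), div_le_iff₀ hs]
          linarith
        have h2 : 1 < Real.exp (w / s) := Real.one_lt_exp_iff.2 (div_pos hw hs)
        have h3 : Real.exp (w / s) ≤ (X ω).toReal / M := by
          rcases le_max_iff.1 h1 with h | h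
          · exact h
          · linarith
        rw [le_div_iff₀ hM] at h3
        refine ENNReal.ofReal_le_of_le_toReal ?_
        linarith

end TailMoment

/-! ### Integrals of the tail against exponentials. -/

section TailIntegral

theorem rpow_le_mul_exp {p x w : ℝ} (hp : 0 ≤ p) (hx : 0 < x) (hw : 0 ≤ w) :
    w ^ p ≤ (2 * p / x) ^ p * Real.exp (x / 2 * w) := by
  rcases hp.eq_or_lt with rfl | hp
  · simp only [Real.rpow_zero, one_mul]
    exact Real.one_le_exp (by positivity)
  · have h1 : w = 2 * p / x * (x / 2 * w / p) := by field_simp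
    have h2 : x / 2 * w / p ≤ Real.exp (x / 2 * w / p) := by
      linarith [Real.add_one_le_exp (x / 2 * w / p)]
    calc w ^ p = (2 * p / x * (x / 2 * w / p)) ^ p := by rw [← h1]
      _ = (2 * p / x) ^ p * (x / 2 * w / p) ^ p := Real.mul_rpow (by positivity) (by positivity)
      _ ≤ (2 * p / x) ^ p * Real.exp (x / 2 * w / p) ^ p := by gcongr
      _ = (2 * p / x) ^ p * Real.exp (x / 2 * w) := by
        rw [← Real.exp_mul]
        congr 2
        field_simp

/-- An elementary substitute for the Gamma integral: half of the decay pays for the power. The loss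
is exponential in p, which the factor 10^(-4m) absorbs. -/
theorem lintegral_rpow_mul_exp_le {p x : ℝ} (hp : 0 ≤ p) (hx : 0 < x) :
    ∫⁻ w in Set.Ioi 0, ENNReal.ofReal (w ^ p * Real.exp (-x * w)) ≤
      ENNReal.ofReal ((2 * p / x) ^ p * (2 / x)) := by
  calc ∫⁻ w in Set.Ioi 0, ENNReal.ofReal (w ^ p * Real.exp (-x * w))
      ≤ ∫⁻ w in Set.Ioi 0, ENNReal.ofReal ((2 * p / x) ^ p) *
          ENNReal.ofReal (Real.exp (-(x / 2) * w)) := by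
        refine setLIntegral_mono' measurableSet_Ioi fun w hw => ?_
        rw [← ENNReal.ofReal_mul (by positivity)]
        refine ENNReal.ofReal_le_ofReal ?_
        calc w ^ p * Real.exp (-x * w)
            ≤ (2 * p / x) ^ p * Real.exp (x / 2 * w) * Real.exp (-x * w) := by
              gcongr
              exact rpow_le_mul_exp hp hx (le_of_lt hw)
          _ = (2 * p / x) ^ p * Real.exp (-(x / 2) * w) := by
              rw [mul_assoc, ← Real.exp_add]
              ring_nf
    _ = ENNReal.ofReal ((2 * p / x) ^ p * (2 / x)) := by
        rw [lintegral_const_mul' _ _ ENNReal.ofReal_ne_top, lintegral_exp_neg_mul_Ioi (by positivity),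
          ← ENNReal.ofReal_mul (by positivity)]
        congr 2
        field_simp

/-- The polynomial factor in the tail bound for the condition number. -/
noncomputable def tailGrowth (n m N d : ℕ) (w : ℝ) : ℝ :=
  (1 + w / N) ^ (gap n m / 2) * (1 + w / (m * logE d)) ^ (((n : ℝ) - 3 / 2) / 2)

/-- The constant factor in the tail bound for the condition number. -/
noncomputable def tailConst (n m d : ℕ) : ℝ :=
  (1 / 10 ^ 4) ^ m * (d : ℝ) ^ (3 - n - 6 * gap n m) * logE d ^ (-(((n : ℝ) - 3 / 2) / 2))

theorem mainTail_eq (n m N d : ℕ) (w : ℝ) :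
    mainTail n m N d w = tailConst n m d * (Real.exp (-w) * tailGrowth n m N d w) := rfl

variable {n m N d : ℕ} {x : ℝ}

theorem tailConst_pos (hd : 0 < d) : 0 < tailConst n m d := by
  have := one_le_logE hd
  rw [tailConst]
  positivity

theorem tailGrowth_nonneg (hd : 0 < d) {w : ℝ} (hw : 0 ≤ w) : 0 ≤ tailGrowth n m N d w := by
  have := one_le_logE hd
  rw [tailGrowth]
  positivity

/-- Both bases are at most 1 + w/m and the exponents add up to m/2. Then 1 + w/m ≤ x⁻¹ e^(xw/m),
because x ≤ 1. -/
theorem tailGrowth_le (hn : 2 ≤ n) (hnm : n ≤ m + 1) (hm : 0 < m) (hmN : m ≤ N) (hd : 0 < d)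
    (hx : 0 < x) (hx1 : x ≤ 1) {w : ℝ} (hw : 0 ≤ w) :
    tailGrowth n m N d w ≤ x⁻¹ ^ ((m : ℝ) / 2) * Real.exp (x / 2 * w) := by
  have hl := one_le_logE hd
  have hm0 : (0 : ℝ) < m := by exact_mod_cast hm
  have hN : (0 : ℝ) < N := by exact_mod_cast (by omega : 0 < N)
  have hmN' : (m : ℝ) ≤ N := by exact_mod_cast hmN
  have hs := half_le_gap hnm
  have hn2 : (2 : ℝ) ≤ n := by exact_mod_cast hn
  have h1 : 1 + w / m ≤ x⁻¹ * Real.exp (x * (w / m)) := by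
    rw [← div_eq_inv_mul, le_div_iff₀ hx]
    linarith [Real.add_one_le_exp (x * (w / m))]
  calc tailGrowth n m N d w
      ≤ (1 + w / m) ^ (gap n m / 2) * (1 + w / m) ^ (((n : ℝ) - 3 / 2) / 2) := by
        rw [tailGrowth]
        gcongr
        · linarith
        · exact le_mul_of_one_le_right hm0.le hl
    _ = (1 + w / m) ^ ((m : ℝ) / 2) := by
        rw [← Real.rpow_add (by positivity), gap]
        congr 1
        ring
    _ ≤ (x⁻¹ * Real.exp (x * (w / m))) ^ ((m : ℝ) / 2) := by gcongr
    _ = x⁻¹ ^ ((m : ℝ) / 2) * Real.exp (x / 2 * w) := by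
        rw [Real.mul_rpow (by positivity) (by positivity), ← Real.exp_mul]
        congr 2
        field_simp

theorem tendsto_tail (hn : 2 ≤ n) (hnm : n ≤ m + 1) (hm : 0 < m) (hmN : m ≤ N) (hd : 0 < d) :
    Filter.Tendsto (fun w : ℝ => 2 * Real.exp (-(8 * m) - 2 * w) + mainTail n m N d w)
      Filter.atTop (nhds 0) := by
  have hE : Filter.Tendsto (fun w : ℝ => Real.exp (-(w / 2))) Filter.atTop (nhds 0) :=
    Real.tendsto_exp_neg_atTop_nhds_zero.comp (Filter.tendsto_id.atTop_div_const two_pos)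
  have hE2 := hE.const_mul (2 + tailConst n m d)
  rw [mul_zero] at hE2
  have hc := tailConst_pos (n := n) (m := m) hd
  refine squeeze_zero' ?_ ?_ hE2
  · filter_upwards [Filter.eventually_ge_atTop 0] with w hw
    have := tailGrowth_nonneg (n := n) (m := m) (N := N) hd hw
    rw [mainTail_eq]
    positivity
  · filter_upwards [Filter.eventually_ge_atTop 0] with w hw
    have h1 := tailGrowth_le hn hnm hm hmN hd one_pos le_rfl hw
    rw [inv_one, Real.one_rpow, one_mul] at h1
    have h2 : Real.exp (-(8 * m) - 2 * w) ≤ Real.exp (-(w / 2)) := by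
      refine Real.exp_le_exp.2 ?_
      have : (0 : ℝ) ≤ m := Nat.cast_nonneg m
      linarith
    have h3 : Real.exp (-w) * tailGrowth n m N d w ≤ Real.exp (-(w / 2)) := by
      calc _ ≤ Real.exp (-w) * Real.exp (1 / 2 * w) := by gcongr
        _ = _ := by rw [← Real.exp_add]; ring_nf
    rw [mainTail_eq, add_mul]
    gcongr

theorem lintegral_tail_le (hd : 0 < d) (hx : 0 < x) {J : ℝ} (hJ0 : 0 ≤ J)
    (hJ : ∫⁻ w in Set.Ioi 0, ENNReal.ofReal (Real.exp (-x * w) * tailGrowth n m N d w) ≤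
      ENNReal.ofReal J) :
    ∫⁻ w in Set.Ioi 0, ENNReal.ofReal (2 * Real.exp (-(8 * m) - 2 * w) + mainTail n m N d w) *
      ENNReal.ofReal (Real.exp ((1 - x) * w)) ≤
    ENNReal.ofReal (2 * Real.exp (-(8 * m)) + tailConst n m d * J) := by
  have hc := tailConst_pos (n := n) (m := m) hd
  calc _ = ∫⁻ w in Set.Ioi 0, (ENNReal.ofReal (2 * Real.exp (-(8 * m))) *
          ENNReal.ofReal (Real.exp (-(1 + x) * w)) + ENNReal.ofReal (tailConst n m d) *
          ENNReal.ofReal (Real.exp (-x * w) * tailGrowth n m N d w)) := by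
        refine setLIntegral_congr_fun measurableSet_Ioi fun w hw => ?_
        have hw0 : (0 : ℝ) ≤ w := le_of_lt hw
        have hg := tailGrowth_nonneg (n := n) (m := m) (N := N) hd hw0
        rw [← ENNReal.ofReal_mul (by rw [mainTail_eq]; positivity),
          ← ENNReal.ofReal_mul (by positivity),
          ← ENNReal.ofReal_mul (by positivity), ← ENNReal.ofReal_add (by positivity)
          (by positivity), mainTail_eq]
        congr 1
        have e1 : Real.exp (-(8 * m) - 2 * w) * Real.exp ((1 - x) * w) =
            Real.exp (-(8 * m)) * Real.exp (-(1 + x) * w) := by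
          rw [← Real.exp_add, ← Real.exp_add]; ring_nf
        have e2 : Real.exp (-w) * Real.exp ((1 - x) * w) = Real.exp (-x * w) := by
          rw [← Real.exp_add]; ring_nf
        linear_combination 2 * e1 + tailConst n m d * tailGrowth n m N d w * e2
    _ = ENNReal.ofReal (2 * Real.exp (-(8 * m))) * ENNReal.ofReal (1 / (1 + x)) +
          ENNReal.ofReal (tailConst n m d) * ∫⁻ w in Set.Ioi 0,
            ENNReal.ofReal (Real.exp (-x * w) * tailGrowth n m N d w) := by
        rw [lintegral_add_left (by fun_prop), lintegral_const_mul' _ _ ENNReal.ofReal_ne_top,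
          lintegral_const_mul' _ _ ENNReal.ofReal_ne_top,
          lintegral_exp_neg_mul_Ioi (by positivity)]
    _ ≤ ENNReal.ofReal (2 * Real.exp (-(8 * m))) * ENNReal.ofReal 1 +
          ENNReal.ofReal (tailConst n m d) * ENNReal.ofReal J := by
        gcongr
        rw [div_le_one (by positivity)]
        linarith
    _ = _ := by
        rw [ENNReal.ofReal_one, mul_one, ← ENNReal.ofReal_mul hc.le,
          ← ENNReal.ofReal_add (by positivity) (by positivity)]

theorem lintegral_tailGrowth_le (hn : 2 ≤ n) (hnm : n ≤ m + 1) (hm : 0 < m) (hmN : m ≤ N)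
    (hd : 0 < d) (hx : 0 < x) (hx1 : x ≤ 1) :
    ∫⁻ w in Set.Ioi 0, ENNReal.ofReal (Real.exp (-x * w) * tailGrowth n m N d w) ≤
      ENNReal.ofReal (2 * x⁻¹ ^ ((m : ℝ) / 2 + 1)) := by
  calc _ ≤ ∫⁻ w in Set.Ioi 0, ENNReal.ofReal (x⁻¹ ^ ((m : ℝ) / 2)) *
          ENNReal.ofReal (Real.exp (-(x / 2) * w)) := by
        refine setLIntegral_mono' measurableSet_Ioi fun w hw => ?_
        rw [← ENNReal.ofReal_mul (by positivity)]
        refine ENNReal.ofReal_le_ofReal ?_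
        calc Real.exp (-x * w) * tailGrowth n m N d w
            ≤ Real.exp (-x * w) * (x⁻¹ ^ ((m : ℝ) / 2) * Real.exp (x / 2 * w)) := by
              gcongr
              exact tailGrowth_le hn hnm hm hmN hd hx hx1 (le_of_lt hw)
          _ = x⁻¹ ^ ((m : ℝ) / 2) * Real.exp (-(x / 2) * w) := by
              rw [mul_left_comm, ← Real.exp_add]
              ring_nf
    _ = _ := by
        rw [lintegral_const_mul' _ _ ENNReal.ofReal_ne_top, lintegral_exp_neg_mul_Ioi (by positivity),
          ← ENNReal.ofReal_mul (by positivity), Real.rpow_add (by positivity), Real.rpow_one]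
        congr 1
        field_simp

theorem one_add_rpow_le {u p : ℝ} (hu : 1 ≤ u) (hp : 0 ≤ p) : (1 + u) ^ p ≤ 2 ^ p * u ^ p := by
  rw [← Real.mul_rpow (by norm_num) (by linarith)]
  exact Real.rpow_le_rpow (by linarith) (by linarith) hp

theorem two_rpow_gap_mul (n m : ℕ) : (2 : ℝ) ^ (gap n m / 2) * 2 ^ (((n : ℝ) - 3 / 2) / 2) =
    2 ^ ((m : ℝ) / 2) := by
  rw [← Real.rpow_add two_pos, gap]
  congr 1
  ring

theorem div_rpow_mul_div_rpow (hd : 0 < d) {w : ℝ} (hw : 0 ≤ w)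
    (hw0 : 0 < w) :
    (w / N) ^ (gap n m / 2) * (w / (m * logE d)) ^ (((n : ℝ) - 3 / 2) / 2) =
      (N : ℝ)⁻¹ ^ (gap n m / 2) * ((m * logE d)⁻¹) ^ (((n : ℝ) - 3 / 2) / 2) *
        w ^ ((m : ℝ) / 2) := by
  have hl := one_le_logE hd
  have h : w ^ ((m : ℝ) / 2) = w ^ (gap n m / 2) * w ^ (((n : ℝ) - 3 / 2) / 2) := by
    rw [← Real.rpow_add hw0, gap]
    congr 1
    ring
  rw [h, div_eq_mul_inv w (N : ℝ), div_eq_mul_inv w (m * logE d), Real.mul_rpow hw (by positivity),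
    Real.mul_rpow hw (by positivity)]
  ring

/-- Split at w = m log(ed). Below, w/N ≤ log(ed) because N ≥ m. Above, both ratios are at least 1,
so 1 + u ≤ 2u in each factor. -/
theorem tailGrowth_le_of_le (hn : 2 ≤ n) (hnm : n ≤ m + 1) (hm : 0 < m) (hmN : m ≤ N)
    (hd : 0 < d) (hN : (N : ℝ) ≤ m * logE d) {w : ℝ} (hw : 0 < w) :
    tailGrowth n m N d w ≤ 2 ^ ((m : ℝ) / 2) * (logE d ^ (gap n m / 2) +
      (N : ℝ)⁻¹ ^ (gap n m / 2) * ((m * logE d)⁻¹) ^ (((n : ℝ) - 3 / 2) / 2) *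
        w ^ ((m : ℝ) / 2)) := by
  have hl := one_le_logE hd
  have hl0 : 0 < logE d := by linarith
  have hm0 : (0 : ℝ) < m := by exact_mod_cast hm
  have hN0 : (0 : ℝ) < N := by exact_mod_cast (by omega : 0 < N)
  have hmN' : (m : ℝ) ≤ N := by exact_mod_cast hmN
  have hs := half_le_gap hnm
  have hn2 : (2 : ℝ) ≤ n := by exact_mod_cast hn
  have hp : 0 ≤ ((n : ℝ) - 3 / 2) / 2 := by linarith
  rw [← two_rpow_gap_mul n m, tailGrowth]
  rcases le_total w (m * logE d) with h | h
  · have h1 : 1 + w / (m * logE d) ≤ 2 := by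
      have : w / (m * logE d) ≤ 1 := by rwa [div_le_one (by positivity)]
      linarith
    have h2 : 1 + w / N ≤ 2 * logE d := by
      have : w / N ≤ logE d := by
        rw [div_le_iff₀ hN0]
        nlinarith
      linarith
    calc _ ≤ (2 * logE d) ^ (gap n m / 2) * 2 ^ (((n : ℝ) - 3 / 2) / 2) := by gcongr
      _ = 2 ^ (gap n m / 2) * 2 ^ (((n : ℝ) - 3 / 2) / 2) * logE d ^ (gap n m / 2) := by
          rw [Real.mul_rpow two_pos.le hl0.le]; ring
      _ ≤ _ := by
          gcongr
          exact le_add_of_nonneg_right (by positivity)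
  · have h1 : 1 ≤ w / (m * logE d) := by rwa [one_le_div (by positivity)]
    have h2 : 1 ≤ w / N := by
      rw [one_le_div (by positivity)]
      linarith
    calc _ ≤ (2 ^ (gap n m / 2) * (w / N) ^ (gap n m / 2)) *
          (2 ^ (((n : ℝ) - 3 / 2) / 2) * (w / (m * logE d)) ^ (((n : ℝ) - 3 / 2) / 2)) := by
          gcongr
          · exact one_add_rpow_le h2 (by linarith)
          · exact one_add_rpow_le h1 hp
      _ = 2 ^ (gap n m / 2) * 2 ^ (((n : ℝ) - 3 / 2) / 2) * ((w / N) ^ (gap n m / 2) *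
          (w / (m * logE d)) ^ (((n : ℝ) - 3 / 2) / 2)) := by ring
      _ ≤ _ := by
          rw [div_rpow_mul_div_rpow hd hw.le hw]
          gcongr
          exact le_add_of_nonneg_left (by positivity)

theorem tailGrowth_le_of_ge (hn : 2 ≤ n) (hnm : n ≤ m + 1) (hm : 0 < m) (hmN : m ≤ N)
    (hd : 0 < d) (hN : m * logE d ≤ N) {w : ℝ} (hw : 0 < w) :
    tailGrowth n m N d w ≤ 2 ^ ((m : ℝ) / 2) *
      (Set.indicator (Set.Iic (m * logE d)) 1 w +
      (N : ℝ) ^ (1 / 4 : ℝ) * ((m * logE d)⁻¹) ^ (((n : ℝ) - 3 / 2) / 2) *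
        w ^ ((n : ℝ) / 2 - 1) +
      (N : ℝ)⁻¹ ^ (gap n m / 2) * ((m * logE d)⁻¹) ^ (((n : ℝ) - 3 / 2) / 2) *
        w ^ ((m : ℝ) / 2)) := by
  have hl := one_le_logE hd
  have hl0 : 0 < logE d := by linarith
  have hm0 : (0 : ℝ) < m := by exact_mod_cast hm
  have hN0 : (0 : ℝ) < N := by exact_mod_cast (by omega : 0 < N)
  have hs := half_le_gap hnm
  have hn2 : (2 : ℝ) ≤ n := by exact_mod_cast hn
  have hp : 0 ≤ ((n : ℝ) - 3 / 2) / 2 := by linarith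
  have hB : 0 ≤ (N : ℝ) ^ (1 / 4 : ℝ) * ((m * logE d)⁻¹) ^ (((n : ℝ) - 3 / 2) / 2) *
        w ^ ((n : ℝ) / 2 - 1) := by positivity
  have hC : 0 ≤ (N : ℝ)⁻¹ ^ (gap n m / 2) * ((m * logE d)⁻¹) ^ (((n : ℝ) - 3 / 2) / 2) *
        w ^ ((m : ℝ) / 2) := by positivity
  have hA : 0 ≤ Set.indicator (Set.Iic (m * logE d)) (1 : ℝ → ℝ) w :=
    Set.indicator_nonneg (fun _ _ => zero_le_one) _
  rw [← two_rpow_gap_mul n m, tailGrowth]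
  rcases le_total w (m * logE d) with h | h
  · have h1 : 1 + w / (m * logE d) ≤ 2 := by
      have : w / (m * logE d) ≤ 1 := by rwa [div_le_one (by positivity)]
      linarith
    have h2 : 1 + w / N ≤ 2 := by
      have : w / N ≤ 1 := by
        rw [div_le_one (by positivity)]; linarith
      linarith
    have hA1 : Set.indicator (Set.Iic (m * logE d)) (1 : ℝ → ℝ) w = 1 :=
      Set.indicator_of_mem (Set.mem_Iic.2 h) _
    calc _ ≤ (2 : ℝ) ^ (gap n m / 2) * 2 ^ (((n : ℝ) - 3 / 2) / 2) * 1 := by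
          rw [mul_one]; gcongr
      _ ≤ _ := by
          gcongr
          linarith
  · have h1 : 1 ≤ w / (m * logE d) := by rwa [one_le_div (by positivity)]
    rcases le_total w N with h' | h'
    · have h2 : 1 + w / N ≤ 2 := by
        have : w / N ≤ 1 := by rwa [div_le_one (by positivity)]
        linarith
      -- Trading w^(1/4) for N^(1/4) lowers the exponent to n/2 - 1, whose integral against e^(-xw)
      -- scales as x^(-n/2), the power occurring in `delta₁`.
      have h3 : w ^ (((n : ℝ) - 3 / 2) / 2) ≤ (N : ℝ) ^ (1 / 4 : ℝ) * w ^ ((n : ℝ) / 2 - 1) := by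
        calc w ^ (((n : ℝ) - 3 / 2) / 2) = w ^ (1 / 4 : ℝ) * w ^ ((n : ℝ) / 2 - 1) := by
              rw [← Real.rpow_add hw]
              congr 1
              ring
          _ ≤ _ := by gcongr
      calc _ ≤ 2 ^ (gap n m / 2) *
            (2 ^ (((n : ℝ) - 3 / 2) / 2) * (w / (m * logE d)) ^ (((n : ℝ) - 3 / 2) / 2)) := by
            gcongr
            exact one_add_rpow_le h1 hp
        _ = 2 ^ (gap n m / 2) * 2 ^ (((n : ℝ) - 3 / 2) / 2) *
            (((m * logE d)⁻¹) ^ (((n : ℝ) - 3 / 2) / 2) * w ^ (((n : ℝ) - 3 / 2) / 2)) := by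
            rw [div_eq_inv_mul w (m * logE d), Real.mul_rpow (by positivity) hw.le]; ring
        _ ≤ 2 ^ (gap n m / 2) * 2 ^ (((n : ℝ) - 3 / 2) / 2) *
            (((m * logE d)⁻¹) ^ (((n : ℝ) - 3 / 2) / 2) *
              ((N : ℝ) ^ (1 / 4 : ℝ) * w ^ ((n : ℝ) / 2 - 1))) := by gcongr
        _ ≤ _ := by
            gcongr
            linarith
    · have h2 : 1 ≤ w / N := by rwa [one_le_div (by positivity)]
      calc _ ≤ (2 ^ (gap n m / 2) * (w / N) ^ (gap n m / 2)) *
            (2 ^ (((n : ℝ) - 3 / 2) / 2) * (w / (m * logE d)) ^ (((n : ℝ) - 3 / 2) / 2)) := by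
            gcongr
            · exact one_add_rpow_le h2 (by linarith)
            · exact one_add_rpow_le h1 hp
        _ = 2 ^ (gap n m / 2) * 2 ^ (((n : ℝ) - 3 / 2) / 2) * ((w / N) ^ (gap n m / 2) *
            (w / (m * logE d)) ^ (((n : ℝ) - 3 / 2) / 2)) := by ring
        _ ≤ _ := by
            rw [div_rpow_mul_div_rpow hd hw.le hw]
            gcongr
            linarith

theorem lintegral_tailGrowth_le_of_le (hn : 2 ≤ n) (hnm : n ≤ m + 1) (hm : 0 < m) (hmN : m ≤ N)
    (hd : 0 < d) (hN : (N : ℝ) ≤ m * logE d) (hx : 0 < x) :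
    ∫⁻ w in Set.Ioi 0, ENNReal.ofReal (Real.exp (-x * w) * tailGrowth n m N d w) ≤
      ENNReal.ofReal (2 ^ ((m : ℝ) / 2) * (logE d ^ (gap n m / 2) * (1 / x) +
        (N : ℝ)⁻¹ ^ (gap n m / 2) * ((m * logE d)⁻¹) ^ (((n : ℝ) - 3 / 2) / 2) *
          ((m / x) ^ ((m : ℝ) / 2) * (2 / x)))) := by
  have hl := one_le_logE hd
  set a := logE d ^ (gap n m / 2)
  set b := (N : ℝ)⁻¹ ^ (gap n m / 2) * ((m * logE d)⁻¹) ^ (((n : ℝ) - 3 / 2) / 2)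
  have ha : 0 ≤ a := by positivity
  have hb : 0 ≤ b := by positivity
  have hI := lintegral_rpow_mul_exp_le (p := (m : ℝ) / 2) (by positivity) hx
  rw [mul_div_cancel₀ _ two_ne_zero] at hI
  calc _ ≤ ∫⁻ w in Set.Ioi 0, ENNReal.ofReal (2 ^ ((m : ℝ) / 2)) *
          (ENNReal.ofReal a * ENNReal.ofReal (Real.exp (-x * w)) +
          ENNReal.ofReal b * ENNReal.ofReal (w ^ ((m : ℝ) / 2) * Real.exp (-x * w))) := by
        refine setLIntegral_mono' measurableSet_Ioi fun w hw => ?_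
        have hw' : (0 : ℝ) < w := hw
        rw [← ENNReal.ofReal_mul ha, ← ENNReal.ofReal_mul hb,
          ← ENNReal.ofReal_add (by positivity) (by positivity),
          ← ENNReal.ofReal_mul (by positivity)]
        refine ENNReal.ofReal_le_ofReal ?_
        calc _ ≤ Real.exp (-x * w) * _ := mul_le_mul_of_nonneg_left
              (tailGrowth_le_of_le hn hnm hm hmN hd hN hw) (Real.exp_pos _).le
          _ = _ := by ring
    _ ≤ ENNReal.ofReal (2 ^ ((m : ℝ) / 2)) * (ENNReal.ofReal a * ENNReal.ofReal (1 / x) +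
          ENNReal.ofReal b * ENNReal.ofReal ((m / x) ^ ((m : ℝ) / 2) * (2 / x))) := by
        rw [lintegral_const_mul' _ _ ENNReal.ofReal_ne_top, lintegral_add_left (by fun_prop),
          lintegral_const_mul' _ _ ENNReal.ofReal_ne_top,
          lintegral_const_mul' _ _ ENNReal.ofReal_ne_top, lintegral_exp_neg_mul_Ioi hx]
        gcongr
    _ = _ := by
        rw [← ENNReal.ofReal_mul ha, ← ENNReal.ofReal_mul hb,
          ← ENNReal.ofReal_add (by positivity) (by positivity),
          ← ENNReal.ofReal_mul (by positivity)]

theorem lintegral_tailGrowth_le_of_ge (hn : 2 ≤ n) (hnm : n ≤ m + 1) (hm : 0 < m) (hmN : m ≤ N)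
    (hd : 0 < d) (hN : m * logE d ≤ N) (hx : 0 < x) :
    ∫⁻ w in Set.Ioi 0, ENNReal.ofReal (Real.exp (-x * w) * tailGrowth n m N d w) ≤
      ENNReal.ofReal (2 ^ ((m : ℝ) / 2) * (m * logE d +
        (N : ℝ) ^ (1 / 4 : ℝ) * ((m * logE d)⁻¹) ^ (((n : ℝ) - 3 / 2) / 2) *
          (((n - 2) / x) ^ ((n : ℝ) / 2 - 1) * (2 / x)) +
        (N : ℝ)⁻¹ ^ (gap n m / 2) * ((m * logE d)⁻¹) ^ (((n : ℝ) - 3 / 2) / 2) *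
          ((m / x) ^ ((m : ℝ) / 2) * (2 / x)))) := by
  have hl := one_le_logE hd
  have hn2 : (2 : ℝ) ≤ n := by exact_mod_cast hn
  set a := (N : ℝ) ^ (1 / 4 : ℝ) * ((m * logE d)⁻¹) ^ (((n : ℝ) - 3 / 2) / 2)
  set b := (N : ℝ)⁻¹ ^ (gap n m / 2) * ((m * logE d)⁻¹) ^ (((n : ℝ) - 3 / 2) / 2)
  have ha : 0 ≤ a := by positivity
  have hb : 0 ≤ b := by positivity
  have hI := lintegral_rpow_mul_exp_le (p := (m : ℝ) / 2) (by positivity) hx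
  rw [mul_div_cancel₀ _ two_ne_zero] at hI
  have hI' := lintegral_rpow_mul_exp_le (p := (n : ℝ) / 2 - 1) (by linarith) hx
  rw [show 2 * ((n : ℝ) / 2 - 1) = n - 2 by ring] at hI'
  have hn3 : 0 ≤ (n - 2) / x := div_nonneg (by linarith) hx.le
  have hind : ∫⁻ w in Set.Ioi 0, ENNReal.ofReal (Set.indicator (Set.Iic (m * logE d)) 1 w) ≤
      ENNReal.ofReal (m * logE d) := by
    have h1 : ∀ w : ℝ, ENNReal.ofReal (Set.indicator (Set.Iic (m * logE d)) 1 w) =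
        Set.indicator (Set.Iic (m * logE d)) 1 w := by
      intro w
      by_cases h : w ∈ Set.Iic (m * logE d) <;> simp [h]
    simp only [h1]
    rw [lintegral_indicator_one measurableSet_Iic, Measure.restrict_apply measurableSet_Iic,
      Set.inter_comm, Set.Ioi_inter_Iic, Real.volume_Ioc, sub_zero]
  calc _ ≤ ∫⁻ w in Set.Ioi 0, ENNReal.ofReal (2 ^ ((m : ℝ) / 2)) *
          (ENNReal.ofReal (Set.indicator (Set.Iic (m * logE d)) 1 w) +
          ENNReal.ofReal a * ENNReal.ofReal (w ^ ((n : ℝ) / 2 - 1) * Real.exp (-x * w)) +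
          ENNReal.ofReal b * ENNReal.ofReal (w ^ ((m : ℝ) / 2) * Real.exp (-x * w))) := by
        refine setLIntegral_mono' measurableSet_Ioi fun w hw => ?_
        have hw' : (0 : ℝ) < w := hw
        have hA : 0 ≤ Set.indicator (Set.Iic (m * logE d)) (1 : ℝ → ℝ) w :=
          Set.indicator_nonneg (fun _ _ => zero_le_one) _
        rw [← ENNReal.ofReal_mul ha, ← ENNReal.ofReal_mul hb,
          ← ENNReal.ofReal_add hA (by positivity),
          ← ENNReal.ofReal_add (by positivity) (by positivity),
          ← ENNReal.ofReal_mul (by positivity)]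
        refine ENNReal.ofReal_le_ofReal ?_
        -- On the bounded range the decay is discarded, so its contribution is at most the length m
        -- log(ed), with no 1/x. This is why the corresponding term q/(m - n - q + 2) stays bounded
        -- as q approaches s.
        have hexp : Real.exp (-x * w) ≤ 1 := Real.exp_le_one_iff.2 (by nlinarith)
        calc _ ≤ Real.exp (-x * w) * _ := mul_le_mul_of_nonneg_left
              (tailGrowth_le_of_ge hn hnm hm hmN hd hN hw) (Real.exp_pos _).le
          _ = 2 ^ ((m : ℝ) / 2) * (Real.exp (-x * w) * Set.indicator (Set.Iic (m * logE d)) 1 w +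
            a * (w ^ ((n : ℝ) / 2 - 1) * Real.exp (-x * w)) +
            b * (w ^ ((m : ℝ) / 2) * Real.exp (-x * w))) := by ring
          _ ≤ _ := by
            gcongr
            exact mul_le_of_le_one_left hA hexp
    _ ≤ ENNReal.ofReal (2 ^ ((m : ℝ) / 2)) * (ENNReal.ofReal (m * logE d) +
          ENNReal.ofReal a * ENNReal.ofReal (((n - 2) / x) ^ ((n : ℝ) / 2 - 1) * (2 / x)) +
          ENNReal.ofReal b * ENNReal.ofReal ((m / x) ^ ((m : ℝ) / 2) * (2 / x))) := by
        have hmeas : Measurable fun w => ENNReal.ofReal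
            (Set.indicator (Set.Iic (m * logE d)) (1 : ℝ → ℝ) w) :=
          (measurable_one.indicator measurableSet_Iic).ennreal_ofReal
        rw [lintegral_const_mul' _ _ ENNReal.ofReal_ne_top,
          lintegral_add_right _ (by fun_prop), lintegral_add_left hmeas,
          lintegral_const_mul' _ _ ENNReal.ofReal_ne_top,
          lintegral_const_mul' _ _ ENNReal.ofReal_ne_top]
        gcongr
    _ = _ := by
        rw [← ENNReal.ofReal_mul ha, ← ENNReal.ofReal_mul hb,
          ← ENNReal.ofReal_add (by positivity) (by positivity),
          ← ENNReal.ofReal_add (by positivity) (by positivity),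
          ← ENNReal.ofReal_mul (by positivity)]

end TailIntegral

/-! ### Absorbing the constants into the stated error terms. -/

section TailConstants

variable {n m N d : ℕ} {x q : ℝ}

/-- Since log(ed) ≤ d, the negative power of d, most of it from the d^6 in M, pays for powers of the
logarithm. -/
theorem rpow_mul_logE_rpow_le_one (hd : 0 < d) {a : ℝ} (ha : 0 ≤ a)
    (ha' : a ≤ n + 6 * gap n m - 3) :
    (d : ℝ) ^ (3 - n - 6 * gap n m) * logE d ^ a ≤ 1 := by
  have hl := one_le_logE hd
  have hd1 : (1 : ℝ) ≤ d := by exact_mod_cast hd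
  calc _ ≤ (d : ℝ) ^ (3 - n - 6 * gap n m) * (d : ℝ) ^ a := by
        gcongr
        exact logE_le hd
    _ = (d : ℝ) ^ (3 - n - 6 * gap n m + a) := by rw [Real.rpow_add (by positivity)]
    _ ≤ 1 := Real.rpow_le_one_of_one_le_of_nonpos hd1 (by linarith)

theorem rpow_mul_rpow_quarter_le (hn : 2 ≤ n) (hnm : n ≤ m + 1) (hd : 0 < d)
    (hN : N ≤ m * (2 * d) ^ n) :
    (d : ℝ) ^ (3 - n - 6 * gap n m) * (N : ℝ) ^ (1 / 4 : ℝ) ≤ m * 2 ^ n := by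
  have hd1 : (1 : ℝ) ≤ d := by exact_mod_cast hd
  have hm1 : (1 : ℝ) ≤ m := by exact_mod_cast (by omega : 1 ≤ m)
  have hs := half_le_gap hnm
  have hn2 : (2 : ℝ) ≤ n := by exact_mod_cast hn
  have hN' : (N : ℝ) ≤ m * 2 ^ n * d ^ n := by
    rw [mul_assoc, ← mul_pow]
    exact_mod_cast hN
  have h1 : (1 : ℝ) ≤ m * 2 ^ n := one_le_mul_of_one_le_of_one_le hm1 (one_le_pow₀ (by norm_num))
  calc _ ≤ (d : ℝ) ^ (3 - n - 6 * gap n m) * ((m * 2 ^ n * d ^ n : ℝ)) ^ (1 / 4 : ℝ) := by gcongr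
    _ = (d : ℝ) ^ (3 - n - 6 * gap n m + n * (1 / 4)) * ((m * 2 ^ n : ℝ)) ^ (1 / 4 : ℝ) := by
        rw [Real.mul_rpow (by positivity) (by positivity), ← Real.rpow_natCast (d : ℝ) n,
          ← Real.rpow_mul (by positivity), Real.rpow_add (by positivity)]
        ring
    _ ≤ 1 * ((m * 2 ^ n : ℝ)) ^ (1 : ℝ) := by
        gcongr
        · exact Real.rpow_le_one_of_one_le_of_nonpos hd1 (by linarith)
        · norm_num
    _ = _ := by rw [Real.rpow_one, one_mul]

theorem two_rpow_half_le (m : ℕ) : (2 : ℝ) ^ ((m : ℝ) / 2) ≤ 2 ^ m := by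
  rw [← Real.rpow_natCast]
  exact Real.rpow_le_rpow_of_exponent_le (by norm_num) (by
    have : (0 : ℝ) ≤ m := Nat.cast_nonneg m
    linarith)

theorem exp_natCast_le_three_pow (m : ℕ) : Real.exp m ≤ 3 ^ m := by
  rw [← mul_one (m : ℝ), Real.exp_nat_mul]
  gcongr
  linarith [Real.exp_one_lt_d9]

theorem two_mul_exp_neg_le (hm : 0 < m) : 2 * Real.exp (-(8 * m)) ≤ 1 / (8 * m) := by
  have hm1 : (1 : ℝ) ≤ m := by exact_mod_cast hm
  have h1 := Real.add_one_le_exp (4 * m : ℝ)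
  have h2 : Real.exp (8 * m) = Real.exp (4 * m) ^ 2 := by
    rw [← Real.exp_nat_mul]; push_cast; ring_nf
  rw [Real.exp_neg, le_div_iff₀ (by positivity), h2]
  rw [show 2 * (Real.exp (4 * m) ^ 2)⁻¹ * (8 * m) = 16 * m / Real.exp (4 * m) ^ 2 by ring,
    div_le_one (by positivity)]
  nlinarith

/-- The factor 10^(-4m) beats the collected constants k^m and leaves 1/(4m), as 4m ≤ 8^m. -/
theorem pow_mul_pow_le {k : ℝ} (hm : 0 < m) (hk : 0 ≤ k) (hk8 : k * 8 ≤ 10 ^ 4) :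
    (1 / 10 ^ 4) ^ m * k ^ m ≤ 1 / (4 * m) := by
  have hm0 : (0 : ℝ) < m := by exact_mod_cast hm
  have h1 : (4 * m : ℝ) ≤ 8 ^ m := by
    have h2 : (m : ℝ) ≤ 2 ^ m := by exact_mod_cast (Nat.lt_two_pow_self (n := m)).le
    have h3 : (4 : ℝ) ≤ 4 ^ m := by
      simpa using pow_le_pow_right₀ (by norm_num : (1 : ℝ) ≤ 4) hm
    calc (4 * m : ℝ) ≤ 4 ^ m * 2 ^ m := by gcongr
      _ = 8 ^ m := by rw [← mul_pow]; norm_num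
  rw [le_div_iff₀ (by positivity), ← mul_pow]
  calc (1 / 10 ^ 4 * k) ^ m * (4 * m) ≤ (1 / 10 ^ 4 * k) ^ m * 8 ^ m := by gcongr
    _ = (1 / 10 ^ 4 * k * 8) ^ m := by rw [← mul_pow]
    _ ≤ 1 := pow_le_one₀ (by positivity) (by linarith)

theorem natCast_le_two_pow (m : ℕ) : (m : ℝ) ≤ 2 ^ m := by
  exact_mod_cast (Nat.lt_two_pow_self (n := m)).le

theorem two_le_two_pow (hm : 0 < m) : (2 : ℝ) ≤ 2 ^ m := by
  simpa using pow_le_pow_right₀ (by norm_num : (1 : ℝ) ≤ 2) hm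

theorem one_div_four_mul_le (hm : 0 < m) : 1 / (4 * m : ℝ) ≤ 1 / 4 := by
  have hm1 : (1 : ℝ) ≤ m := by exact_mod_cast hm
  exact one_div_le_one_div_of_le (by norm_num) (by linarith)

theorem logE_rpow_neg_le_one (hn : 2 ≤ n) (hd : 0 < d) :
    logE d ^ (-(((n : ℝ) - 3 / 2) / 2)) ≤ 1 := by
  have hn2 : (2 : ℝ) ≤ n := by exact_mod_cast hn
  exact Real.rpow_le_one_of_one_le_of_nonpos (one_le_logE hd) (by linarith)

theorem bulk_const_le (hn : 2 ≤ n) (hnm : n ≤ m + 1) (hm : 0 < m) (hd : 0 < d) :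
    2 * Real.exp (-(8 * m)) +
      tailConst n m d * (2 * (Real.exp 1 * logE d) ^ ((m : ℝ) / 2 + 1)) ≤ 1 / 4 := by
  have hl := one_le_logE hd
  have hl0 : 0 < logE d := by linarith
  have hs := half_le_gap hnm
  have hn2 : (2 : ℝ) ≤ n := by exact_mod_cast hn
  have hm1 : (1 : ℝ) ≤ m := by exact_mod_cast hm
  have h1 : 2 * Real.exp (-(8 * m)) ≤ 1 / 8 :=
    (two_mul_exp_neg_le hm).trans (one_div_le_one_div_of_le (by norm_num) (by linarith))
  have h2 : tailConst n m d * (2 * (Real.exp 1 * logE d) ^ ((m : ℝ) / 2 + 1)) =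
      (1 / 10 ^ 4) ^ m * (2 * Real.exp (m / 2 + 1)) *
        ((d : ℝ) ^ (3 - n - 6 * gap n m) * logE d ^ (gap n m / 2 + 1)) := by
    have h3 : logE d ^ (gap n m / 2 + 1) =
        logE d ^ (-(((n : ℝ) - 3 / 2) / 2)) * logE d ^ ((m : ℝ) / 2 + 1) := by
      rw [← Real.rpow_add hl0, gap]
      congr 1
      ring
    rw [h3, tailConst, Real.mul_rpow (by positivity) hl0.le, ← Real.exp_mul, one_mul]
    ring
  have h4 := rpow_mul_logE_rpow_le_one (n := n) (m := m) hd (a := gap n m / 2 + 1) (by linarith)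
    (by linarith)
  have h5 : 2 * Real.exp (m / 2 + 1) ≤ 2 * 9 ^ m := by
    have : Real.exp (m / 2 + 1) ≤ Real.exp m ^ 2 := by
      rw [← Real.exp_nat_mul]
      refine Real.exp_le_exp.2 ?_
      push_cast
      linarith
    calc 2 * Real.exp (m / 2 + 1) ≤ 2 * Real.exp m ^ 2 := by gcongr
      _ ≤ 2 * (3 ^ m) ^ 2 := by
          gcongr
          exact exp_natCast_le_three_pow m
      _ = 2 * 9 ^ m := by rw [← pow_mul, mul_comm m 2, pow_mul]; norm_num
  have h6 : (1 / 10 ^ 4 : ℝ) ^ m * 9 ^ m ≤ 1 / 10 ^ 4 * 9 := by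
    rw [← mul_pow]
    exact pow_le_of_le_one (by norm_num) (by norm_num) hm.ne'
  have h7 : tailConst n m d * (2 * (Real.exp 1 * logE d) ^ ((m : ℝ) / 2 + 1)) ≤ 1 / 8 := by
    rw [h2]
    calc _ ≤ (1 / 10 ^ 4 : ℝ) ^ m * (2 * 9 ^ m) * 1 := by gcongr
      _ = 2 * ((1 / 10 ^ 4) ^ m * 9 ^ m) := by ring
      _ ≤ 2 * (1 / 10 ^ 4 * 9) := mul_le_mul_of_nonneg_left h6 two_pos.le
      _ ≤ 1 / 8 := by norm_num
  linarith

theorem near_const_le_of_le (hn : 2 ≤ n) (hnm : n ≤ m + 1) (hm : 0 < m) (hd : 0 < d)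
    (hx : 0 < x) (hx1 : x ≤ 1) :
    2 * Real.exp (-(8 * m)) +
      tailConst n m d * (2 ^ ((m : ℝ) / 2) * (logE d ^ (gap n m / 2) * (1 / x))) ≤
      1 / x := by
  have hl := one_le_logE hd
  have hs := half_le_gap hnm
  have hs0 : 0 < gap n m := by linarith
  have hn2 : (2 : ℝ) ≤ n := by exact_mod_cast hn
  have hm0 : (0 : ℝ) < m := by exact_mod_cast hm
  have hm1 : (1 : ℝ) ≤ m := by exact_mod_cast hm
  have h1 : 2 * Real.exp (-(8 * m)) ≤ 1 / 2 * (1 / x) := by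
    refine (two_mul_exp_neg_le hm).trans ?_
    rw [div_mul_div_comm, one_mul]
    exact one_div_le_one_div_of_le (by positivity) (by linarith)
  have h2 : tailConst n m d * (2 ^ ((m : ℝ) / 2) * logE d ^ (gap n m / 2)) ≤ 1 / 2 := by
    calc _ = (1 / 10 ^ 4) ^ m * 2 ^ ((m : ℝ) / 2) *
          ((d : ℝ) ^ (3 - n - 6 * gap n m) * logE d ^ (gap n m / 2)) *
          logE d ^ (-(((n : ℝ) - 3 / 2) / 2)) := by rw [tailConst]; ring
      _ ≤ (1 / 10 ^ 4) ^ m * 2 ^ m * 1 * 1 := by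
          gcongr
          · exact two_rpow_half_le m
          · exact rpow_mul_logE_rpow_le_one hd (by linarith) (by linarith)
          · exact logE_rpow_neg_le_one hn hd
      _ = (1 / 10 ^ 4) ^ m * 2 ^ m := by ring
      _ ≤ 1 / (4 * m) := pow_mul_pow_le hm (by norm_num) (by norm_num)
      _ ≤ 1 / 2 := (one_div_four_mul_le hm).trans (by norm_num)
  have h3 : tailConst n m d * (2 ^ ((m : ℝ) / 2) * (logE d ^ (gap n m / 2) * (1 / x))) ≤
      1 / 2 * (1 / x) := by
    calc _ = tailConst n m d * (2 ^ ((m : ℝ) / 2) * logE d ^ (gap n m / 2)) * (1 / x) := by ring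
      _ ≤ 1 / 2 * (1 / x) := by gcongr
  linarith

theorem near_const_le_of_ge (hn : 2 ≤ n) (hnm : n ≤ m + 1) (hm : 0 < m) (hd : 0 < d)
    (hx : 0 < x) (hx1 : x ≤ 1) :
    2 * Real.exp (-(8 * m)) + tailConst n m d * (2 ^ ((m : ℝ) / 2) * (m * logE d)) ≤
      gap n m / (gap n m * x + 1 / 2) := by
  have hl := one_le_logE hd
  have hs := half_le_gap hnm
  have hs0 : 0 < gap n m := by linarith
  have hn2 : (2 : ℝ) ≤ n := by exact_mod_cast hn
  have hm0 : (0 : ℝ) < m := by exact_mod_cast hm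
  have hm1 : (1 : ℝ) ≤ m := by exact_mod_cast hm
  have h2 : tailConst n m d * (2 ^ ((m : ℝ) / 2) * (m * logE d)) ≤ 1 / (4 * m) := by
    have h3 := rpow_mul_logE_rpow_le_one (n := n) (m := m) hd (a := 1) (by linarith) (by linarith)
    rw [Real.rpow_one] at h3
    calc _ = (1 / 10 ^ 4) ^ m * 2 ^ ((m : ℝ) / 2) * m *
          ((d : ℝ) ^ (3 - n - 6 * gap n m) * logE d) *
          logE d ^ (-(((n : ℝ) - 3 / 2) / 2)) := by rw [tailConst]; ring
      _ ≤ (1 / 10 ^ 4) ^ m * 2 ^ m * 2 ^ m * 1 * 1 := by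
          gcongr
          · exact two_rpow_half_le m
          · exact natCast_le_two_pow m
          · exact logE_rpow_neg_le_one hn hd
      _ = (1 / 10 ^ 4) ^ m * 4 ^ m := by
          rw [mul_one, mul_one, mul_assoc, ← mul_pow]; norm_num
      _ ≤ 1 / (4 * m) := pow_mul_pow_le hm (by norm_num) (by norm_num)
  -- The left side is at most 1/2, and s/(sx + 1/2) ≥ 1/2 because s ≥ 1/2 and x ≤ 1.
  calc _ ≤ 1 / (8 * m : ℝ) + 1 / (4 * m) := add_le_add (two_mul_exp_neg_le hm) h2
    _ = 3 / (8 * m) := by field_simp; norm_num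
    _ ≤ 1 / 2 := by
        rw [div_le_div_iff₀ (by positivity) (by positivity)]
        linarith
    _ ≤ _ := by
        rw [div_le_div_iff₀ (by positivity) (by positivity)]
        nlinarith

theorem far_const_le (hn : 2 ≤ n) (hnm : n ≤ m + 1) (hm : 0 < m) (hmN : m ≤ N) (hd : 0 < d)
    (hq : 0 < q) (hqs : q < gap n m) (hxq : x = 1 - q / gap n m) :
    tailConst n m d * (2 ^ ((m : ℝ) / 2) *
      ((N : ℝ)⁻¹ ^ (gap n m / 2) * ((m * logE d)⁻¹) ^ (((n : ℝ) - 3 / 2) / 2) *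
        ((m / x) ^ ((m : ℝ) / 2) * (2 / x)))) ≤ gap n m / q * delta₂ n m N d q := by
  have hl := one_le_logE hd
  have hl0 : 0 < logE d := by linarith
  have hs := half_le_gap hnm
  have hs0 : 0 < gap n m := by linarith
  have hn2 : (2 : ℝ) ≤ n := by exact_mod_cast hn
  have hm1 : (1 : ℝ) ≤ m := by exact_mod_cast hm
  have hm0 : (0 : ℝ) < m := by linarith
  have hN0 : (0 : ℝ) < N := by exact_mod_cast (by omega : 0 < N)
  have hx : 0 < x := by
    rw [hxq, sub_pos, div_lt_one hs0]
    exact hqs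
  have hsq : gap n m - q = gap n m * x := by
    rw [hxq, mul_sub, mul_div_cancel₀ _ hs0.ne', mul_one]
  -- F collects the dependence on N and x, which is the same on both sides; only powers of
  -- constants, d and log(ed) remain to be compared.
  set F := ((m : ℝ) / N) ^ (gap n m / 2) * (x ^ ((m : ℝ) / 2))⁻¹ * (1 / x) with hF
  have hF0 : 0 ≤ F := by positivity
  have hm2 : (m : ℝ) ^ ((m : ℝ) / 2) = (m : ℝ) ^ (gap n m / 2) *
      (m : ℝ) ^ (((n : ℝ) - 3 / 2) / 2) := by
    rw [← Real.rpow_add hm0, gap]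
    congr 1
    ring
  have hL : tailConst n m d * (2 ^ ((m : ℝ) / 2) *
      ((N : ℝ)⁻¹ ^ (gap n m / 2) * ((m * logE d)⁻¹) ^ (((n : ℝ) - 3 / 2) / 2) *
        ((m / x) ^ ((m : ℝ) / 2) * (2 / x)))) =
      (1 / 10 ^ 4) ^ m * (2 ^ ((m : ℝ) / 2) * 2) * (d : ℝ) ^ (3 - n - 6 * gap n m) *
        (logE d ^ (-(((n : ℝ) - 3 / 2) / 2)) * logE d ^ (-(((n : ℝ) - 3 / 2) / 2))) * F := by
    rw [hF, tailConst, Real.inv_rpow (by positivity) (((n : ℝ) - 3 / 2) / 2),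
      Real.inv_rpow hN0.le, Real.mul_rpow hm0.le hl0.le, Real.div_rpow hm0.le hx.le, hm2,
      Real.rpow_neg hl0.le, Real.div_rpow hm0.le hN0.le]
    field_simp
  have hR : gap n m / q * delta₂ n m N d q =
      √(Real.pi * m) * Real.exp (-(m : ℝ) / 2) * logE d ^ (-((n : ℝ) / 2 - 1)) * F := by
    rw [hF, delta₂, hsq, ← hxq, Real.rpow_neg hl0.le]
    field_simp
  rw [hL, hR]
  refine mul_le_mul_of_nonneg_right ?_ hF0
  have h1 : logE d ^ (-(((n : ℝ) - 3 / 2) / 2)) * logE d ^ (-(((n : ℝ) - 3 / 2) / 2)) ≤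
      logE d ^ (-((n : ℝ) / 2 - 1)) := by
    rw [← Real.rpow_add hl0]
    exact Real.rpow_le_rpow_of_exponent_le hl (by linarith)
  have h2 : (d : ℝ) ^ (3 - n - 6 * gap n m) ≤ 1 := by
    have := rpow_mul_logE_rpow_le_one (n := n) (m := m) hd (a := 0) le_rfl (by linarith)
    rwa [Real.rpow_zero, mul_one] at this
  have h3 : 1 ≤ √(Real.pi * m) := by
    rw [Real.one_le_sqrt]
    nlinarith [Real.pi_gt_three]
  have h4 : (1 / 10 ^ 4 : ℝ) ^ m * (2 ^ ((m : ℝ) / 2) * 2) ≤ Real.exp (-(m : ℝ) / 2) := by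
    have h5 : Real.exp ((m : ℝ) / 2) ≤ 3 ^ m :=
      (Real.exp_le_exp.2 (by linarith)).trans (exp_natCast_le_three_pow m)
    rw [neg_div, Real.exp_neg, ← one_div, le_div_iff₀ (Real.exp_pos _)]
    calc _ ≤ (1 / 10 ^ 4 : ℝ) ^ m * (2 ^ m * 2 ^ m) * 3 ^ m := by
          gcongr
          · exact two_rpow_half_le m
          · exact two_le_two_pow hm
      _ = (1 / 10 ^ 4 : ℝ) ^ m * 12 ^ m := by
          rw [mul_assoc, ← mul_pow, ← mul_pow]; norm_num
      _ ≤ 1 / (4 * m) := pow_mul_pow_le hm (by norm_num) (by norm_num)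
      _ ≤ 1 := (one_div_four_mul_le hm).trans (by norm_num)
  calc _ ≤ Real.exp (-(m : ℝ) / 2) * 1 * logE d ^ (-((n : ℝ) / 2 - 1)) := by gcongr
    _ = 1 * Real.exp (-(m : ℝ) / 2) * logE d ^ (-((n : ℝ) / 2 - 1)) := by ring
    _ ≤ _ := by gcongr

theorem sub_two_rpow_le (hn : 2 ≤ n) :
    ((n : ℝ) - 2) ^ ((n : ℝ) / 2 - 1) ≤ 2 * ((n : ℝ) - 3 / 2) ^ (((n : ℝ) - 3 / 2) / 2) := by
  rcases hn.eq_or_lt with rfl | h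
  -- For n = 2 the left side is 0^0 = 1, while the base 1/2 on the right is below 1; this case
  -- requires the factor 2.
  · norm_num
    have h1 : (1 / 2 : ℝ) ≤ (1 / 2) ^ (1 / 4 : ℝ) := by
      conv_lhs => rw [← Real.rpow_one (1 / 2 : ℝ)]
      exact Real.rpow_le_rpow_of_exponent_ge (by norm_num) (by norm_num) (by norm_num)
    linarith
  · have h3 : (3 : ℝ) ≤ n := by exact_mod_cast h
    calc ((n : ℝ) - 2) ^ ((n : ℝ) / 2 - 1) ≤ ((n : ℝ) - 3 / 2) ^ ((n : ℝ) / 2 - 1) := by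
          refine Real.rpow_le_rpow (by linarith) (by linarith) (by linarith)
      _ ≤ ((n : ℝ) - 3 / 2) ^ (((n : ℝ) - 3 / 2) / 2) :=
          Real.rpow_le_rpow_of_exponent_le (by linarith) (by linarith)
      _ ≤ _ := by
          have : 0 ≤ ((n : ℝ) - 3 / 2) ^ (((n : ℝ) - 3 / 2) / 2) :=
            Real.rpow_nonneg (by linarith) _
          linarith

theorem mid_const_le (hn : 2 ≤ n) (hnm : n ≤ m + 1) (hm : 0 < m) (hd : 0 < d)
    (hN : N ≤ m * (2 * d) ^ n)
    (hq : 0 < q) (hqs : q < gap n m) (hxq : x = 1 - q / gap n m) :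
    tailConst n m d * (2 ^ ((m : ℝ) / 2) *
      ((N : ℝ) ^ (1 / 4 : ℝ) * ((m * logE d)⁻¹) ^ (((n : ℝ) - 3 / 2) / 2) *
        (((n - 2) / x) ^ ((n : ℝ) / 2 - 1) * (2 / x)))) ≤ gap n m / q * delta₁ n m d q := by
  have hl := one_le_logE hd
  have hl0 : 0 < logE d := by linarith
  have hs := half_le_gap hnm
  have hs0 : 0 < gap n m := by linarith
  have hn2 : (2 : ℝ) ≤ n := by exact_mod_cast hn
  have hm1 : (1 : ℝ) ≤ m := by exact_mod_cast hm
  have hm0 : (0 : ℝ) < m := by linarith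
  have hn32 : (0 : ℝ) < n - 3 / 2 := by linarith
  have hx : 0 < x := by
    rw [hxq, sub_pos, div_lt_one hs0]
    exact hqs
  set p := ((n : ℝ) - 3 / 2) / 2 with hp
  have hp0 : 0 < p := by positivity
  set F := ((m * logE d) ^ p)⁻¹ * (x ^ ((n : ℝ) / 2))⁻¹ with hF
  have hF0 : 0 ≤ F := by positivity
  have hxn : x ^ ((n : ℝ) / 2) = x ^ ((n : ℝ) / 2 - 1) * x := by
    rw [← Real.rpow_add_one hx.ne']
    congr 1
    ring
  have hL : tailConst n m d * (2 ^ ((m : ℝ) / 2) *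
      ((N : ℝ) ^ (1 / 4 : ℝ) * ((m * logE d)⁻¹) ^ p *
        (((n - 2) / x) ^ ((n : ℝ) / 2 - 1) * (2 / x)))) =
      (1 / 10 ^ 4) ^ m * (2 ^ ((m : ℝ) / 2) * 2) *
        ((d : ℝ) ^ (3 - n - 6 * gap n m) * (N : ℝ) ^ (1 / 4 : ℝ)) * logE d ^ (-p) *
        ((n : ℝ) - 2) ^ ((n : ℝ) / 2 - 1) * F := by
    rw [hF, tailConst, Real.inv_rpow (by positivity), Real.div_rpow (by linarith) hx.le, hxn, ← hp]
    field_simp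
  have hR : gap n m / q * delta₁ n m d q =
      √(Real.pi * n) * (((n : ℝ) - 3 / 2) ^ p * ((2 * Real.exp 1) ^ p)⁻¹) * F := by
    rw [hF, delta₁, ← hxq, ← hp, show 2 * Real.exp 1 * m * logE d = (2 * Real.exp 1) * (m * logE d) by
      ring, Real.div_rpow hn32.le (by positivity), Real.mul_rpow (x := 2 * Real.exp 1)
      (by positivity) (by positivity)]
    field_simp
  rw [hL, hR]
  refine mul_le_mul_of_nonneg_right ?_ hF0
  have hnm2 : n ≤ 2 * m := by omega
  have h1 : (2 * Real.exp 1) ^ p ≤ 6 ^ m := by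
    rw [← Real.rpow_natCast]
    have hpm : p ≤ m := by
      have : (n : ℝ) ≤ 2 * m := by exact_mod_cast hnm2
      rw [hp]; linarith
    calc (2 * Real.exp 1) ^ p ≤ 6 ^ p := by
          gcongr
          linarith [Real.exp_one_lt_d9]
      _ ≤ _ := Real.rpow_le_rpow_of_exponent_le (by norm_num) hpm
  have h2 : (m : ℝ) * 2 ^ n ≤ 8 ^ m := by
    calc (m : ℝ) * 2 ^ n ≤ 2 ^ m * 2 ^ (2 * m) := by
          gcongr
          · exact natCast_le_two_pow m
          · norm_num
      _ = 8 ^ m := by rw [pow_mul, ← mul_pow]; norm_num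
  have h3 : 1 ≤ √(Real.pi * n) := by
    rw [Real.one_le_sqrt]
    nlinarith [Real.pi_gt_three]
  have h4 : (1 / 10 ^ 4 : ℝ) ^ m * (2 ^ ((m : ℝ) / 2) * 2) * (m * 2 ^ n) * 2 ≤
      ((2 * Real.exp 1) ^ p)⁻¹ := by
    rw [← one_div, le_div_iff₀ (by positivity)]
    calc _ ≤ (1 / 10 ^ 4 : ℝ) ^ m * (2 ^ m * 2 ^ m) * 8 ^ m * 2 ^ m * 6 ^ m := by
          gcongr
          · exact two_rpow_half_le m
          · exact two_le_two_pow hm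
          · exact two_le_two_pow hm
      _ = (1 / 10 ^ 4 : ℝ) ^ m * 384 ^ m := by
          rw [← mul_pow, ← mul_pow, ← mul_pow, ← mul_pow, ← mul_pow, ← mul_pow]; norm_num
      _ ≤ 1 / (4 * m) := pow_mul_pow_le hm (by norm_num) (by norm_num)
      _ ≤ 1 := (one_div_four_mul_le hm).trans (by norm_num)
  have h5 := rpow_mul_rpow_quarter_le hn hnm hd hN
  have h6 : logE d ^ (-p) ≤ 1 := logE_rpow_neg_le_one hn hd
  have h7 := sub_two_rpow_le hn
  rw [← hp] at h7
  have h8 : 0 ≤ ((n : ℝ) - 2) ^ ((n : ℝ) / 2 - 1) := Real.rpow_nonneg (by linarith) _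
  have h9 : 0 ≤ ((n : ℝ) - 3 / 2) ^ p := by positivity
  calc _ ≤ (1 / 10 ^ 4) ^ m * (2 ^ ((m : ℝ) / 2) * 2) * (m * 2 ^ n) * 1 *
        (2 * ((n : ℝ) - 3 / 2) ^ p) := by gcongr
    _ = (1 / 10 ^ 4 : ℝ) ^ m * (2 ^ ((m : ℝ) / 2) * 2) * (m * 2 ^ n) * 2 *
        ((n : ℝ) - 3 / 2) ^ p := by ring
    _ ≤ ((2 * Real.exp 1) ^ p)⁻¹ * ((n : ℝ) - 3 / 2) ^ p := by gcongr
    _ = 1 * (((n : ℝ) - 3 / 2) ^ p * ((2 * Real.exp 1) ^ p)⁻¹) := by ring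
    _ ≤ _ := by gcongr

end TailConstants

/-! ### Moment and logarithmic bounds from the tail. -/

section MomentBounds

variable {Ω : Type*} [MeasurableSpace Ω] {μ : Measure Ω}
  {X : Ω → ENNReal} {n m N d : ℕ} {M q x : ℝ}

theorem qMean_le_of_lintegral_le (hM : 0 < M) (hq : 0 < q) {B : ℝ} (hB : 0 ≤ B)
    (h : ∫⁻ ω, X ω ^ q ∂μ ≤ ENNReal.ofReal (M ^ q * B)) :
    qMean μ X q ≤ ENNReal.ofReal (M * B ^ (1 / q)) := by
  calc qMean μ X q ≤ ENNReal.ofReal (M ^ q * B) ^ (1 / q) :=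
        ENNReal.rpow_le_rpow h (by positivity)
    _ = ENNReal.ofReal (M * B ^ (1 / q)) := by
        rw [ENNReal.ofReal_rpow_of_nonneg (by positivity) (by positivity),
          Real.mul_rpow (by positivity) hB, ← Real.rpow_mul hM.le, mul_one_div_cancel hq.ne',
          Real.rpow_one]

/-- Moments of a random variable whose tail beyond the scale `M` is that of the condition
number. -/
theorem lintegral_rpow_le_of_tailGrowth [IsProbabilityMeasure μ] (hn : 2 ≤ n) (hnm : n ≤ m + 1)
    (hmN : m ≤ N) (hd : 0 < d)
    (hX : Measurable X) (hM : 0 < M)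
    (ht : ∀ w, 0 ≤ w → μ {ω | ENNReal.ofReal (M * Real.exp (w / gap n m)) ≤ X ω} ≤
      ENNReal.ofReal (2 * Real.exp (-(8 * m) - 2 * w) + mainTail n m N d w))
    (hq : 0 < q) (hqs : q < gap n m) (hxq : x = 1 - q / gap n m) {J B : ℝ} (hJ0 : 0 ≤ J)
    (hJ : ∫⁻ w in Set.Ioi 0, ENNReal.ofReal (Real.exp (-x * w) * tailGrowth n m N d w) ≤
      ENNReal.ofReal J)
    (hB : q / gap n m * (2 * Real.exp (-(8 * m)) + tailConst n m d * J) ≤ B) :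
    ∫⁻ ω, X ω ^ q ∂μ ≤ ENNReal.ofReal (M ^ q * (1 + B)) := by
  have hs := half_le_gap hnm
  have hs0 : 0 < gap n m := by linarith
  have hx : 0 < x := by
    rw [hxq, sub_pos, div_lt_one hs0]
    exact hqs
  have hc := tailConst_pos (n := n) (m := m) hd
  have hfin := ae_lt_top_of_tail ht (tendsto_tail hn hnm (by omega) hmN hd)
  have h1 := lintegral_tail_le (n := n) (m := m) hd hx hJ0 hJ
  rw [show 1 - x = q / gap n m by rw [hxq]; ring] at h1
  have hB0 : 0 ≤ q / gap n m * (2 * Real.exp (-(8 * m)) + tailConst n m d * J) := by positivity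
  calc _ ≤ _ := lintegral_rpow_le_of_tail hX hM hs0 hq ht hfin
    _ ≤ ENNReal.ofReal (M ^ q) * (ENNReal.ofReal 1 + ENNReal.ofReal (q / gap n m) *
          ENNReal.ofReal (2 * Real.exp (-(8 * m)) + tailConst n m d * J)) := by
        rw [ENNReal.ofReal_one]
        gcongr
    _ = ENNReal.ofReal (M ^ q *
          (1 + q / gap n m * (2 * Real.exp (-(8 * m)) + tailConst n m d * J))) := by
        rw [← ENNReal.ofReal_mul (by positivity), ← ENNReal.ofReal_add one_pos.le hB0,
          ← ENNReal.ofReal_mul (by positivity)]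
    _ ≤ _ := by gcongr

/-- Away from the critical exponent, x⁻¹ ≤ e log(ed), so the crude integral x^(-m/2-1) is paid for
by powers of d and the factor 10^(-4m). No comparison of N with m log(ed) is needed. -/
theorem lintegral_rpow_le_bulk [IsProbabilityMeasure μ] (hn : 2 ≤ n) (hnm : n ≤ m + 1)
    (hmN : m ≤ N) (hd : 0 < d)
    (hX : Measurable X) (hM : 0 < M)
    (ht : ∀ w, 0 ≤ w → μ {ω | ENNReal.ofReal (M * Real.exp (w / gap n m)) ≤ X ω} ≤
      ENNReal.ofReal (2 * Real.exp (-(8 * m) - 2 * w) + mainTail n m N d w))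
    (hq : 0 < q) (hqs : 1 / (Real.exp 1 * logE d) ≤ 1 - q / gap n m) :
    ∫⁻ ω, X ω ^ q ∂μ ≤ ENNReal.ofReal (M ^ q * (5 / 4)) := by
  have hs := half_le_gap hnm
  have hs0 : 0 < gap n m := by linarith
  have hl := one_le_logE hd
  have hx : 0 < 1 - q / gap n m := lt_of_lt_of_le (by positivity) hqs
  have hqs' : q < gap n m := by rwa [sub_pos, div_lt_one hs0] at hx
  have hq1 : q / gap n m ≤ 1 := by linarith
  have hq0 : 0 < q / gap n m := by positivity
  have hb := bulk_const_le hn hnm (by omega) hd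
  have hc := tailConst_pos (n := n) (m := m) hd
  rw [show (5 / 4 : ℝ) = 1 + 1 / 4 by norm_num]
  refine lintegral_rpow_le_of_tailGrowth hn hnm hmN hd hX hM ht hq hqs' rfl
    (J := 2 * (Real.exp 1 * logE d) ^ ((m : ℝ) / 2 + 1)) (by positivity) ?_ ?_
  · refine (lintegral_tailGrowth_le hn hnm (by omega) hmN hd hx (by linarith)).trans ?_
    refine ENNReal.ofReal_le_ofReal ?_
    gcongr
    rw [inv_le_comm₀ hx (by positivity), ← one_div]
    exact hqs
  · calc _ ≤ 1 * (1 / 4 : ℝ) := by gcongr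
      _ = 1 / 4 := one_mul _

theorem qMean_le_bulk [IsProbabilityMeasure μ] (hn : 2 ≤ n) (hnm : n ≤ m + 1)
    (hmN : m ≤ N) (hd : 0 < d)
    (hX : Measurable X) (hM : 0 < M)
    (ht : ∀ w, 0 ≤ w → μ {ω | ENNReal.ofReal (M * Real.exp (w / gap n m)) ≤ X ω} ≤
      ENNReal.ofReal (2 * Real.exp (-(8 * m) - 2 * w) + mainTail n m N d w))
    (hq : 0 < q) (hqs : 1 / (Real.exp 1 * logE d) ≤ 1 - q / gap n m) {B : ℝ} (hB : 5 / 4 ≤ B) :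
    qMean μ X q ≤ ENNReal.ofReal (M * B ^ (1 / q)) := by
  refine (qMean_le_of_lintegral_le hM hq (by norm_num)
    (lintegral_rpow_le_bulk hn hnm hmN hd hX hM ht hq hqs)).trans ?_
  gcongr

theorem qMean_le_of_ge [IsProbabilityMeasure μ] (hn : 2 ≤ n) (hnm : n ≤ m + 1)
    (hmN : m ≤ N) (hd : 0 < d)
    (hNle : N ≤ m * (2 * d) ^ n) (hN : m * logE d ≤ N)
    (hX : Measurable X) (hM : 0 < M)
    (ht : ∀ w, 0 ≤ w → μ {ω | ENNReal.ofReal (M * Real.exp (w / gap n m)) ≤ X ω} ≤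
      ENNReal.ofReal (2 * Real.exp (-(8 * m) - 2 * w) + mainTail n m N d w))
    (hq : 0 < q) (hqs : q < gap n m) :
    qMean μ X q ≤ ENNReal.ofReal
      (M * (1 + q / ((m : ℝ) - n - q + 2) + delta₁ n m d q + delta₂ n m N d q) ^ (1 / q)) := by
  have hs := half_le_gap hnm
  have hs0 : 0 < gap n m := by linarith
  have hm : 0 < m := by omega
  have hl := one_le_logE hd
  have hn2 : (2 : ℝ) ≤ n := by exact_mod_cast hn
  obtain ⟨x, hxq⟩ : ∃ x, x = 1 - q / gap n m := ⟨_, rfl⟩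
  have hx : 0 < x := by
    rw [hxq, sub_pos, div_lt_one hs0]
    exact hqs
  have hq0 : 0 < q / gap n m := by positivity
  have hx1 : x ≤ 1 := by linarith
  have hsx : (m : ℝ) - n - q + 2 = gap n m * x + 1 / 2 := by
    rw [hxq, mul_sub, mul_div_cancel₀ _ hs0.ne', gap]
    ring
  have h1 := near_const_le_of_ge hn hnm hm hd hx hx1
  have h2 := mid_const_le hn hnm hm hd hNle hq hqs hxq
  have h3 := far_const_le hn hnm hm hmN hd hq hqs hxq
  have hc := tailConst_pos (n := n) (m := m) hd
  have hn3 : 0 ≤ (n - 2) / x := div_nonneg (by linarith) hx.le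
  set a := (N : ℝ) ^ (1 / 4 : ℝ) * ((m * logE d)⁻¹) ^ (((n : ℝ) - 3 / 2) / 2) *
    (((n - 2) / x) ^ ((n : ℝ) / 2 - 1) * (2 / x)) with ha
  set b := (N : ℝ)⁻¹ ^ (gap n m / 2) * ((m * logE d)⁻¹) ^ (((n : ℝ) - 3 / 2) / 2) *
    ((m / x) ^ ((m : ℝ) / 2) * (2 / x)) with hb
  have ha0 : 0 ≤ a := by positivity
  have hb0 : 0 ≤ b := by positivity
  have hB : q / gap n m * (2 * Real.exp (-(8 * m)) +
      tailConst n m d * (2 ^ ((m : ℝ) / 2) * (m * logE d + a + b))) ≤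
      q / ((m : ℝ) - n - q + 2) + delta₁ n m d q + delta₂ n m N d q := by
    calc _ = q / gap n m * ((2 * Real.exp (-(8 * m)) +
            tailConst n m d * (2 ^ ((m : ℝ) / 2) * (m * logE d))) +
            tailConst n m d * (2 ^ ((m : ℝ) / 2) * a) +
            tailConst n m d * (2 ^ ((m : ℝ) / 2) * b)) := by ring
      _ ≤ q / gap n m * (gap n m / (gap n m * x + 1 / 2) + gap n m / q * delta₁ n m d q +
            gap n m / q * delta₂ n m N d q) := by gcongr
      _ = _ := by
          rw [hsx]
          field_simp
  have hB0 : 0 ≤ q / gap n m * (2 * Real.exp (-(8 * m)) +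
      tailConst n m d * (2 ^ ((m : ℝ) / 2) * (m * logE d + a + b))) := by positivity
  rw [add_assoc, add_assoc, ← add_assoc (q / _)]
  exact qMean_le_of_lintegral_le hM hq (by linarith) (lintegral_rpow_le_of_tailGrowth hn hnm hmN hd
    hX hM ht hq hqs hxq (by positivity)
    (lintegral_tailGrowth_le_of_ge hn hnm hm hmN hd hN hx) hB)

theorem qMean_le_of_le [IsProbabilityMeasure μ] (hn : 2 ≤ n) (hnm : n ≤ m + 1)
    (hmN : m ≤ N) (hd : 0 < d)
    (hN : (N : ℝ) ≤ m * logE d) (hX : Measurable X) (hM : 0 < M)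
    (ht : ∀ w, 0 ≤ w → μ {ω | ENNReal.ofReal (M * Real.exp (w / gap n m)) ≤ X ω} ≤
      ENNReal.ofReal (2 * Real.exp (-(8 * m) - 2 * w) + mainTail n m N d w))
    (hq : 0 < q) (hqs : q < gap n m) :
    qMean μ X q ≤ ENNReal.ofReal
      (M * (1 + q / ((m : ℝ) - n - q + 3 / 2) + delta₂ n m N d q) ^ (1 / q)) := by
  have hs := half_le_gap hnm
  have hs0 : 0 < gap n m := by linarith
  have hm : 0 < m := by omega
  have hl := one_le_logE hd
  obtain ⟨x, hxq⟩ : ∃ x, x = 1 - q / gap n m := ⟨_, rfl⟩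
  have hx : 0 < x := by
    rw [hxq, sub_pos, div_lt_one hs0]
    exact hqs
  have hq0 : 0 < q / gap n m := by positivity
  have hx1 : x ≤ 1 := by linarith
  have hsx : (m : ℝ) - n - q + 3 / 2 = gap n m * x := by
    rw [hxq, mul_sub, mul_div_cancel₀ _ hs0.ne', gap]
    ring
  have h1 := near_const_le_of_le hn hnm hm hd hx hx1
  have h3 := far_const_le hn hnm hm hmN hd hq hqs hxq
  have hc := tailConst_pos (n := n) (m := m) hd
  set b := (N : ℝ)⁻¹ ^ (gap n m / 2) * ((m * logE d)⁻¹) ^ (((n : ℝ) - 3 / 2) / 2) *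
    ((m / x) ^ ((m : ℝ) / 2) * (2 / x)) with hb
  have hb0 : 0 ≤ b := by positivity
  have hB : q / gap n m * (2 * Real.exp (-(8 * m)) +
      tailConst n m d * (2 ^ ((m : ℝ) / 2) * (logE d ^ (gap n m / 2) * (1 / x) + b))) ≤
      q / ((m : ℝ) - n - q + 3 / 2) + delta₂ n m N d q := by
    calc _ = q / gap n m * ((2 * Real.exp (-(8 * m)) +
            tailConst n m d * (2 ^ ((m : ℝ) / 2) * (logE d ^ (gap n m / 2) * (1 / x)))) +
            tailConst n m d * (2 ^ ((m : ℝ) / 2) * b)) := by ring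
      _ ≤ q / gap n m * (1 / x + gap n m / q * delta₂ n m N d q) := by gcongr
      _ = _ := by
          rw [hsx]
          field_simp
  have hB0 : 0 ≤ q / gap n m * (2 * Real.exp (-(8 * m)) +
      tailConst n m d * (2 ^ ((m : ℝ) / 2) * (logE d ^ (gap n m / 2) * (1 / x) + b))) := by
    positivity
  rw [add_assoc]
  exact qMean_le_of_lintegral_le hM hq (by linarith) (lintegral_rpow_le_of_tailGrowth hn hnm hmN hd
    hX hM ht hq hqs hxq (by positivity)
    (lintegral_tailGrowth_le_of_le hn hnm hm hmN hd hN hx) hB)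

/-- A logarithmic moment bound from a single power moment. -/
theorem expectedLogLE_of_lintegral_le [IsProbabilityMeasure μ] (hX : Measurable X) (hM : 0 < M) (hq : 0 < q) {B δ : ℝ}
    (hB : 0 ≤ B) (h : ∫⁻ ω, X ω ^ q ∂μ ≤ ENNReal.ofReal (M ^ q * B)) (hδ : 0 < δ)
    (hlow : ∀ᵐ ω ∂μ, ENNReal.ofReal δ ≤ X ω) {b : ℝ} (hb : Real.log M + (B - 1) / q ≤ b) :
    ExpectedLogLE μ X b := by
  have hfin : ∀ᵐ ω ∂μ, X ω < ⊤ := by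
    have h1 := ae_lt_top (hX.pow_const q) (h.trans_lt ENNReal.ofReal_lt_top).ne
    filter_upwards [h1] with ω hω
    by_contra htop
    rw [not_lt, top_le_iff] at htop
    rw [htop, ENNReal.top_rpow_of_pos hq] at hω
    exact lt_irrefl _ hω
  set g : Ω → ℝ := fun ω => (X ω ^ q).toReal with hg
  have hgi : Integrable g μ :=
    integrable_toReal_of_lintegral_ne_top (hX.pow_const q).aemeasurable
      (h.trans_lt ENNReal.ofReal_lt_top).ne
  have hgB : ∫ ω, g ω ∂μ ≤ M ^ q * B := by
    rw [hg, integral_toReal (hX.pow_const q).aemeasurable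
      (ae_lt_top (hX.pow_const q) (h.trans_lt ENNReal.ofReal_lt_top).ne)]
    exact ENNReal.toReal_le_of_le_ofReal (by positivity) h
  set u : Ω → ℝ := fun ω => Real.log M - 1 / q + (q * M ^ q)⁻¹ * g ω with hu
  have hui : Integrable u μ := (integrable_const _).add (hgi.const_mul _)
  have hup : ∀ᵐ ω ∂μ, Real.log δ ≤ Real.log (X ω).toReal ∧ Real.log (X ω).toReal ≤ u ω := by
    filter_upwards [hfin, hlow] with ω h1 h2
    have h3 : δ ≤ (X ω).toReal := by
      rwa [ENNReal.ofReal_le_iff_le_toReal h1.ne] at h2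
    have h4 : 0 < (X ω).toReal := by linarith
    refine ⟨Real.log_le_log hδ h3, ?_⟩
    -- The inequality log y ≤ (y^q - 1)/q at y = X/M gives an integrable majorant of log X; the
    -- constant δ gives the minorant.
    have h5 := Real.log_le_sub_one_of_pos (x := ((X ω).toReal / M) ^ q) (by positivity)
    rw [Real.log_rpow (by positivity), Real.log_div h4.ne' hM.ne', Real.div_rpow h4.le hM.le] at h5
    have h6 : g ω = (X ω).toReal ^ q := by rw [hg, ENNReal.toReal_rpow]
    have h7 : u ω - Real.log M = ((X ω).toReal ^ q / M ^ q - 1) / q := by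
      rw [hu, ← h6]
      field_simp
      ring
    have h8 : Real.log (X ω).toReal - Real.log M ≤ u ω - Real.log M := by
      rw [h7, le_div_iff₀ hq]
      linarith
    linarith
  have hint : Integrable (fun ω => Real.log (X ω).toReal) μ := by
    refine Integrable.mono' (hui.abs.add (integrable_const |Real.log δ|))
      (Real.measurable_log.comp hX.ennreal_toReal).aestronglyMeasurable ?_
    filter_upwards [hup] with ω hω
    rw [Real.norm_eq_abs, abs_le]
    have h1 := neg_abs_le (Real.log δ)
    have h2 := le_abs_self (u ω)
    have h3 := abs_nonneg (u ω)
    have h4 := abs_nonneg (Real.log δ)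
    simp only [Pi.add_apply]
    constructor <;> linarith
  refine ⟨?_, hint, ?_⟩
  · filter_upwards [hfin, hlow] with ω h1 h2
    exact ⟨lt_of_lt_of_le (ENNReal.ofReal_pos.2 hδ) h2, h1⟩
  · calc ∫ ω, Real.log (X ω).toReal ∂μ ≤ ∫ ω, u ω ∂μ :=
          integral_mono_ae hint hui (hup.mono fun ω hω => hω.2)
      _ = Real.log M - 1 / q + (q * M ^ q)⁻¹ * ∫ ω, g ω ∂μ := by
          rw [hu, integral_add (integrable_const _) (hgi.const_mul _), integral_const_mul]
          simp
      _ ≤ Real.log M - 1 / q + (q * M ^ q)⁻¹ * (M ^ q * B) := by gcongr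
      _ = Real.log M + (B - 1) / q := by
          field_simp
          ring
      _ ≤ b := hb

end MomentBounds

/-! ### Proof of the theorem. -/

section Main

/-- Test one coordinate and let ε tend to 0. This gives the almost sure positivity of κ. -/
theorem HasSmallBall.ae_ne_zero {Ω ι : Type*} [MeasurableSpace Ω] [Fintype ι] [Nonempty ι]
    {μ : Measure Ω} [IsProbabilityMeasure μ] {X : Ω → EuclideanSpace ℝ ι} {c₀ : ℝ}
    (hsb : HasSmallBall μ X c₀) : ∀ᵐ ω ∂μ, X ω ≠ 0 := by
  classical
  obtain ⟨i⟩ := ‹Nonempty ι›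
  set θ : EuclideanSpace ℝ ι := EuclideanSpace.single i 1 with hθ
  have hθ0 : θ ≠ 0 := by
    intro h
    simpa [hθ] using congrArg norm h
  have h1 : ∀ ε : ℝ, 0 < ε → μ.real {ω | ¬ X ω ≠ 0} ≤ c₀ * ε := by
    intro ε hε
    refine (measureReal_mono ?_).trans (hsb θ hθ0 ε hε)
    intro ω hω
    simp only [Set.mem_ofPred_eq, not_not] at hω ⊢
    rw [hω, inner_zero_right, abs_zero]
    positivity
  have h2 : μ.real {ω | ¬ X ω ≠ 0} ≤ 0 := by
    have h3 : Filter.Tendsto (fun ε : ℝ => c₀ * ε) (nhdsWithin 0 (Set.Ioi 0)) (nhds (c₀ * 0)) :=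
      ((continuous_const_mul c₀).tendsto 0).mono_left nhdsWithin_le_nhds
    rw [mul_zero] at h3
    exact ge_of_tendsto h3 (by
      filter_upwards [self_mem_nhdsWithin] with ε hε
      exact h1 ε hε)
  have h4 : μ.real {ω | ¬ X ω ≠ 0} = 0 := le_antisymm h2 measureReal_nonneg
  rw [ae_iff]
  rwa [measureReal_eq_zero_iff] at h4

theorem theorem3p7 :
    ∃ C : ℝ, 0 < C ∧
      ∀ (n m : ℕ) (deg : Fin m → ℕ), 2 ≤ n → n ≤ m + 1 → (∀ j, 1 ≤ deg j) →
      ∀ (Ω : Type*) [MeasurableSpace Ω] (μ : Measure Ω) [IsProbabilityMeasure μ]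
        (c : (j : Fin m) → Ω → EuclideanSpace ℝ (MultiIndex n (deg j))) (K c₀ : ℝ),
      (∀ j, Measurable (c j)) → iIndepFun c μ →
      0 < K → (∀ j, IsSubGaussianVector μ (c j) K) →
      0 < c₀ → (∀ j, HasSmallBall μ (c j) c₀) →
      ∀ (d N : ℕ) (M : ℝ) (κ : Ω → ENNReal),
      d = maxDeg deg → N = totalN n deg → M = boundM C K c₀ n m N d →
      κ = (fun ω => kappa deg (fun j => formOfCoeff (c j ω))) →
      ((m : ℝ) * logE d ≤ N →
        (∀ q : ℝ, 0 < q → q < gap n m →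
          qMean μ κ q ≤ ENNReal.ofReal
            (M * (1 + q / ((m : ℝ) - n - q + 2) + delta₁ n m d q + delta₂ n m N d q) ^ (1 / q))) ∧
        (∀ q : ℝ, 0 < q → q ≤ gap n m * (1 - 1 / (2 * logE d)) →
          qMean μ κ q ≤ ENNReal.ofReal (M * (3 * m * logE d / n) ^ (1 / q))) ∧
        (∀ q : ℝ, 0 < q → q ≤ gap n m / 2 →
          qMean μ κ q ≤ ENNReal.ofReal ((4 : ℝ) ^ (1 / q) * M)) ∧
        ExpectedLogLE μ κ (1 + Real.log M)) ∧
      ((N : ℝ) ≤ (m : ℝ) * logE d →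
        (∀ q : ℝ, 0 < q → q < gap n m →
          qMean μ κ q ≤ ENNReal.ofReal
            (M * (1 + q / ((m : ℝ) - n - q + 3 / 2) + delta₂ n m N d q) ^ (1 / q))) ∧
        (∀ q : ℝ, 0 < q → q ≤ gap n m * (1 - m / (Real.exp 1 * N)) →
          qMean μ κ q ≤ ENNReal.ofReal (M * (3 * m * logE d / n) ^ (1 / q))) ∧
        (∀ q : ℝ, 0 < q → q ≤ gap n m / 2 →
          qMean μ κ q ≤ ENNReal.ofReal ((4 : ℝ) ^ (1 / q) * M)) ∧
        ExpectedLogLE μ κ (1 + Real.log M)) := by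
  refine ⟨10 ^ 10, by positivity, ?_⟩
  intro n m deg hn hnm hdeg1 Ω _ μ _ c K c₀ hc hi hK hsg hc₀ hsb d N M κ hd hN hM hκ
  have hm : 0 < m := by omega
  have hdeg : ∀ j, deg j ≤ d := fun j => hd ▸ Finset.le_sup (f := deg) (Finset.mem_univ j)
  have hd0 : 0 < d := lt_of_lt_of_le (hdeg1 ⟨0, hm⟩) (hdeg ⟨0, hm⟩)
  have hmN : m ≤ N := hN ▸ le_totalN (by omega)
  have hNle : N ≤ m * (2 * d) ^ n := hN ▸ totalN_le hd0 hdeg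
  have hM0 : 0 < M := hM ▸ boundM_pos hn hm hmN hd0 (by positivity)
  have hX : Measurable κ := by
    rw [hκ]
    exact (measurable_kappa hn).comp (measurable_pi_lambda _ hc)
  have ht : ∀ w, 0 ≤ w → μ {ω | ENNReal.ofReal (M * Real.exp (w / gap n m)) ≤ κ ω} ≤
      ENNReal.ofReal (2 * Real.exp (-(8 * m) - 2 * w) + mainTail n m N d w) := by
    intro w hw
    rw [hκ, hM, hN]
    exact measure_boundM_mul_exp_le_kappa_le hn hnm hdeg1 hd0 hdeg hc hi hK hsg hc₀ hsb hw
  have hs := half_le_gap hnm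
  have hs0 : 0 < gap n m := by linarith
  have hl := one_le_logE hd0
  have hl0 : 0 < logE d := by linarith
  have hm0 : (0 : ℝ) < m := by exact_mod_cast hm
  have hn0 : (0 : ℝ) < n := by exact_mod_cast (by omega : 0 < n)
  have hN0 : (0 : ℝ) < N := by exact_mod_cast (by omega : 0 < N)
  have he : 2 ≤ Real.exp 1 := by linarith [Real.add_one_le_exp (1 : ℝ)]
  have hratio : 5 / 4 ≤ 3 * m * logE d / n := by
    have hn2m : (n : ℝ) ≤ 2 * m := by exact_mod_cast (by omega : n ≤ 2 * m)
    rw [le_div_iff₀ hn0]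
    nlinarith
  have hle : 1 / (Real.exp 1 * logE d) ≤ 1 / (2 * logE d) := by gcongr
  have hhalf : 1 / (Real.exp 1 * logE d) ≤ 1 / 2 :=
    one_div_le_one_div_of_le two_pos (by nlinarith)
  have hfour : ∀ q : ℝ, 0 < q → q ≤ gap n m / 2 →
      qMean μ κ q ≤ ENNReal.ofReal ((4 : ℝ) ^ (1 / q) * M) := by
    intro q hq hqs
    rw [mul_comm]
    refine qMean_le_bulk hn hnm hmN hd0 hX hM0 ht hq (hhalf.trans ?_) (by norm_num)
    have : q / gap n m ≤ 1 / 2 := by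
      rw [div_le_iff₀ hs0]
      linarith
    linarith
  have hratio_bound : ∀ (q y : ℝ), 0 < q → q ≤ gap n m * (1 - y) →
      1 / (Real.exp 1 * logE d) ≤ y →
      qMean μ κ q ≤ ENNReal.ofReal (M * (3 * m * logE d / n) ^ (1 / q)) := by
    intro q y hq hqs hy
    refine qMean_le_bulk hn hnm hmN hd0 hX hM0 ht hq (hy.trans ?_) hratio
    have : q / gap n m ≤ 1 - y := by
      rw [div_le_iff₀ hs0]
      linarith
    linarith
  have hlog : ExpectedLogLE μ κ (1 + Real.log M) := by
    obtain ⟨δ, hδ, hlow⟩ := exists_le_kappa hn deg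
    have hne : Nonempty (MultiIndex n (deg ⟨0, hm⟩)) := by
      rw [← Fintype.card_pos_iff, card_multiIndex]
      exact Nat.choose_pos (by omega)
    refine expectedLogLE_of_lintegral_le hX hM0 (half_pos hs0) (by norm_num : (0 : ℝ) ≤ 5 / 4)
      (lintegral_rpow_le_bulk hn hnm hmN hd0 hX hM0 ht (half_pos hs0) (hhalf.trans ?_)) hδ ?_ ?_
    · have : gap n m / 2 / gap n m = 1 / 2 := by field_simp
      linarith
    · filter_upwards [(hsb ⟨0, hm⟩).ae_ne_zero] with ω hω
      rw [hκ]
      refine hlow (fun j => c j ω) ?_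
      have : 0 < ‖c ⟨0, hm⟩ ω‖ ^ 2 := by positivity
      exact this.trans_le (Finset.single_le_sum (f := fun j => ‖c j ω‖ ^ 2)
        (fun _ _ => by positivity) (Finset.mem_univ _))
    -- With q = s/2 the excess is 1/(2s), at most 1 since s ≥ 1/2.
    · have : (5 / 4 - 1) / (gap n m / 2) ≤ 1 := by
        rw [div_le_one (by positivity)]
        linarith
      linarith
  refine ⟨fun hNm => ⟨fun q hq hqs => ?_, fun q hq hqs => ?_, hfour, hlog⟩,
    fun hNm => ⟨fun q hq hqs => ?_, fun q hq hqs => ?_, hfour, hlog⟩⟩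
  · exact qMean_le_of_ge hn hnm hmN hd0 hNle hNm hX hM0 ht hq hqs
  · exact hratio_bound q _ hq hqs hle
  · exact qMean_le_of_le hn hnm hmN hd0 hNm hX hM0 ht hq hqs
  · refine hratio_bound q _ hq hqs ?_
    -- The hypothesis N ≤ m log(ed) is exactly 1/(e log(ed)) ≤ m/(eN).
    rw [div_le_div_iff₀ (by positivity) (by positivity)]
    nlinarith

end Main
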